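/- Let $k$ be a field of characteristic $0$ and let $L=\bigoplus_{i\in\mathbb Z}L^i$ be a dg Lie algebra over $k$ with differential $d$ of degree $+1$. Let $L=F_0L\supseteq F_1L\supseteq F_2L\supseteq\cdots$ be a decreasing filtration by graded subspaces with $dF_p\subseteq F_p$ and $[F_p,F_q]\subseteq F_{p+q}$, and assume that $L$ is $L^0$-complete with respect to it: $L^0\subseteq F_1L$, and $L^i\to\varprojlim_p L^i/(F_pL\cap L^i)$ is bijective for every $i$. *The moduli set.* Let $V_L=\{p\in L^1 : dp+\tfrac12[p,p]=0\}$. Let $\exp L^0$ act on $V_L$ by $p\mapsto(\exp b)(d+p)-d$ for $b\in L^0$, where $\exp b=\sum_n \frac1{n!}(\mathrm{ad}\,b)^n$ is computed in $L\oplus k\,d$ with $[b,d]=-db$, and put $M_L=V_L/\exp L^0$. *The coalgebra $\hat C(L)$.* Let $sL$ be the suspension, $(sL)^i=L^{i+1}$, and let $T^c(sL)=\bigoplus_n (sL)^{\otimes n}$ have the deconcatenation coproduct. Let $G_m\subseteq T^c(sL)$ be spanned by the tensors $sx_1\otimes\cdots\otimes sx_n$ such that $n\ge m$, or $x_i\in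 F_{p_i}L$ with $\sum p_i\ge m$ (if $F_1L=L$, the second condition alone gives the same span), and let $\hat T^c(sL)=\varprojlim_m T^c(sL)/G_m$. Then $\hat C(L)\subseteq \hat T^c(sL)$ is the completion of the sub-coalgebra $C(L)$ of graded symmetric tensors, with the extension by continuity of the coproduct and of the coderivation determined by $sx\mapsto -s(dx)$ and $sx\otimes sy+(-1)^{|sx||sy|}sy\otimes sx\mapsto(-1)^{|x|}s[x,y]$. Let $\pi$ denote the projection to the tensors of length one. *Filtered maps and homotopies.* Let $J$ be the unit interval coalgebra: its elements are the formal series $\sum a_it_i+\sum b_i\,t_iu$ with $a_i,b_i\in k$, where $t_i$ has degree $0$ and $t_iu$ has degree $-1$, $\Delta t_n=\sum_{i+j=n}t_i\otimes t_j$, $\Delta(t_nu)=\sum_{i+j=n}(t_iu\otimes t_j+t_i\otimes t_ju)$, $d(t_nu)=(n+1)t_{n+1}$, $dt_n=0$, the counit takes the coefficient $a_0$, and $F_pJ$ consists of the series in the $t_i,t_iu$ with $i\ge p$. The field $k$ is a coalgebra in degree $0$ with $\Delta 1=1\otimes1$, $F_0k=k$ and $F_1k=0$. For $C=k$ or $C=J$,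 a filtered map $f:C\to\hat C(L)$ is a linear map of degree $0$ that preserves filtrations ($\hat C(L)$ being filtered by the kernels of the projections to $T^c(sL)/G_m$), is compatible with differentials, counits and coproducts (with values in completed tensor products), and is such that $\pi f$ maps $F_pC$ to $F_pL$ for all $p$. Two filtered maps $f,g:k\to\hat C(L)$ are filtered homotopic if there is a filtered map $h:J\to\hat C(L)$ with $h(t_0)=f(1)$ and $h\bigl(\sum_i t_i\bigr)=g(1)$. **Theorem.** Lying in the same $\exp L^0$-orbit (that is, $q=(\exp b)(d+p)-d$ for some $b\in L^0$) is an equivalence relation on $V_L$, filtered homotopy is an equivalence relation on the set of filtered maps $k\to\hat C(L)$, and there is a bijection from $M_L$ onto the set of filtered homotopy classes of filtered maps $k\to\hat C(L)$. It sends the class of $p\in V_L$ to the class of the classifying map $\chi(p)$, the filtered map with $\chi(p)(1)=1+sp+sp\otimes sp+\cdots$. -/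

import Mathlib

open scoped TensorProduct

noncomputable section

namespace HomotopyModuli

universe u v w

/-! ### Decreasing filtrations, completions, completed tensor products -/

/-- A decreasing filtration of a vector space, indexed by the natural numbers. -/
structure Filtration (k : Type u) (M : Type v) [Field k] [AddCommGroup M] [Module k M] where
  /-- The subspaces `F_p`. -/
  F : ℕ → Submodule k M
  anti : Antitone F

section Completion

variable {k : Type u} [Field k]
variable {M : Type v} [AddCommGroup M] [Module k M]
variable {N : Type w} [AddCommGroup N] [Module k N]

/-- The completion `lim_p M / F_p`, as a subspace of the product of all the `M / F_p`. -/
def completion (A : Filtration k M) : Submodule k ((p : ℕ) → M ⧸ A.F p) where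
  carrier := {x | ∀ p q (h : p ≤ q), Submodule.factor (A.anti h) (x q) = x p}
  add_mem' := by
    intro x y hx hy p q h
    simp [hx p q h, hy p q h]
  zero_mem' := by
    intro p q h
    simp
  smul_mem' := by
    intro c x hx p q h
    simp [hx p q h]

/-- The filtration of the completion by the kernels of the projections to `M / F_p`. -/
def completionFiltration (A : Filtration k M) : Filtration k (completion A) where
  F p := LinearMap.ker ((LinearMap.proj p).comp (completion A).subtype)
  anti := by
    intro p q h x hx
    have h1 : x.1 q = 0 := hx
    have h2 := x.2 p q h
    rw [h1, map_zero] at h2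
    exact h2.symm

/-- The canonical map of `M` to its completion. -/
def toCompletion (A : Filtration k M) : M →ₗ[k] completion A where
  toFun m := ⟨fun p => (A.F p).mkQ m, fun p q h => Submodule.factor_mk (A.anti h) m⟩
  map_add' := by
    intro x y
    ext p
    simp
  map_smul' := by
    intro c x
    ext p
    simp

/-- The map of completions induced by a linear map `f` with `f (F_{p+s} M) ⊆ F_p N` for all `p`. -/
def completionMap (A : Filtration k M) (B : Filtration k N) (f : M →ₗ[k] N) (s : ℕ)
    (h : ∀ p, A.F (p + s) ≤ (B.F p).comap f) : completion A →ₗ[k] completion B where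
  toFun x := ⟨fun p => Submodule.mapQ _ _ f (h p) (x.1 (p + s)), by
    intro p q hpq
    have h2 := x.2 (p + s) (q + s) (by omega)
    obtain ⟨m, hm⟩ := Submodule.mkQ_surjective _ (x.1 (q + s))
    have h3 : Submodule.mkQ _ m = x.1 (p + s) := by
      rw [← h2, ← hm]
      rfl
    change Submodule.factor (B.anti hpq) (Submodule.mapQ _ _ f (h q) (x.1 (q + s)))
      = Submodule.mapQ _ _ f (h p) (x.1 (p + s))
    rw [← hm, ← h3]
    rfl⟩
  map_add' := by
    intro x y
    ext p
    simp
  map_smul' := by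
    intro c x
    ext p
    simp

/-- The filtration `F_n (M ⊗ N) = ∑_{p + q ≥ n} F_p M ⊗ F_q N` of a tensor product. -/
def tensorFiltration (A : Filtration k M) (B : Filtration k N) : Filtration k (M ⊗[k] N) where
  F n := Submodule.span k {z | ∃ p q : ℕ, n ≤ p + q ∧ ∃ x ∈ A.F p, ∃ y ∈ B.F q, z = x ⊗ₜ[k] y}
  anti := by
    intro m n h
    apply Submodule.span_mono
    rintro z ⟨p, q, hpq, hz⟩
    exact ⟨p, q, h.trans hpq, hz⟩

/-- The completed tensor product `M ⊗̂ N`. -/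
abbrev completedTensor (A : Filtration k M) (B : Filtration k N) :
    Submodule k ((n : ℕ) → (M ⊗[k] N) ⧸ (tensorFiltration A B).F n) :=
  completion (tensorFiltration A B)

theorem tensorFiltration_map {M' : Type*} {N' : Type*} [AddCommGroup M'] [Module k M']
    [AddCommGroup N'] [Module k N']
    (A : Filtration k M) (B : Filtration k N) (A' : Filtration k M') (B' : Filtration k N')
    (f : M →ₗ[k] M') (g : N →ₗ[k] N') (hf : ∀ p, A.F p ≤ (A'.F p).comap f)
    (hg : ∀ p, B.F p ≤ (B'.F p).comap g) (n : ℕ) :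
    (tensorFiltration A B).F n ≤
      ((tensorFiltration A' B').F n).comap (TensorProduct.map f g) := by
  refine Submodule.span_le.2 ?_
  rintro z ⟨p, q, hpq, x, hx, y, hy, rfl⟩
  exact Submodule.subset_span ⟨p, q, hpq, f x, hf p hx, g y, hg q hy, by simp⟩

/-- The map `f ⊗̂ f` of completed tensor squares induced by a filtration preserving `f`. -/
def completedSquare (A : Filtration k M) (B : Filtration k N) (f : M →ₗ[k] N)
    (hf : ∀ p, A.F p ≤ (B.F p).comap f) : completedTensor A A →ₗ[k] completedTensor B B :=
  completionMap _ _ (TensorProduct.map f f) 0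
    (fun n => tensorFiltration_map A A B B f f hf hf n)

end Completion

/-! ### Filtered differential graded coalgebras and their maps -/

/-- The data of a filtered counital dg coalgebra with coproduct `Δ : X → X ⊗̂ X`.  It is used only
for the concrete coalgebras built below. -/
structure DGCoalgebraData (k : Type u) (X : Type v) [Field k] [AddCommGroup X] [Module k X] where
  deg : ℤ → Submodule k X
  fil : Filtration k X
  d : X →ₗ[k] X
  counit : X →ₗ[k] k
  comul : X →ₗ[k] completedTensor fil fil

/-- A map of filtered dg coalgebras: linear, of degree zero, filtration preserving, and compatible
with differentials, counits and coproducts. -/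
structure DGCoalgebraMap {k : Type u} {X : Type v} {Y : Type w} [Field k] [AddCommGroup X]
    [Module k X] [AddCommGroup Y] [Module k Y] (C : DGCoalgebraData k X) (D : DGCoalgebraData k Y)
    where
  toLin : X →ₗ[k] Y
  map_deg : ∀ i, ∀ x ∈ C.deg i, toLin x ∈ D.deg i
  map_fil : ∀ p, C.fil.F p ≤ (D.fil.F p).comap toLin
  map_d : ∀ x, toLin (C.d x) = D.d (toLin x)
  map_counit : ∀ x, D.counit (toLin x) = C.counit x
  map_comul : ∀ x, completedSquare C.fil D.fil toLin map_fil (C.comul x) = D.comul (toLin x)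

section Domains

variable (k : Type u) [Field k]

/-- The filtration of the ground field with `F_0 = k` and `F_p = 0` for `p > 0`. -/
def pointFiltration : Filtration k k where
  F p := if p = 0 then ⊤ else ⊥
  anti := by
    intro p q h
    by_cases hq : q = 0
    · have hp : p = 0 := by omega
      simp [hp, hq]
    · simp [hq]

/-- The ground field as a coalgebra (the "point"): degree zero, `d = 0`, `Δ 1 = 1 ⊗ 1`. -/
def point : DGCoalgebraData k k where
  deg i := if i = 0 then ⊤ else ⊥
  fil := pointFiltration k
  d := 0
  counit := LinearMap.id
  comul := (toCompletion _).comp (TensorProduct.mk k k k 1)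

/-- The space underlying the unit interval coalgebra `J`: the pair `(a, b)` stands for the formal
series `∑ a_i t_i + ∑ b_i t_i u`. -/
abbrev IntervalSpace : Type u := (ℕ → k) × (ℕ → k)

variable {k}

/-- The element `t_i` of `J`. -/
def tElt (i : ℕ) : IntervalSpace k := (Pi.single i 1, 0)

/-- The element `t_i u` of `J`. -/
def tuElt (i : ℕ) : IntervalSpace k := (0, Pi.single i 1)

variable (k)

/-- `F_p J` consists of the series in the `t_i` and `t_i u` with `i ≥ p`. -/
def intervalFiltration : Filtration k (IntervalSpace k) where
  F p :=
    { carrier := {x | ∀ i < p, x.1 i = 0 ∧ x.2 i = 0}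
      add_mem' := by
        intro x y hx hy i hi
        simp [hx i hi, hy i hi]
      zero_mem' := by
        intro i hi
        simp
      smul_mem' := by
        intro c x hx i hi
        simp [hx i hi] }
  anti := by
    intro p q h x hx i hi
    exact hx i (lt_of_lt_of_le hi h)

variable {k}

theorem tElt_mem (i : ℕ) : tElt i ∈ (intervalFiltration k).F i := by
  intro j hj
  simp [tElt, hj.ne]

theorem tuElt_mem (i : ℕ) : tuElt i ∈ (intervalFiltration k).F i := by
  intro j hj
  simp [tuElt, hj.ne]

/-- For `x = ∑ a_n t_n + ∑ b_n t_n u`, the degree `n` part of `Δ x`, given by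
`Δ t_n = ∑_{i + j = n} t_i ⊗ t_j` and
`Δ (t_n u) = ∑_{i + j = n} (t_i u ⊗ t_j + t_i ⊗ t_j u)`. -/
def intervalComulTerm (n : ℕ) : IntervalSpace k →ₗ[k] IntervalSpace k ⊗[k] IntervalSpace k where
  toFun x := ∑ ij ∈ Finset.HasAntidiagonal.antidiagonal n,
    (x.1 n • (tElt ij.1 ⊗ₜ[k] tElt ij.2) +
      x.2 n • (tuElt ij.1 ⊗ₜ[k] tElt ij.2 + tElt ij.1 ⊗ₜ[k] tuElt ij.2))
  map_add' := by
    intro x y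
    rw [← Finset.sum_add_distrib]
    refine Finset.sum_congr rfl fun ij _ => ?_
    simp only [Prod.fst_add, Prod.snd_add, Pi.add_apply, add_smul]
    abel
  map_smul' := by
    intro c x
    rw [RingHom.id_apply, Finset.smul_sum]
    refine Finset.sum_congr rfl fun ij _ => ?_
    simp only [Prod.smul_fst, Prod.smul_snd, Pi.smul_apply, smul_add, smul_smul, smul_eq_mul]

theorem intervalComulTerm_mem (n : ℕ) (x : IntervalSpace k) :
    intervalComulTerm n x ∈
      (tensorFiltration (intervalFiltration k) (intervalFiltration k)).F n := by
  rw [intervalComulTerm, LinearMap.coe_mk, AddHom.coe_mk]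
  refine Submodule.sum_mem _ fun ij hij => ?_
  have hn : n ≤ ij.1 + ij.2 := (Finset.HasAntidiagonal.mem_antidiagonal.1 hij).ge
  refine Submodule.add_mem _ (Submodule.smul_mem _ _ ?_) (Submodule.smul_mem _ _
    (Submodule.add_mem _ ?_ ?_))
  · exact Submodule.subset_span ⟨_, _, hn, _, tElt_mem _, _, tElt_mem _, rfl⟩
  · exact Submodule.subset_span ⟨_, _, hn, _, tuElt_mem _, _, tElt_mem _, rfl⟩
  · exact Submodule.subset_span ⟨_, _, hn, _, tElt_mem _, _, tuElt_mem _, rfl⟩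

/-- The coproduct `Δ : J → J ⊗̂ J`. -/
def intervalComul : IntervalSpace k →ₗ[k]
    completedTensor (intervalFiltration k) (intervalFiltration k) where
  toFun x := ⟨fun p => Submodule.mkQ _ (∑ n ∈ Finset.range p, intervalComulTerm n x), by
    intro p q h
    rw [Submodule.factor_mk, ← sub_eq_zero, ← map_sub, Submodule.mkQ_apply,
      Submodule.Quotient.mk_eq_zero, ← Finset.sum_range_add_sum_Ico _ h, add_sub_cancel_left]
    refine Submodule.sum_mem _ fun n hn => ?_
    exact (tensorFiltration _ _).anti (Finset.mem_Ico.1 hn).1 (intervalComulTerm_mem n x)⟩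
  map_add' := by
    intro x y
    ext p
    simp only [map_add, Finset.sum_add_distrib]
    rfl
  map_smul' := by
    intro c x
    ext p
    simp only [map_smul, ← Finset.smul_sum]
    rfl

variable (k)

/-- The unit interval coalgebra `J`, with `t_i` in degree `0`, `t_i u` in degree `-1` and
`d (t_i u) = (i + 1) t_{i+1}`; it is the completed dual of the algebra `k[t, dt]`. -/
def interval : DGCoalgebraData k (IntervalSpace k) where
  deg i := if i = 0 then LinearMap.ker (LinearMap.snd k (ℕ → k) (ℕ → k))
    else if i = -1 then LinearMap.ker (LinearMap.fst k (ℕ → k) (ℕ → k)) else ⊥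
  fil := intervalFiltration k
  d :=
    { toFun := fun x => (fun n => (n : k) * x.2 (n - 1), 0)
      map_add' := by
        intro x y
        ext n <;> simp [mul_add]
      map_smul' := by
        intro c x
        ext n <;> simp [mul_left_comm] }
  counit := (LinearMap.proj 0).comp (LinearMap.fst k (ℕ → k) (ℕ → k))
  comul := intervalComul

end Domains

/-! ### Complete dg Lie algebras -/

/-- A `ℤ`-graded dg Lie algebra over `k`, with differential of degree `+1`. -/
structure DGLieAlgebra (k : Type u) (L : Type v) [Field k] [AddCommGroup L] [Module k L] where
  deg : ℤ → Submodule k L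
  isInternal : DirectSum.IsInternal deg
  bracket : L →ₗ[k] L →ₗ[k] L
  d : L →ₗ[k] L
  bracket_mem : ∀ i j, ∀ x ∈ deg i, ∀ y ∈ deg j, bracket x y ∈ deg (i + j)
  bracket_skew : ∀ i j, ∀ x ∈ deg i, ∀ y ∈ deg j,
    bracket x y = -((i * j).negOnePow • bracket y x)
  jacobi : ∀ i j, ∀ x ∈ deg i, ∀ y ∈ deg j, ∀ z,
    bracket x (bracket y z) = bracket (bracket x y) z + (i * j).negOnePow • bracket y (bracket x z)
  d_mem : ∀ i, ∀ x ∈ deg i, d x ∈ deg (i + 1)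
  d_d : ∀ x, d (d x) = 0
  leibniz : ∀ i, ∀ x ∈ deg i, ∀ y, d (bracket x y) = bracket (d x) y + i.negOnePow • bracket x (d y)

section Grading

variable {k : Type u} [Field k] {L : Type v} [AddCommGroup L] [Module k L]

/-- The decomposition of `L` as the direct sum of its homogeneous parts. -/
def DGLieAlgebra.decompose (A : DGLieAlgebra k L) : L ≃ₗ[k] DirectSum ℤ (fun i => A.deg i) :=
  (LinearEquiv.ofBijective (DirectSum.coeLinearMap A.deg) A.isInternal).symm

/-- The operator `x ↦ (-1)^|x| x`. -/
def DGLieAlgebra.parity (A : DGLieAlgebra k L) : L →ₗ[k] L :=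
  (DirectSum.toModule k ℤ L (fun i => (i.negOnePow : ℤ) • (A.deg i).subtype)).comp
    A.decompose.toLinearMap

end Grading

/-- A decreasing dg Lie filtration `L = F_0 ⊇ F_1 ⊇ ...` of `L` for which `L` is `L^0`-complete:
`L^0` has positive filtration (so bracketing with `L^0` raises the filtration), and every `L^i` is
complete, that is, `L^i → lim_p L^i / F_p L^i` is bijective. -/
structure CompleteFiltration {k : Type u} {L : Type v} [Field k] [AddCommGroup L] [Module k L]
    (A : DGLieAlgebra k L) extends Filtration k L where
  F_zero : F 0 = ⊤
  homogeneous : ∀ p, ∀ x ∈ F p, ∀ i, (A.decompose x i : L) ∈ F p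
  d_mem : ∀ p, ∀ x ∈ F p, A.d x ∈ F p
  bracket_mem : ∀ p q, ∀ x ∈ F p, ∀ y ∈ F q, A.bracket x y ∈ F (p + q)
  deg_zero_le : A.deg 0 ≤ F 1
  separated : ∀ i, ∀ x ∈ A.deg i, (∀ p, x ∈ F p) → x = 0
  complete : ∀ i, ∀ x : ℕ → L, (∀ p, x p ∈ A.deg i) → (∀ p, x (p + 1) - x p ∈ F p) →
    ∃ y ∈ A.deg i, ∀ p, y - x p ∈ F p

/-! ### The moduli set `M_L = V_L / exp L^0` -/

section Moduli

variable {k : Type u} [Field k] {L : Type v} [AddCommGroup L] [Module k L]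

/-- The set `V_L` of Maurer-Cartan elements: `p ∈ L^1` with `d p + 1/2 [p, p] = 0`. -/
def MaurerCartan (A : DGLieAlgebra k L) : Type v :=
  {p : L // p ∈ A.deg 1 ∧ A.d p + (2 : k)⁻¹ • A.bracket p p = 0}

/-- For `b ∈ L^0`, the operator `ad b` on `L[d] = L ⊕ k d`, where `(x, c)` stands for `x + c d`:
since `[b, d] = -[d, b] = - d b`, it sends `x + c d` to `[b, x] - c (d b)`. -/
def adIncorporated (A : DGLieAlgebra k L) (b : L) : L × k →ₗ[k] L × k where
  toFun z := (A.bracket b z.1 - z.2 • A.d b, 0)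
  map_add' := by
    intro x y
    ext
    · simp only [Prod.fst_add, Prod.snd_add, map_add, add_smul]
      abel
    · simp
  map_smul' := by
    intro c x
    ext
    · simp [smul_sub, smul_smul]
    · simp

/-- The `n`-th partial sum of `(exp b) (d + p)` in `L[d]`. -/
def expPartialSum (A : DGLieAlgebra k L) (b p : L) (n : ℕ) : L × k :=
  ∑ i ∈ Finset.range n, ((i.factorial : k)⁻¹) • ((adIncorporated A b) ^ i) (p, 1)

variable {A : DGLieAlgebra k L}

/-- `(exp b) (d + p) - d = q`, the series being taken in the topology of the filtration. -/
def GaugeAct (F : CompleteFiltration A) (b p q : L) : Prop :=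
  ∀ m, ∃ n₀, ∀ n ≥ n₀, (expPartialSum A b p n).2 = 1 ∧ (expPartialSum A b p n).1 - q ∈ F.F m

/-- Two Maurer-Cartan elements are in the same orbit of `exp L^0`. -/
def GaugeEquivalent (F : CompleteFiltration A) (p q : MaurerCartan A) : Prop :=
  ∃ b ∈ A.deg 0, GaugeAct F b p.1 q.1

/-- The moduli set `M_L = V_L / exp L^0`. -/
def ModuliSet (F : CompleteFiltration A) : Type v := Quot (GaugeEquivalent F)

end Moduli

/-! ### The tensor coalgebra on `sL`

The underlying space of the suspension `sL` is `L`, an element of `L^i` having degree `i - 1` in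
`sL`.  The space underlying the tensor coalgebra is `TensorAlgebra k L`; its concatenation product
is only used to write tensors down. -/

section Tensor

variable {k : Type u} [Field k] {L : Type v} [AddCommGroup L] [Module k L]

/-- The tensor `x_1 ⊗ ... ⊗ x_n`. -/
def word (l : List L) : TensorAlgebra k L := (l.map (TensorAlgebra.ι k)).prod

variable (k L)

/-- An auxiliary recursion for the deconcatenation, which satisfies
`Δ (x ⊗ w) = 1 ⊗ (x ⊗ w) + (x ⊗ 1) Δ w`. -/
def deconcatenationStep :
    L →ₗ[k] Module.End k (TensorAlgebra k L × (TensorAlgebra k L ⊗[k] TensorAlgebra k L)) where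
  toFun x :=
    { toFun := fun z => (TensorAlgebra.ι k x * z.1,
        1 ⊗ₜ[k] (TensorAlgebra.ι k x * z.1) + (TensorAlgebra.ι k x ⊗ₜ[k] 1) * z.2)
      map_add' := by
        intro y z
        ext
        · simp [mul_add]
        · simp only [Prod.fst_add, Prod.snd_add, mul_add, TensorProduct.tmul_add]
          abel
      map_smul' := by
        intro c z
        ext <;> simp }
  map_add' := by
    intro x y
    refine LinearMap.ext fun z => ?_
    ext
    · simp [add_mul]
    · simp only [map_add, add_mul, TensorProduct.tmul_add, TensorProduct.add_tmul,
        LinearMap.coe_mk, AddHom.coe_mk, LinearMap.add_apply, Prod.snd_add]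
      abel
  map_smul' := by
    intro c x
    refine LinearMap.ext fun z => ?_
    ext
    · simp
    · simp [← TensorProduct.smul_tmul']

/-- The deconcatenation coproduct
`Δ (x_1 ⊗ ... ⊗ x_n) = ∑ (x_1 ⊗ ... ⊗ x_p) ⊗ (x_{p+1} ⊗ ... ⊗ x_n)`. -/
def deconcatenation : TensorAlgebra k L →ₗ[k] TensorAlgebra k L ⊗[k] TensorAlgebra k L where
  toFun t := (TensorAlgebra.lift k (deconcatenationStep k L) t (1, 1 ⊗ₜ[k] 1)).2
  map_add' := by
    intro x y
    simp
  map_smul' := by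
    intro c x
    simp

variable {k L}

theorem deconcatenation_one : deconcatenation k L 1 = 1 ⊗ₜ[k] 1 := by
  simp [deconcatenation]

theorem lift_deconcatenationStep_fst (t : TensorAlgebra k L) (a : TensorAlgebra k L)
    (b : TensorAlgebra k L ⊗[k] TensorAlgebra k L) :
    (TensorAlgebra.lift k (deconcatenationStep k L) t (a, b)).1 = t * a := by
  induction t using TensorAlgebra.induction generalizing a b with
  | algebraMap r => simp [Algebra.smul_def]
  | ι x => simp [deconcatenationStep]
  | mul x y hx hy =>
    rw [map_mul, Module.End.mul_apply, mul_assoc, ← hy a b]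
    exact hx _ _
  | add x y hx hy => simp [hx, hy, add_mul]

theorem deconcatenation_ι_mul (x : L) (t : TensorAlgebra k L) :
    deconcatenation k L (TensorAlgebra.ι k x * t) =
      1 ⊗ₜ[k] (TensorAlgebra.ι k x * t) + (TensorAlgebra.ι k x ⊗ₜ[k] 1) * deconcatenation k L t := by
  have h := lift_deconcatenationStep_fst (k := k) t 1 (1 ⊗ₜ[k] 1)
  rw [mul_one] at h
  change (TensorAlgebra.lift k (deconcatenationStep k L) (TensorAlgebra.ι k x * t)
    (1, 1 ⊗ₜ[k] 1)).2 = _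
  rw [map_mul, Module.End.mul_apply, TensorAlgebra.lift_ι_apply]
  change 1 ⊗ₜ[k] (TensorAlgebra.ι k x *
    (TensorAlgebra.lift k (deconcatenationStep k L) t (1, 1 ⊗ₜ[k] 1)).1) + _ = _
  rw [h]
  rfl

variable (k L)

/-- The projection `π` of the tensor coalgebra to the tensors of length one. -/
def cogenerator : TensorAlgebra k L →ₗ[k] L := TensorAlgebra.ιInv

/-- The projection to the tensors of length two. -/
def lengthTwo : TensorAlgebra k L →ₗ[k] L ⊗[k] L :=
  (TensorProduct.map (cogenerator k L) (cogenerator k L)).comp (deconcatenation k L)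

/-- The iterated deconcatenation, with values in `T ⊗ (T ⊗ T)`. -/
def deconcatenation₃ : TensorAlgebra k L →ₗ[k]
    TensorAlgebra k L ⊗[k] (TensorAlgebra k L ⊗[k] TensorAlgebra k L) :=
  (TensorProduct.map LinearMap.id (deconcatenation k L)).comp (deconcatenation k L)

variable {k L}

/-- The operator `sx ↦ (-1)^|sx| sx` on `sL`. -/
def suspendedParity (A : DGLieAlgebra k L) : L →ₗ[k] L := -A.parity

/-- The operator `w ↦ (-1)^|w| w` on the tensor coalgebra of `sL`. -/
def tensorParity (A : DGLieAlgebra k L) : TensorAlgebra k L →ₗ[k] TensorAlgebra k L :=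
  (TensorAlgebra.lift k ((TensorAlgebra.ι k).comp (suspendedParity A))).toLinearMap

/-- The linear map cogenerating the differential: it is `sx ↦ - s(dx)` on tensors of length one,
`sx ⊗ sy ↦ 1/2 (-1)^|x| s[x, y]` on tensors of length two (so that
`sx ⊗ sy + (-1)^{|sx||sy|} sy ⊗ sx ↦ (-1)^|x| s[x, y]`), and zero on all other lengths. -/
def cogeneratingMap (A : DGLieAlgebra k L) : TensorAlgebra k L →ₗ[k] L :=
  (2 : k)⁻¹ • (TensorProduct.lift (A.bracket.comp A.parity)).comp (lengthTwo k L)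
    - A.d.comp (cogenerator k L)

/-- The coderivation of degree one of the tensor coalgebra cogenerated by `cogeneratingMap`:
`w ↦ ∑ (-1)^|w₁| w₁ ⊗ γ(w₂) ⊗ w₃` over all decompositions `w = w₁ ⊗ w₂ ⊗ w₃`. -/
def coderivation (A : DGLieAlgebra k L) : TensorAlgebra k L →ₗ[k] TensorAlgebra k L :=
  (LinearMap.mul' k (TensorAlgebra k L)).comp
    ((TensorProduct.map (tensorParity A)
      ((LinearMap.mul' k (TensorAlgebra k L)).comp
        (TensorProduct.map ((TensorAlgebra.ι k).comp (cogeneratingMap A)) LinearMap.id))).comp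
      (deconcatenation₃ k L))

/-- The signed exchange `sx ⊗ sy ↦ (-1)^{|sx||sy|} sy ⊗ sx`, written by means of the operator `ε` of
`suspendedParity` as the plain exchange composed with
`1/2 (1 ⊗ 1 + ε ⊗ 1 + 1 ⊗ ε - ε ⊗ ε)`. -/
def signedSwap (A : DGLieAlgebra k L) : L ⊗[k] L →ₗ[k] L ⊗[k] L :=
  (TensorProduct.comm k L L).toLinearMap.comp
    ((2 : k)⁻¹ • (LinearMap.id
      + TensorProduct.map (suspendedParity A) LinearMap.id
      + TensorProduct.map LinearMap.id (suspendedParity A)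
      - TensorProduct.map (suspendedParity A) (suspendedParity A)))

/-- The map that sends a tensor to the family of all its decompositions
`w₁ ⊗ (x ⊗ y) ⊗ w₂` with `x, y` of length one. -/
def adjacentPairs (k : Type u) [Field k] (L : Type v) [AddCommGroup L] [Module k L] :
    TensorAlgebra k L →ₗ[k] TensorAlgebra k L ⊗[k] ((L ⊗[k] L) ⊗[k] TensorAlgebra k L) :=
  (TensorProduct.map LinearMap.id (TensorProduct.map (lengthTwo k L) LinearMap.id)).comp
    (deconcatenation₃ k L)

/-- The subspace `S^c(sL)` of graded symmetric tensors: those invariant under all signed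
permutations, that is, under the signed exchange of any two adjacent factors. -/
def symmetricTensors (A : DGLieAlgebra k L) : Submodule k (TensorAlgebra k L) :=
  LinearMap.ker ((TensorProduct.map LinearMap.id
    (TensorProduct.map (signedSwap A) LinearMap.id)).comp (adjacentPairs k L) - adjacentPairs k L)

/-- The tensors of degree `m`, spanned by the `sx_1 ⊗ ... ⊗ sx_n` with `x_i` homogeneous and
`∑ (|x_i| - 1) = m`. -/
def tensorDeg (A : DGLieAlgebra k L) (m : ℤ) : Submodule k (TensorAlgebra k L) :=
  Submodule.span k {t | ∃ l : List (L × ℤ), (∀ a ∈ l, a.1 ∈ A.deg a.2) ∧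
    (l.map (fun a => a.2 - 1)).sum = m ∧ t = word (l.map Prod.fst)}

variable {A : DGLieAlgebra k L}

/-- The filtration used to complete the tensor coalgebra: `G_m` is spanned by the
`sx_1 ⊗ ... ⊗ sx_n` such that either `x_i ∈ F_{p_i}` with `∑ p_i ≥ m`, or `n ≥ m`.  If `L = F_1 L`,
the first alternative contains the second one, and this is the filtration induced by that of `L`. -/
def tensorCoalgebraFiltration (F : CompleteFiltration A) : Filtration k (TensorAlgebra k L) where
  F m := Submodule.span k {t | ∃ l : List (L × ℕ), (∀ a ∈ l, a.1 ∈ F.F a.2) ∧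
    (m ≤ (l.map Prod.snd).sum ∨ m ≤ l.length) ∧ t = word (l.map Prod.fst)}
  anti := by
    intro m n h
    apply Submodule.span_mono
    rintro t ⟨l, hl, hn, ht⟩
    exact ⟨l, hl, hn.imp h.trans h.trans, ht⟩

/-! ### Continuity of the coproduct and of the coderivation -/

theorem word_nil : word (k := k) ([] : List L) = 1 := rfl

theorem word_cons (x : L) (l : List L) :
    word (k := k) (x :: l) = TensorAlgebra.ι k x * word l := rfl

theorem word_append (l l' : List L) :
    word (k := k) (l ++ l') = word l * word l' := by
  simp [word]

theorem deconcatenation_word (l : List L) :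
    deconcatenation k L (word l) ∈ Submodule.span k
      {z | ∃ l₁ l₂ : List L, l₁ ++ l₂ = l ∧ z = word l₁ ⊗ₜ[k] word l₂} := by
  induction l with
  | nil =>
    rw [word_nil, deconcatenation_one]
    exact Submodule.subset_span ⟨[], [], rfl, rfl⟩
  | cons x l ih =>
    rw [word_cons, deconcatenation_ι_mul]
    refine Submodule.add_mem _ (Submodule.subset_span ⟨[], x :: l, rfl, rfl⟩) ?_
    have h : ∀ z ∈ Submodule.span k {z : TensorAlgebra k L ⊗[k] TensorAlgebra k L |
        ∃ l₁ l₂ : List L, l₁ ++ l₂ = l ∧ z = word l₁ ⊗ₜ[k] word l₂},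
        (TensorAlgebra.ι k x ⊗ₜ[k] 1) * z ∈ Submodule.span k
          {z : TensorAlgebra k L ⊗[k] TensorAlgebra k L |
            ∃ l₁ l₂ : List L, l₁ ++ l₂ = x :: l ∧ z = word l₁ ⊗ₜ[k] word l₂} := by
      intro z hz
      induction hz using Submodule.span_induction with
      | mem z hz =>
        obtain ⟨l₁, l₂, h, rfl⟩ := hz
        exact Submodule.subset_span ⟨x :: l₁, l₂, by simp [h], by
          simp [word_cons]⟩
      | zero => simp
      | add a b _ _ ha hb =>
        rw [mul_add]
        exact Submodule.add_mem _ ha hb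
      | smul c a _ ha =>
        rw [mul_smul_comm]
        exact Submodule.smul_mem _ c ha
    exact h _ ih

theorem deconcatenation₃_word (l : List L) :
    deconcatenation₃ k L (word l) ∈ Submodule.span k
      {z | ∃ l₁ l₂ l₃ : List L, l₁ ++ (l₂ ++ l₃) = l ∧
        z = word l₁ ⊗ₜ[k] (word l₂ ⊗ₜ[k] word l₃)} := by
  have h : ∀ z ∈ Submodule.span k {z : TensorAlgebra k L ⊗[k] TensorAlgebra k L |
      ∃ l₁ l₂ : List L, l₁ ++ l₂ = l ∧ z = word l₁ ⊗ₜ[k] word l₂},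
      TensorProduct.map LinearMap.id (deconcatenation k L) z ∈ Submodule.span k
        {z | ∃ l₁ l₂ l₃ : List L, l₁ ++ (l₂ ++ l₃) = l ∧
          z = word l₁ ⊗ₜ[k] (word l₂ ⊗ₜ[k] word l₃)} := by
    intro z hz
    induction hz using Submodule.span_induction with
    | mem z hz =>
      obtain ⟨l₁, l₂, h, rfl⟩ := hz
      rw [TensorProduct.map_tmul, LinearMap.id_apply]
      have h2 := Submodule.mem_map_of_mem 
        (f := TensorProduct.mk k (TensorAlgebra k L) (TensorAlgebra k L ⊗[k] TensorAlgebra k L)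
          (word l₁))
        (deconcatenation_word (k := k) l₂)
      rw [Submodule.map_span] at h2
      refine Submodule.span_mono (R := k) ?_ h2
      rintro _ ⟨_, ⟨l₃, l₄, h34, rfl⟩, rfl⟩
      exact ⟨l₁, l₃, l₄, by rw [h34, h], rfl⟩
    | zero => simp
    | add a b _ _ ha hb =>
      rw [map_add]
      exact Submodule.add_mem _ ha hb
    | smul c a _ ha =>
      rw [map_smul]
      exact Submodule.smul_mem _ c ha
  exact h _ (deconcatenation_word l)

theorem cogenerator_one : cogenerator k L 1 = 0 := by
  let _ : Module kᵐᵒᵖ L := Module.compHom _ ((RingHom.id k).fromOpposite mul_comm)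
  have _ : IsCentralScalar k L := ⟨fun r m => rfl⟩
  change (TensorAlgebra.toTrivSqZeroExt (1 : TensorAlgebra k L)).snd = 0
  rw [map_one, TrivSqZeroExt.snd_one]

theorem cogenerator_ι_mul (x : L) (t : TensorAlgebra k L) :
    cogenerator k L (TensorAlgebra.ι k x * t) = TensorAlgebra.algebraMapInv t • x := by
  let _ : Module kᵐᵒᵖ L := Module.compHom _ ((RingHom.id k).fromOpposite mul_comm)
  have _ : IsCentralScalar k L := ⟨fun r m => rfl⟩
  have h : (TrivSqZeroExt.fstHom k k L).comp TensorAlgebra.toTrivSqZeroExt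
      = TensorAlgebra.algebraMapInv (R := k) (M := L) := by
    apply TensorAlgebra.hom_ext
    ext y
    simp [TensorAlgebra.algebraMapInv]
  change (TensorAlgebra.toTrivSqZeroExt (TensorAlgebra.ι k x * t)).snd = _
  rw [map_mul, TensorAlgebra.toTrivSqZeroExt_ι, TrivSqZeroExt.snd_mul, TrivSqZeroExt.fst_inr,
    zero_smul, zero_add, TrivSqZeroExt.snd_inr, op_smul_eq_smul, ← h]
  rfl

theorem counit_deconcatenation_word (l : List L) :
    TensorProduct.map (TensorAlgebra.algebraMapInv (R := k) (M := L)).toLinearMap LinearMap.id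
      (deconcatenation k L (word l)) = 1 ⊗ₜ[k] word l := by
  cases l with
  | nil => simp [word_nil, deconcatenation_one]
  | cons x l =>
    rw [word_cons, deconcatenation_ι_mul, map_add]
    have h : ∀ z : TensorAlgebra k L ⊗[k] TensorAlgebra k L,
        TensorProduct.map (TensorAlgebra.algebraMapInv (R := k) (M := L)).toLinearMap LinearMap.id
          ((TensorAlgebra.ι k x ⊗ₜ[k] 1) * z) = 0 := by
      intro z
      induction z using TensorProduct.induction_on with
      | zero => simp
      | tmul a b => simp [TensorAlgebra.algebraMapInv]
      | add a b ha hb => rw [mul_add, map_add, ha, hb, add_zero]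
    rw [h]
    simp

theorem lengthTwo_word_nil : lengthTwo k L (word []) = 0 := by
  rw [word_nil, lengthTwo, LinearMap.comp_apply, deconcatenation_one]
  simp [cogenerator_one]

theorem lengthTwo_word_cons (x : L) (l : List L) :
    lengthTwo k L (word (x :: l)) = x ⊗ₜ[k] cogenerator k L (word l) := by
  rw [word_cons, lengthTwo, LinearMap.comp_apply, deconcatenation_ι_mul, map_add,
    TensorProduct.map_tmul, cogenerator_one, TensorProduct.zero_tmul, zero_add]
  have h : ∀ z : TensorAlgebra k L ⊗[k] TensorAlgebra k L,
      TensorProduct.map (cogenerator k L) (cogenerator k L) ((TensorAlgebra.ι k x ⊗ₜ[k] 1) * z) =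
        TensorProduct.map (LinearMap.toSpanSingleton k L x) (cogenerator k L)
          (TensorProduct.map (TensorAlgebra.algebraMapInv (R := k) (M := L)).toLinearMap
            LinearMap.id z) := by
    intro z
    induction z using TensorProduct.induction_on with
    | zero => simp
    | tmul a b => simp [cogenerator_ι_mul]
    | add a b ha hb => rw [mul_add, map_add, map_add, map_add, ha, hb]
  rw [h, counit_deconcatenation_word]
  simp

theorem cogenerator_word_cons_cons (x y : L) (l : List L) :
    cogenerator k L (word (x :: y :: l)) = 0 := by
  rw [word_cons, cogenerator_ι_mul, word_cons]
  simp [TensorAlgebra.algebraMapInv]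

theorem cogenerator_word_singleton (x : L) : cogenerator k L (word [x]) = x := by
  rw [word_cons, cogenerator_ι_mul, word_nil]
  simp

theorem cogeneratingMap_word_nil : cogeneratingMap A (word []) = 0 := by
  rw [cogeneratingMap, LinearMap.sub_apply, LinearMap.smul_apply, LinearMap.comp_apply,
    LinearMap.comp_apply, lengthTwo_word_nil, word_nil, cogenerator_one]
  simp

theorem cogeneratingMap_word_singleton (x : L) : cogeneratingMap A (word [x]) = -A.d x := by
  rw [cogeneratingMap, LinearMap.sub_apply, LinearMap.smul_apply, LinearMap.comp_apply,
    LinearMap.comp_apply, lengthTwo_word_cons, cogenerator_word_singleton, word_nil,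
    cogenerator_one]
  simp

theorem cogeneratingMap_word_pair (x y : L) :
    cogeneratingMap A (word [x, y]) = (2 : k)⁻¹ • A.bracket (A.parity x) y := by
  rw [cogeneratingMap, LinearMap.sub_apply, LinearMap.smul_apply, LinearMap.comp_apply,
    LinearMap.comp_apply, lengthTwo_word_cons, cogenerator_word_singleton,
    cogenerator_word_cons_cons]
  simp

theorem cogeneratingMap_word_long (x y z : L) (l : List L) :
    cogeneratingMap A (word (x :: y :: z :: l)) = 0 := by
  rw [cogeneratingMap, LinearMap.sub_apply, LinearMap.smul_apply, LinearMap.comp_apply,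
    LinearMap.comp_apply, lengthTwo_word_cons, cogenerator_word_cons_cons,
    cogenerator_word_cons_cons]
  simp

theorem parity_eq_sum (x : L) :
    A.parity x = DirectSum.toModule k ℤ L (fun i => (i.negOnePow : ℤ) • (A.deg i).subtype)
      (A.decompose x) := rfl

theorem parity_of_mem (i : ℤ) (x : L) (hx : x ∈ A.deg i) :
    A.parity x = (i.negOnePow : ℤ) • x := by
  have h : A.decompose x = DirectSum.lof k ℤ (fun i => A.deg i) i ⟨x, hx⟩ := by
    rw [DGLieAlgebra.decompose, LinearEquiv.symm_apply_eq]
    exact (DirectSum.coeLinearMap_lof A.deg i ⟨x, hx⟩).symm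
  rw [parity_eq_sum, h, DirectSum.toModule_lof]
  simp

theorem parity_mem (F : CompleteFiltration A) (p : ℕ) (x : L) (hx : x ∈ F.F p) :
    A.parity x ∈ F.F p := by
  classical
  rw [parity_eq_sum]
  have h := F.homogeneous p x hx
  rw [DirectSum.toModule, DFinsupp.lsum_apply_apply, DFinsupp.sumAddHom_apply]
  refine Submodule.sum_mem _ fun i _ => ?_
  exact zsmul_mem (h i) _

theorem signedSwap_of_mem [CharZero k] (i j : ℤ) (x y : L) (hx : x ∈ A.deg i) (hy : y ∈ A.deg j) :
    signedSwap A (x ⊗ₜ[k] y) = (((i - 1) * (j - 1)).negOnePow : ℤ) • (y ⊗ₜ[k] x) := by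
  have h2 : (2 : k) ≠ 0 := two_ne_zero
  simp only [signedSwap, suspendedParity, LinearMap.comp_apply, LinearMap.smul_apply,
    LinearMap.sub_apply, LinearMap.add_apply, TensorProduct.map_tmul, LinearMap.neg_apply,
    parity_of_mem i x hx, parity_of_mem j y hy, LinearMap.id_apply]
  rcases Int.even_or_odd i with hi | hi <;> rcases Int.even_or_odd j with hj | hj
  · have h3 : Odd ((i - 1) * (j - 1)) := (hi.sub_odd odd_one).mul (hj.sub_odd odd_one)
    rw [Int.negOnePow_even _ hi, Int.negOnePow_even _ hj, Int.negOnePow_odd _ h3]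
    simp only [Units.val_one, Units.val_neg, one_smul, neg_smul, neg_neg, TensorProduct.neg_tmul,
      TensorProduct.tmul_neg, LinearEquiv.coe_coe, map_smul, map_add, map_sub, map_neg,
      TensorProduct.comm_tmul]
    match_scalars
    field_simp
    norm_num
  · have h3 : Even ((i - 1) * (j - 1)) := (hj.sub_odd odd_one).mul_left _
    rw [Int.negOnePow_even _ hi, Int.negOnePow_odd _ hj, Int.negOnePow_even _ h3]
    simp only [Units.val_one, Units.val_neg, one_smul, neg_smul, neg_neg, TensorProduct.neg_tmul,
      TensorProduct.tmul_neg, LinearEquiv.coe_coe, map_smul, map_add, map_sub, map_neg,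
      TensorProduct.comm_tmul]
    match_scalars
    field_simp
    norm_num
  · have h3 : Even ((i - 1) * (j - 1)) := (hi.sub_odd odd_one).mul_right _
    rw [Int.negOnePow_odd _ hi, Int.negOnePow_even _ hj, Int.negOnePow_even _ h3]
    simp only [Units.val_one, Units.val_neg, one_smul, neg_smul, neg_neg, TensorProduct.neg_tmul,
      TensorProduct.tmul_neg, LinearEquiv.coe_coe, map_smul, map_add, map_sub, map_neg,
      TensorProduct.comm_tmul]
    match_scalars
    field_simp
    norm_num
  · have h3 : Even ((i - 1) * (j - 1)) := (hi.sub_odd odd_one).mul_right _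
    rw [Int.negOnePow_odd _ hi, Int.negOnePow_odd _ hj, Int.negOnePow_even _ h3]
    simp only [Units.val_one, Units.val_neg, one_smul, neg_smul, neg_neg, TensorProduct.neg_tmul,
      TensorProduct.tmul_neg, LinearEquiv.coe_coe, map_smul, map_add, map_sub, map_neg,
      TensorProduct.comm_tmul]
    match_scalars
    field_simp
    norm_num

theorem coderivation_word (l : List L) :
    coderivation A (word l) ∈ Submodule.span k
      {t | ∃ l₁ l₂ l₃ : List L, l₁ ++ (l₂ ++ l₃) = l ∧
        t = word (l₁.map (suspendedParity A)) *
          (TensorAlgebra.ι k (cogeneratingMap A (word l₂)) * word l₃)} := by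
  have h := Submodule.mem_map_of_mem
    (f := (LinearMap.mul' k (TensorAlgebra k L)).comp
      (TensorProduct.map (tensorParity A)
      ((LinearMap.mul' k (TensorAlgebra k L)).comp
        (TensorProduct.map ((TensorAlgebra.ι k).comp (cogeneratingMap A)) LinearMap.id))))
    (deconcatenation₃_word (k := k) l)
  rw [Submodule.map_span] at h
  refine Submodule.span_mono (R := k) ?_ h
  rintro _ ⟨_, ⟨l₁, l₂, l₃, hl, rfl⟩, rfl⟩
  refine ⟨l₁, l₂, l₃, hl, ?_⟩
  have h1 : tensorParity A (word l₁) = word (l₁.map (suspendedParity A)) := by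
    simp [tensorParity, word, map_list_prod, Function.comp_def]
  rw [← h1]
  simp

theorem coderivation_mem (F : CompleteFiltration A) (m : ℕ) :
    (tensorCoalgebraFiltration F).F (m + 1) ≤
      ((tensorCoalgebraFiltration F).F m).comap (coderivation A) := by
  refine Submodule.span_le.2 ?_
  rintro t ⟨l, hl, hm, rfl⟩
  refine (Submodule.span_le.2 ?_ : _ ≤ (tensorCoalgebraFiltration F).F m)
    (coderivation_word (A := A) (l.map Prod.fst))
  rintro t ⟨l₁, l₂, l₃, h, rfl⟩
  obtain ⟨l₁, l', rfl, rfl, h'⟩ := List.map_eq_append_iff.1 h.symm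
  obtain ⟨l₂, l₃, rfl, rfl, rfl⟩ := List.map_eq_append_iff.1 h'
  simp only [List.mem_append, List.map_append, List.sum_append, List.length_append] at hl hm
  have key : ∀ (x : L) (p : ℕ), x ∈ F.F p →
      (l₂.map Prod.snd).sum ≤ p → l₂.length ≤ 2 →
      word ((l₁.map Prod.fst).map (suspendedParity A)) *
        (TensorAlgebra.ι k x * word (l₃.map Prod.fst)) ∈ (tensorCoalgebraFiltration F).F m := by
    intro x p hx hp hlen
    refine Submodule.subset_span ⟨l₁.map (fun a => (suspendedParity A a.1, a.2)) ++ ((x, p) :: l₃),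
      ?_, ?_, ?_⟩
    · intro a ha
      simp only [List.mem_append, List.mem_map, List.mem_cons] at ha
      rcases ha with ⟨b, hb, rfl⟩ | rfl | ha
      · exact neg_mem (parity_mem F _ _ (hl b (Or.inl hb)))
      · exact hx
      · exact hl a (Or.inr (Or.inr ha))
    · simp only [List.map_append, List.map_map, List.map_cons, List.sum_append, List.sum_cons,
        List.length_append, List.length_map, List.length_cons]
      have he : (Prod.snd ∘ fun a : L × ℕ => (suspendedParity A a.1, a.2)) = Prod.snd := rfl
      rw [he]
      omega
    · simp [word_append, word_cons, Function.comp_def]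
  match l₂, hl, hm, key with
  | [], _, _, _ =>
    rw [List.map_nil, cogeneratingMap_word_nil]
    simp
  | [a], hl, _, key =>
    rw [List.map_cons, List.map_nil, cogeneratingMap_word_singleton]
    refine key _ a.2 (neg_mem (F.d_mem _ _ (hl a (Or.inr (Or.inl (by simp)))))) (by simp) (by simp)
  | [a, b], hl, _, key =>
    rw [List.map_cons, List.map_cons, List.map_nil, cogeneratingMap_word_pair]
    refine key _ (a.2 + b.2) (Submodule.smul_mem _ _ (F.bracket_mem _ _ _
      (parity_mem F _ _ (hl a (Or.inr (Or.inl (by simp))))) _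
      (hl b (Or.inr (Or.inl (by simp)))))) (by simp) (by simp)
  | a :: b :: c :: l, _, _, _ =>
    rw [List.map_cons, List.map_cons, List.map_cons, cogeneratingMap_word_long]
    simp

theorem deconcatenation_mem (F : CompleteFiltration A) (m : ℕ) :
    (tensorCoalgebraFiltration F).F m ≤
      ((tensorFiltration (tensorCoalgebraFiltration F) (tensorCoalgebraFiltration F)).F m).comap
        (deconcatenation k L) := by
  refine Submodule.span_le.2 ?_
  rintro t ⟨l, hl, hm, rfl⟩
  refine (Submodule.span_le.2 ?_ : _ ≤ (tensorFiltration (tensorCoalgebraFiltration F)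
    (tensorCoalgebraFiltration F)).F m) (deconcatenation_word (k := k) (l.map Prod.fst))
  rintro t ⟨l₁, l₂, h, rfl⟩
  obtain ⟨l₁, l₂, rfl, rfl, rfl⟩ := List.map_eq_append_iff.1 h.symm
  simp only [List.mem_append, List.map_append, List.sum_append, List.length_append] at hl hm
  rcases hm with hm | hm
  · exact Submodule.subset_span ⟨_, _, hm,
      _, Submodule.subset_span ⟨l₁, fun a ha => hl a (Or.inl ha), Or.inl le_rfl, rfl⟩,
      _, Submodule.subset_span ⟨l₂, fun a ha => hl a (Or.inr ha), Or.inl le_rfl, rfl⟩, rfl⟩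
  · exact Submodule.subset_span ⟨_, _, hm,
      _, Submodule.subset_span ⟨l₁, fun a ha => hl a (Or.inl ha), Or.inr le_rfl, rfl⟩,
      _, Submodule.subset_span ⟨l₂, fun a ha => hl a (Or.inr ha), Or.inr le_rfl, rfl⟩, rfl⟩

/-! ### The completed tensor coalgebra and `Ĉ(L)` -/

/-- The space underlying the completed tensor coalgebra `T̂^c(sL)`. -/
abbrev CompletedTensorSpace (F : CompleteFiltration A) : Type (max u v) :=
  completion (tensorCoalgebraFiltration F)

theorem toCompletion_mem {M : Type*} [AddCommGroup M] [Module k M] (B : Filtration k M) (p : ℕ) :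
    B.F p ≤ ((completionFiltration B).F p).comap (toCompletion B) := by
  intro x hx
  exact (Submodule.Quotient.mk_eq_zero _).2 hx

theorem algebraMapInv_mem (F : CompleteFiltration A) :
    (tensorCoalgebraFiltration F).F 1 ≤
      LinearMap.ker (TensorAlgebra.algebraMapInv (R := k) (M := L)).toLinearMap := by
  refine Submodule.span_le.2 ?_
  rintro t ⟨l, -, hl, rfl⟩
  match l, hl with
  | [], hl => simp at hl
  | a :: l, _ => simp [word_cons, TensorAlgebra.algebraMapInv]

/-- The completed tensor coalgebra `T̂^c(sL)`, with the extension by continuity of the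
deconcatenation and of the coderivation.  (The latter has square zero on the graded symmetric
tensors.) -/
def completedTensorCoalgebra (F : CompleteFiltration A) :
    DGCoalgebraData k (CompletedTensorSpace F) where
  deg i :=
    { carrier := {x | ∀ m, ∃ t ∈ tensorDeg A i, x.1 m = Submodule.mkQ _ t}
      add_mem' := by
        intro x y hx hy m
        obtain ⟨s, hs, hs'⟩ := hx m
        obtain ⟨t, ht, ht'⟩ := hy m
        exact ⟨s + t, add_mem hs ht, by rw [map_add, ← hs', ← ht']; rfl⟩
      zero_mem' := fun m => ⟨0, zero_mem _, by rw [map_zero]; rfl⟩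
      smul_mem' := by
        intro c x hx m
        obtain ⟨s, hs, hs'⟩ := hx m
        exact ⟨c • s, Submodule.smul_mem _ _ hs, by rw [map_smul, ← hs']; rfl⟩ }
  fil := completionFiltration (tensorCoalgebraFiltration F)
  d := completionMap _ _ (coderivation A) 1 (coderivation_mem F)
  counit := (Submodule.liftQ _ (TensorAlgebra.algebraMapInv (R := k) (M := L)).toLinearMap
    (algebraMapInv_mem F)).comp ((LinearMap.proj 1).comp (Submodule.subtype _))
  comul := completionMap _ _
    ((TensorProduct.map (toCompletion (tensorCoalgebraFiltration F))
      (toCompletion (tensorCoalgebraFiltration F))).comp (deconcatenation k L)) 0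
    (fun p => (deconcatenation_mem F p).trans
      (Submodule.comap_mono (tensorFiltration_map _ _ _ _ _ _ (toCompletion_mem _)
        (toCompletion_mem _) p)))

/-- `x ∈ Ĉ(L)`: the completion of `C(L) = S^c(sL)`, which is the closed sub-coalgebra of
`T̂^c(sL)` of limits of graded symmetric tensors. -/
def MemC (F : CompleteFiltration A) (x : CompletedTensorSpace F) : Prop :=
  ∀ m, ∃ t ∈ symmetricTensors A, x.1 m = Submodule.mkQ _ t

/-- The component of length one of `x` lies in `F_p L`. -/
def CogeneratorMem (F : CompleteFiltration A) (p : ℕ) (x : CompletedTensorSpace F) : Prop :=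
  ∀ m, ∃ t : TensorAlgebra k L, cogenerator k L t ∈ F.F p ∧ x.1 m = Submodule.mkQ _ t

/-- A filtered map of dg coalgebras `f : C → Ĉ(L)`, "filtered" meaning that the composite
`π f : C → L` preserves filtrations. -/
structure FilteredMap {X : Type w} [AddCommGroup X] [Module k X] (C : DGCoalgebraData k X)
    (F : CompleteFiltration A) extends DGCoalgebraMap C (completedTensorCoalgebra F) where
  mem_C : ∀ x, MemC F (toLin x)
  filtered : ∀ p, ∀ x ∈ C.fil.F p, CogeneratorMem F p (toLin x)

/-- Two points `f, g : k → Ĉ(L)` are joined by a filtered homotopy `h : k ⊗̂ J = J → Ĉ(L)`, with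
`f 1 = h (t_0)` and `g 1 = h (∑ t_i)`. -/
def Homotopic {F : CompleteFiltration A} (f g : FilteredMap (point k) F) : Prop :=
  ∃ h : FilteredMap (interval k) F,
    h.toLin (tElt 0) = f.toLin 1 ∧ h.toLin (fun _ => 1, 0) = g.toLin 1

/-- The set of filtered homotopy classes of dg coalgebra maps `k → Ĉ(L)`. -/
def HomotopyClasses (F : CompleteFiltration A) : Type (max u v) :=
  Quot (Homotopic (F := F))

/-- The element `1 + sp + sp ⊗ sp + ...` of `T̂^c(sL)`. -/
def groupLike (F : CompleteFiltration A) (p : L) : CompletedTensorSpace F :=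
  ⟨fun m => Submodule.mkQ _ (∑ n ∈ Finset.range m, TensorAlgebra.ι k p ^ n), by
    intro m n h
    rw [Submodule.factor_mk, ← sub_eq_zero, ← map_sub, Submodule.mkQ_apply,
      Submodule.Quotient.mk_eq_zero, ← Finset.sum_range_add_sum_Ico _ h, add_sub_cancel_left]
    refine Submodule.sum_mem _ fun i hi => ?_
    refine Submodule.subset_span ⟨List.replicate i (p, 0), ?_, Or.inr ?_, ?_⟩
    · intro a ha
      rw [List.eq_of_mem_replicate ha, F.F_zero]
      exact Submodule.mem_top
    · simpa using (Finset.mem_Ico.1 hi).1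
    · simp [word]⟩

/-- `f` is the classifying map `χ(p)`, that is, `f 1 = 1 + sp + sp ⊗ sp + ...`. -/
def IsClassifyingMap {F : CompleteFiltration A} (p : MaurerCartan A)
    (f : FilteredMap (point k) F) : Prop :=
  f.toLin 1 = groupLike F p.1

end Tensor

end HomotopyModuli

end

noncomputable section

namespace HomotopyModuli

open Finset

/-! ### Sums over antidiagonals -/

section Sums

variable {k : Type*} [Field k] {M : Type*} [AddCommGroup M] [Module k M]

/-! A coalgebra map into the tensor coalgebra is determined by its component of length one.
Splitting off the first letter of every tensor turns compatibility with coproduct and counit into a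
recursion `g = ε(g) + π(g) · g`. A letter raises the length, and `G_m` contains all tensors of
length at least `m`, so the recursion has exactly one solution modulo each `G_m`, a geometric
series. For the point this gives `1 + sp + sp ⊗ sp + ...`, and the length one part of compatibility
with the differentials is the Maurer-Cartan equation for `p` (`FilteredMap.exists_eq_groupLike`).

For `J`, put `P_n = π h(t_n)` and `B_n = π h(t_n u)`. The same comparison yields `dP + 1/2 [P, P] =
0` and `P' = [B, P] - dB` for the series `P(t)`, `B(t)` (`FilteredMap.exists_path`); conversely
every such pair defines a filtered map (`pathMap`). The filtered condition says that `P_n` and `B_n`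
lie in `F_n`, so the path can be evaluated at `t = 1`. A homotopy is thus a path of Maurer-Cartan
elements from `p` to `q`.

It remains to compare paths with gauge transformations. In `L ⊕ k d` the flow equation reads `(d +
P)' = (ad B)(d + P)`. For constant `B = b` it is solved by `exp(tb)(d + p)`, so a gauge
transformation gives a path (`exists_path_of_gaugeAct`). For general `B` there is a series `c` with
`c(0) = 0` and `∑ (ad c)^i c' / (i + 1)! = B` (`exists_logarithm`). By the formula for the
derivative of an exponential (`seriesDeriv_expSeries`), `exp(ad c)` solves the flow equation; by
uniqueness `d + P = exp(ad c)(d + p)`, and `C = c(1)` carries `p` to `q`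
(`exists_gaugeAct_of_flow`).

The same argument applied to `exp(ta) exp(tb)` shows that gauge transformations compose
(`GaugeAct.trans`), which avoids the Baker-Campbell-Hausdorff formula. Both directions meet in
`homotopic_iff`, and homotopy inherits from gauge equivalence that it is an equivalence relation. -/

theorem sum_antidiagonal_leibniz (f : ℕ → ℕ → M) (n : ℕ) :
    ((n : k) + 1) • ∑ ij ∈ antidiagonal (n + 1), f ij.1 ij.2 =
      ∑ ij ∈ antidiagonal n, (((ij.1 : k) + 1) • f (ij.1 + 1) ij.2
        + ((ij.2 : k) + 1) • f ij.1 (ij.2 + 1)) := by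
  have h : ((n : k) + 1) • ∑ ij ∈ antidiagonal (n + 1), f ij.1 ij.2 =
      ∑ ij ∈ antidiagonal (n + 1), ((ij.1 : k) • f ij.1 ij.2 + (ij.2 : k) • f ij.1 ij.2) := by
    rw [smul_sum]
    refine sum_congr rfl fun ij hij => ?_
    rw [← add_smul, ← Nat.cast_add, mem_antidiagonal.1 hij, Nat.cast_succ]
  rw [h, sum_add_distrib, sum_add_distrib, Nat.sum_antidiagonal_succ, Nat.sum_antidiagonal_succ']
  simp

/-- The square `i, j < N` and the triangle `i + j < N` differ by the terms with `i + j ≥ N`. This is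
the common estimate for products of truncated series of operators, power series and tensors. -/
theorem sum_range_sum_range_sub_mem (S : Submodule k M) (f : ℕ → ℕ → M) (N : ℕ)
    (h : ∀ i < N, ∀ j < N, N ≤ i + j → f i j ∈ S) :
    (∑ i ∈ range N, ∑ j ∈ range N, f i j) - ∑ n ∈ range N, ∑ ij ∈ antidiagonal n, f ij.1 ij.2
      ∈ S := by
  have h1 : ∑ n ∈ range N, ∑ ij ∈ antidiagonal n, f ij.1 ij.2 =
      ∑ ij ∈ (range N ×ˢ range N).filter (fun ij => ij.1 + ij.2 < N), f ij.1 ij.2 := by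
    rw [← sum_fiberwise_of_maps_to (s := (range N ×ˢ range N).filter _) (t := range N)
      (g := fun ij => ij.1 + ij.2) (fun ij hij => mem_range.2 (mem_filter.1 hij).2)]
    refine sum_congr rfl fun n hn => sum_congr ?_ fun _ _ => rfl
    ext ij
    simp only [HasAntidiagonal.mem_antidiagonal, mem_filter, mem_product, mem_range] at hn ⊢
    omega
  rw [h1, ← sum_product', ← sum_filter_add_sum_filter_not (range N ×ˢ range N)
    (fun ij => ij.1 + ij.2 < N), add_sub_cancel_left]
  refine Submodule.sum_mem _ fun ij hij => ?_
  simp only [mem_filter, mem_product, mem_range, not_lt] at hij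
  exact h _ hij.1.1 _ hij.1.2 hij.2

end Sums

/-! ### Exponentials in associative algebras -/

section Associative

variable {k : Type*} [Field k] [CharZero k] {R : Type*} [Ring R] [Algebra k R]

variable (k) in
/-- The commutator `b ↦ a b - b a`. -/
def commutator (a : R) : R →ₗ[k] R := LinearMap.mulLeft k a - LinearMap.mulRight k a

omit [CharZero k] in
theorem commutator_apply (a b : R) : commutator k a b = a * b - b * a := rfl

/-- The coefficients of `exp(a) b = (exp(ad a) b) exp(a)`. Left multiplication by `a` is the sum of
the commuting operators `ad a` and right multiplication by `a`, so the binomial theorem applies. -/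
theorem dividedPow_mul (a b : R) (n : ℕ) :
    ((n.factorial : k)⁻¹) • (a ^ n * b) = ∑ ij ∈ antidiagonal n,
      (((ij.1.factorial : k)⁻¹) • ((commutator k a) ^ ij.1) b) *
        (((ij.2.factorial : k)⁻¹) • a ^ ij.2) := by
  have hc : Commute (commutator k a) (LinearMap.mulRight k a) :=
    LinearMap.ext fun x => by
      simp only [Module.End.mul_apply, commutator_apply, LinearMap.mulRight_apply]
      noncomm_ring
  have h := congrArg (fun φ : Module.End k R => φ b) (hc.add_pow' n)
  have h0 : commutator k a + LinearMap.mulRight k a = LinearMap.mulLeft k a :=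
    sub_add_cancel _ _
  simp only [h0, LinearMap.pow_mulLeft, LinearMap.mulLeft_apply, LinearMap.sum_apply,
    LinearMap.smul_apply, Module.End.mul_apply, LinearMap.pow_mulRight,
    LinearMap.mulRight_apply] at h
  rw [h, smul_sum]
  refine sum_congr rfl fun ij hij => ?_
  have hc' : Commute ((commutator k a) ^ ij.1) (LinearMap.mulRight k (a ^ ij.2)) := by
    rw [← LinearMap.pow_mulRight]
    exact hc.pow_pow _ _
  have h1 : ((commutator k a) ^ ij.1) (b * a ^ ij.2) = ((commutator k a) ^ ij.1) b * a ^ ij.2 :=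
    congrArg (fun φ : Module.End k R => φ b) hc'.eq
  rw [h1, smul_mul_smul_comm, ← Nat.cast_smul_eq_nsmul k, smul_smul]
  congr 1
  rw [← mem_antidiagonal.1 hij, Nat.cast_add_choose]
  have := Nat.cast_ne_zero (R := k).2 (Nat.factorial_ne_zero (ij.1 + ij.2))
  have := Nat.cast_ne_zero (R := k).2 (Nat.factorial_ne_zero ij.1)
  have := Nat.cast_ne_zero (R := k).2 (Nat.factorial_ne_zero ij.2)
  field_simp

/-- The coefficients of `exp(-a) exp(a) = 1`, from the binomial expansion of `(-a + a)^n`. -/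
theorem sum_dividedPow_neg (a : R) (n : ℕ) :
    ∑ ij ∈ antidiagonal n, (((ij.1.factorial : k)⁻¹) • (-a) ^ ij.1) *
      (((ij.2.factorial : k)⁻¹) • a ^ ij.2) = if n = 0 then 1 else 0 := by
  have h := (Commute.neg_left (Commute.refl a)).add_pow' n
  rw [neg_add_cancel] at h
  have h2 := congrArg (fun x => ((n.factorial : k)⁻¹) • x) h
  simp only [smul_sum] at h2
  have h3 : ((n.factorial : k)⁻¹) • (0 : R) ^ n = if n = 0 then 1 else 0 := by
    rcases n with _ | n <;> simp
  rw [← h3, h2]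
  refine sum_congr rfl fun ij hij => ?_
  rw [smul_mul_smul_comm, ← Nat.cast_smul_eq_nsmul k, smul_smul]
  congr 1
  rw [← mem_antidiagonal.1 hij, Nat.cast_add_choose]
  have := Nat.cast_ne_zero (R := k).2 (Nat.factorial_ne_zero (ij.1 + ij.2))
  have := Nat.cast_ne_zero (R := k).2 (Nat.factorial_ne_zero ij.1)
  have := Nat.cast_ne_zero (R := k).2 (Nat.factorial_ne_zero ij.2)
  field_simp

/-! ### Derivative and exponential of power series with noncommuting coefficients -/

variable (k) in
/-- The derivative of a power series with noncommuting coefficients. -/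
def seriesDeriv : PowerSeries R →ₗ[k] PowerSeries R where
  toFun f := PowerSeries.mk fun n => ((n : k) + 1) • PowerSeries.coeff (n + 1) f
  map_add' f g := by ext n; simp
  map_smul' c f := by ext n; simp [smul_comm c]

omit [CharZero k] in
theorem coeff_seriesDeriv (f : PowerSeries R) (n : ℕ) :
    PowerSeries.coeff n (seriesDeriv k f) = ((n : k) + 1) • PowerSeries.coeff (n + 1) f := by
  simp [seriesDeriv]

omit [CharZero k] in
theorem coeff_smul' (c : k) (f : PowerSeries R) (n : ℕ) :
    PowerSeries.coeff n (c • f) = c • PowerSeries.coeff n f := rfl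

omit [CharZero k] in
theorem seriesDeriv_mul (f g : PowerSeries R) :
    seriesDeriv k (f * g) = seriesDeriv k f * g + f * seriesDeriv k g := by
  ext n
  rw [coeff_seriesDeriv, map_add, PowerSeries.coeff_mul, PowerSeries.coeff_mul,
    PowerSeries.coeff_mul, ← sum_add_distrib,
    sum_antidiagonal_leibniz (fun i j => PowerSeries.coeff i f * PowerSeries.coeff j g)]
  simp [coeff_seriesDeriv]

omit [CharZero k] in
theorem seriesDeriv_one : seriesDeriv k (1 : PowerSeries R) = 0 := by
  ext n
  simp [coeff_seriesDeriv, PowerSeries.coeff_one]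

/-- This is `dividedPow_mul` in the endomorphism ring, for left multiplication by `X` and the
derivation `D`, evaluated at `1`. There `D 1 = 0` kills the left side, and the commutator of `X`
with `D` is left multiplication by `-X'`, so that `(ad X)^(i+1)(D)` is multiplication by `-(ad X)^i
X'`. -/
theorem seriesDeriv_dividedPow (X : PowerSeries R) (n : ℕ) :
    (((n + 1).factorial : k)⁻¹) • seriesDeriv k (X ^ (n + 1)) = ∑ ij ∈ antidiagonal n,
      ((((ij.1 + 1).factorial : k)⁻¹) • ((commutator k X) ^ ij.1) (seriesDeriv k X)) *
        (((ij.2.factorial : k)⁻¹) • X ^ ij.2) := by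
  have h0 : ∀ (i : ℕ) (Z : PowerSeries R),
      ((commutator k (LinearMap.mulLeft k X)) ^ i) (LinearMap.mulLeft k Z) =
        LinearMap.mulLeft k (((commutator k X) ^ i) Z) := by
    intro i Z
    induction i with
    | zero => rfl
    | succ i ih =>
      rw [pow_succ', Module.End.mul_apply, ih, pow_succ', Module.End.mul_apply, commutator_apply,
        commutator_apply]
      ext1 x
      simp [sub_mul, mul_assoc]
  have h1 : commutator k (LinearMap.mulLeft k X) (seriesDeriv k) =
      -LinearMap.mulLeft k (seriesDeriv k X) := by
    ext1 Z
    rw [commutator_apply]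
    simp [seriesDeriv_mul]
  have h := congrArg (fun φ : Module.End k (PowerSeries R) => φ 1)
    (dividedPow_mul (k := k) (LinearMap.mulLeft k X : Module.End k (PowerSeries R))
      (seriesDeriv k) (n + 1))
  simp only [Nat.sum_antidiagonal_succ, LinearMap.add_apply, LinearMap.sum_apply,
    LinearMap.smul_apply, Module.End.mul_apply, seriesDeriv_one, map_zero, smul_zero,
    LinearMap.pow_mulLeft, LinearMap.mulLeft_apply, mul_one, pow_succ (commutator k _), h1, map_neg,
    h0, LinearMap.neg_apply, map_smul, pow_zero, Module.End.one_apply, Nat.factorial_zero,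
    Nat.cast_one, inv_one, one_smul, smul_neg, sum_neg_distrib] at h
  rw [eq_comm, add_neg_eq_zero] at h
  rw [h]
  refine sum_congr rfl fun ij _ => ?_
  rw [smul_mul_smul_comm, smul_smul, mul_comm]

omit [CharZero k] in
theorem coeff_mul_eq_zero {f g : PowerSeries R} {a b : ℕ}
    (hf : ∀ i < a, PowerSeries.coeff i f = 0) (hg : ∀ i < b, PowerSeries.coeff i g = 0) :
    ∀ i < a + b, PowerSeries.coeff i (f * g) = 0 := by
  intro n hn
  rw [PowerSeries.coeff_mul]
  refine sum_eq_zero fun ij hij => ?_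
  have := mem_antidiagonal.1 hij
  by_cases h : ij.1 < a
  · rw [hf _ h, zero_mul]
  · rw [hg _ (by omega), mul_zero]

omit [CharZero k] in
theorem coeff_pow_eq_zero {f : PowerSeries R} (hf : PowerSeries.coeff 0 f = 0) (j : ℕ) :
    ∀ n < j, PowerSeries.coeff n (f ^ j) = 0 := by
  induction j with
  | zero => intro n hn; omega
  | succ j ih =>
    rw [pow_succ]
    exact coeff_mul_eq_zero ih (b := 1) (fun i hi => by
      obtain rfl : i = 0 := by omega
      exact hf)

omit [CharZero k] in
theorem coeff_commutator_pow_eq_zero {f : PowerSeries R} (hf : PowerSeries.coeff 0 f = 0)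
    (g : PowerSeries R) (j : ℕ) :
    ∀ n < j, PowerSeries.coeff n (((commutator k f) ^ j) g) = 0 := by
  induction j with
  | zero => intro n hn; omega
  | succ j ih =>
    have h1 : ∀ i < 1, PowerSeries.coeff i f = 0 := fun i hi => by
      obtain rfl : i = 0 := by omega
      exact hf
    intro n hn
    rw [pow_succ', Module.End.mul_apply, commutator_apply, map_sub,
      coeff_mul_eq_zero h1 ih n (by omega), coeff_mul_eq_zero ih h1 n hn, sub_zero]

variable (k) in
/-- The exponential of a power series without constant term. -/
def expSeries (f : PowerSeries R) : PowerSeries R :=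
  PowerSeries.mk fun n => ∑ j ∈ range (n + 1), ((j.factorial : k)⁻¹) • PowerSeries.coeff n (f ^ j)

-- Since `f` has no constant term, `f ^ j` does not contribute to coefficient `n` when `j > n`; any
-- longer truncation may be used.
omit [CharZero k] in
theorem coeff_expSeries {f : PowerSeries R} (hf : PowerSeries.coeff 0 f = 0) {n N : ℕ}
    (h : n < N) : PowerSeries.coeff n (expSeries k f) =
      ∑ j ∈ range N, ((j.factorial : k)⁻¹) • PowerSeries.coeff n (f ^ j) := by
  rw [expSeries, PowerSeries.coeff_mk]
  refine sum_subset (range_subset_range.2 h) fun j _ hj => ?_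
  rw [coeff_pow_eq_zero hf j n (by simpa using hj), smul_zero]

/-- The derivative of `exp f` is `Y exp f` with `Y = ∑ (ad f)^i f' / (i + 1)!`. -/
theorem seriesDeriv_expSeries {f Y : PowerSeries R} (hf : PowerSeries.coeff 0 f = 0)
    (hY : ∀ n, PowerSeries.coeff n Y = ∑ i ∈ range (n + 1), (((i + 1).factorial : k)⁻¹) •
      PowerSeries.coeff n (((commutator k f) ^ i) (seriesDeriv k f))) :
    seriesDeriv k (expSeries k f) = Y * expSeries k f := by
  have hY' : ∀ n N, n < N → PowerSeries.coeff n Y = PowerSeries.coeff n (∑ i ∈ range N,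
      (((i + 1).factorial : k)⁻¹) • ((commutator k f) ^ i) (seriesDeriv k f)) := by
    intro n N h
    rw [hY, map_sum]
    refine sum_subset (range_subset_range.2 h) fun j _ hj => ?_
    rw [coeff_commutator_pow_eq_zero hf _ j n (by simpa using hj), smul_zero]
  have hE' : ∀ n N, n < N → PowerSeries.coeff n (expSeries k f) =
      PowerSeries.coeff n (∑ j ∈ range N, ((j.factorial : k)⁻¹) • f ^ j) := by
    intro n N h
    rw [coeff_expSeries hf h, map_sum]
    rfl
  ext n
  have h1 : PowerSeries.coeff n (Y * expSeries k f) = PowerSeries.coeff n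
      ((∑ i ∈ range (n + 1), (((i + 1).factorial : k)⁻¹) •
        ((commutator k f) ^ i) (seriesDeriv k f)) *
        (∑ j ∈ range (n + 1), ((j.factorial : k)⁻¹) • f ^ j)) := by
    rw [PowerSeries.coeff_mul, PowerSeries.coeff_mul]
    refine sum_congr rfl fun ij hij => ?_
    have := mem_antidiagonal.1 hij
    rw [hY' _ (n + 1) (by omega), hE' _ (n + 1) (by omega)]
  -- Modulo the series with vanishing coefficient `n`, the product of the two truncations is the
  -- truncated Cauchy product: the factors have orders at least `i` and `j`, and the omitted terms
  -- have `i + j > n`.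
  let S : Submodule k (PowerSeries R) :=
    { carrier := {g | PowerSeries.coeff n g = 0}
      add_mem' := fun {a b} ha hb => by
        change _ = _ at ha hb
        change _ = _
        rw [map_add, ha, hb, add_zero]
      zero_mem' := map_zero _
      smul_mem' := fun c x hx => by
        change _ = _ at hx
        change _ = _
        rw [coeff_smul', hx, smul_zero] }
  have h2 := sum_range_sum_range_sub_mem S (fun i j =>
    ((((i + 1).factorial : k)⁻¹) • ((commutator k f) ^ i) (seriesDeriv k f)) *
      (((j.factorial : k)⁻¹) • f ^ j)) (n + 1) (fun i _ j _ hij => by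
      change PowerSeries.coeff n _ = 0
      rw [smul_mul_smul_comm, coeff_smul', coeff_mul_eq_zero
        (coeff_commutator_pow_eq_zero hf _ i) (coeff_pow_eq_zero hf j) n (by omega), smul_zero])
  change PowerSeries.coeff n _ = 0 at h2
  rw [map_sub, sub_eq_zero] at h2
  rw [h1, sum_mul_sum, h2, coeff_seriesDeriv, coeff_expSeries hf (n.succ.lt_succ_self),
    sum_range_succ', smul_add, smul_sum, map_sum]
  rw [pow_zero, PowerSeries.coeff_one, if_neg (by omega), smul_zero, smul_zero, add_zero]
  refine sum_congr rfl fun j _ => ?_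
  rw [← seriesDeriv_dividedPow, coeff_smul', coeff_seriesDeriv, smul_comm]

end Associative

/-! ### Operators on `L ⊕ k d` -/

section Operators

variable {k : Type*} [Field k] {L : Type*} [AddCommGroup L] [Module k L]
variable {A : DGLieAlgebra k L}

/-- The filtration of `L ⊕ k d` in which `d` has filtration zero. -/
def incorporatedFiltration (F : CompleteFiltration A) (m : ℕ) : Submodule k (L × k) where
  carrier := {x | x.1 ∈ F.F m ∧ (m ≠ 0 → x.2 = 0)}
  add_mem' := fun {x y} hx hy =>
    ⟨add_mem hx.1 hy.1, fun h => by rw [Prod.snd_add, hx.2 h, hy.2 h, add_zero]⟩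
  zero_mem' := ⟨zero_mem _, fun _ => rfl⟩
  smul_mem' := fun c x hx =>
    ⟨Submodule.smul_mem _ c hx.1, fun h => by rw [Prod.smul_snd, hx.2 h, smul_zero]⟩

/-- The operators on `L ⊕ k d` that raise the filtration by `p`. -/
def operatorFiltration (F : CompleteFiltration A) (p : ℕ) :
    Submodule k (Module.End k (L × k)) where
  carrier := {φ | ∀ q, ∀ x ∈ incorporatedFiltration F q, φ x ∈ incorporatedFiltration F (p + q)}
  add_mem' := fun hx hy q x h => add_mem (hx q x h) (hy q x h)
  zero_mem' := fun _ _ _ => zero_mem _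
  smul_mem' := fun c _ hx q x h => Submodule.smul_mem _ c (hx q x h)

variable (F : CompleteFiltration A)

theorem incorporatedFiltration_anti : Antitone (incorporatedFiltration F) := fun _ _ h _ hx =>
  ⟨F.anti h hx.1, fun h0 => hx.2 (by omega)⟩

theorem operatorFiltration_anti : Antitone (operatorFiltration F) := fun _ _ h _ hφ q x hx =>
  incorporatedFiltration_anti F (by omega) (hφ q x hx)

theorem mem_incorporatedFiltration_zero (x : L × k) : x ∈ incorporatedFiltration F 0 :=
  ⟨by rw [F.F_zero]; exact Submodule.mem_top, fun h => absurd rfl h⟩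

theorem one_mem_operatorFiltration : 1 ∈ operatorFiltration F 0 := fun q x hx => by
  rwa [zero_add]

variable {F}

theorem mul_mem_operatorFiltration {p q : ℕ} {φ ψ : Module.End k (L × k)}
    (hφ : φ ∈ operatorFiltration F p) (hψ : ψ ∈ operatorFiltration F q) :
    φ * ψ ∈ operatorFiltration F (p + q) := fun r x hx => by
  rw [add_assoc]
  exact hφ _ _ (hψ r x hx)

theorem pow_mem_operatorFiltration {p : ℕ} {φ : Module.End k (L × k)}
    (hφ : φ ∈ operatorFiltration F p) (n : ℕ) : φ ^ n ∈ operatorFiltration F (n * p) := by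
  induction n with
  | zero => simpa using one_mem_operatorFiltration F
  | succ n ih =>
    rw [pow_succ, Nat.succ_mul]
    exact mul_mem_operatorFiltration ih hφ

theorem apply_mem_incorporatedFiltration {p : ℕ} {φ : Module.End k (L × k)}
    (hφ : φ ∈ operatorFiltration F p) (x : L × k) : φ x ∈ incorporatedFiltration F p := by
  simpa using hφ 0 x (mem_incorporatedFiltration_zero F x)

/-- The rate `w` is left free: the exponential of one element of `L^0` converges at rate `id`, but
the logarithm of a flow only at rate `(n + 1) / 2`. -/
theorem sum_mul_sum_sub_mem_operatorFiltration {w : ℕ → ℕ} (hw : Monotone w)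
    (hw' : ∀ i j, w (i + j) ≤ w i + w j) {x y : ℕ → Module.End k (L × k)}
    (hx : ∀ i, x i ∈ operatorFiltration F (w i)) (hy : ∀ i, y i ∈ operatorFiltration F (w i))
    (N : ℕ) : (∑ i ∈ range N, x i) * (∑ i ∈ range N, y i) -
      ∑ n ∈ range N, ∑ ij ∈ antidiagonal n, x ij.1 * y ij.2 ∈ operatorFiltration F (w N) := by
  rw [sum_mul_sum]
  exact sum_range_sum_range_sub_mem _ (fun i j => x i * y j) N fun i _ j _ h =>
    operatorFiltration_anti F ((hw h).trans (hw' i j)) (mul_mem_operatorFiltration (hx i) (hy j))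

variable (A) in
/-- The linear map `b ↦ ad b`, with values in the operators on `L ⊕ k d`. -/
def adOperator : L →ₗ[k] Module.End k (L × k) where
  toFun b := adIncorporated A b
  map_add' a b := by
    ext1 <;> ext <;> simp [adIncorporated]; abel
  map_smul' c b := by
    ext1 <;> ext <;> simp [adIncorporated]

theorem adOperator_apply (b : L) (z : L × k) :
    adOperator A b z = (A.bracket b z.1 - z.2 • A.d b, 0) := rfl

/-- Besides the bracket with `b`, the term `-db` coming from `d` has to be controlled. It occurs
only for `q = 0`, where it suffices that it lies in `F_p`. -/
theorem adOperator_mem {b : L} {p : ℕ} (hb : b ∈ F.F p) :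
    adOperator A b ∈ operatorFiltration F p := by
  intro q x hx
  rw [adOperator_apply]
  refine ⟨sub_mem (F.bracket_mem _ _ _ hb _ hx.1) ?_, fun _ => rfl⟩
  by_cases hq : q = 0
  · subst hq
    exact Submodule.smul_mem _ _ (F.d_mem _ _ hb)
  · rw [hx.2 hq, zero_smul]
    exact zero_mem _

theorem adOperator_mem_zero (b : L) : adOperator A b ∈ operatorFiltration F 0 :=
  adOperator_mem (by rw [F.F_zero]; exact Submodule.mem_top)

theorem bracket_symm_of_mem {i : ℤ} {a x : L} (ha : a ∈ A.deg 0) (hx : x ∈ A.deg i) :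
    A.bracket a x = -A.bracket x a := by
  simpa using A.bracket_skew 0 i a ha x hx

/-- The Jacobi identity gives the action on `L`, and the Leibniz rule for `d[a, b]` gives the action
on `d`. -/
theorem adOperator_bracket {a b : L} (ha : a ∈ A.deg 0) (hb : b ∈ A.deg 0) :
    adOperator A (A.bracket a b) = commutator k (adOperator A a) (adOperator A b) := by
  have h1 : ∀ z, A.bracket a (A.bracket b z) =
      A.bracket (A.bracket a b) z + A.bracket b (A.bracket a z) := fun z => by
    simpa using A.jacobi 0 0 a ha b hb z
  have h2 : A.d (A.bracket a b) = A.bracket (A.d a) b + A.bracket a (A.d b) := by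
    simpa using A.leibniz 0 a ha b
  have h3 := bracket_symm_of_mem hb (A.d_mem 0 a ha)
  refine LinearMap.ext fun z => Prod.ext ?_ ?_
  · simp only [commutator_apply, LinearMap.sub_apply, Module.End.mul_apply, adOperator_apply, h1,
      h2, map_sub, map_smul, h3, Prod.fst_sub, zero_smul]
    module
  · simp [commutator_apply, adOperator_apply]

/-! ### Gauge equivalence through partial sums of exponentials -/

/-- The partial sums of `exp φ`. -/
def expSum (φ : Module.End k (L × k)) (n : ℕ) : Module.End k (L × k) :=
  ∑ i ∈ range n, ((i.factorial : k)⁻¹) • φ ^ i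

theorem expPartialSum_eq (b p : L) (n : ℕ) :
    expPartialSum A b p n = expSum (adOperator A b) n (p, 1) := by
  simp only [expPartialSum, expSum, LinearMap.sum_apply, LinearMap.smul_apply]
  rfl

theorem gaugeAct_iff {b p q : L} : GaugeAct F b p q ↔ ∀ m, ∃ n₀, ∀ n ≥ n₀,
    expSum (adOperator A b) n (p, 1) - (q, 1) ∈ incorporatedFiltration F m := by
  simp only [GaugeAct, expPartialSum_eq]
  constructor
  · intro h m
    obtain ⟨n₀, hn⟩ := h m
    exact ⟨n₀, fun n hn' => ⟨(hn n hn').2, fun _ => sub_eq_zero.2 (hn n hn').1⟩⟩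
  · intro h m
    -- The filtration controls the scalar component only in positive level, hence `m + 1`.
    obtain ⟨n₀, hn⟩ := h (m + 1)
    exact ⟨n₀, fun n hn' => ⟨sub_eq_zero.1 ((hn n hn').2 m.succ_ne_zero),
      F.anti m.le_succ (hn n hn').1⟩⟩

theorem expSum_mem (b : L) (n : ℕ) : expSum (adOperator A b) n ∈ operatorFiltration F 0 :=
  Submodule.sum_mem _ fun i _ => Submodule.smul_mem _ _
    (by simpa using pow_mem_operatorFiltration (adOperator_mem_zero (F := F) b) i)

theorem dividedPow_adOperator_mem {b : L} (hb : b ∈ A.deg 0) (i : ℕ) :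
    ((i.factorial : k)⁻¹) • adOperator A b ^ i ∈ operatorFiltration F i :=
  Submodule.smul_mem _ _
    (by simpa using pow_mem_operatorFiltration (adOperator_mem (F.deg_zero_le hb)) i)

/-- As `L^0 ⊆ F_1`, the `i`-th term of the exponential lies in `F_i`. Mere convergence therefore
comes with an explicit rate: the tail from `n` on lies in `F_n`. -/
theorem GaugeAct.expSum_sub_mem {b p q : L} (hb : b ∈ A.deg 0) (h : GaugeAct F b p q) (n : ℕ) :
    expSum (adOperator A b) n (p, 1) - (q, 1) ∈ incorporatedFiltration F n := by
  obtain ⟨n₀, hn⟩ := gaugeAct_iff.1 h n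
  have h1 := hn (max n n₀) (le_max_right _ _)
  have h2 : expSum (adOperator A b) (max n n₀) - expSum (adOperator A b) n
      ∈ operatorFiltration F n := by
    rw [expSum, expSum, ← sum_range_add_sum_Ico _ (le_max_left n n₀), add_sub_cancel_left]
    exact Submodule.sum_mem _ fun i hi =>
      operatorFiltration_anti F (mem_Ico.1 hi).1 (dividedPow_adOperator_mem hb i)
  have h3 := sub_mem h1 (apply_mem_incorporatedFiltration h2 (p, 1))
  rw [LinearMap.sub_apply] at h3
  convert h3 using 1
  abel

theorem gaugeAct_zero (p : L) : GaugeAct F 0 p p := by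
  rw [gaugeAct_iff]
  intro m
  refine ⟨1, fun n hn => ?_⟩
  obtain ⟨n, rfl⟩ := Nat.exists_eq_add_of_le' hn
  simp [expSum, sum_range_succ']

theorem GaugeAct.symm [CharZero k] {b p q : L} (hb : b ∈ A.deg 0) (h : GaugeAct F b p q) :
    GaugeAct F (-b) q p := by
  rw [gaugeAct_iff]
  intro m
  -- The bound `m + 1` makes `n` positive, so that index `0`, which carries the only nonzero
  -- coefficient of `exp(-b) exp(b)`, is in the range.
  refine ⟨m + 1, fun n hn => incorporatedFiltration_anti F (by omega : m ≤ n) ?_⟩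
  have h1 := (expSum_mem (F := F) (-b) n) n _ (h.expSum_sub_mem hb n)
  have h2 := sum_mul_sum_sub_mem_operatorFiltration (F := F) (w := id) monotone_id
    (fun _ _ => le_rfl) (dividedPow_adOperator_mem (neg_mem hb)) (dividedPow_adOperator_mem hb) n
  rw [map_neg] at h1 h2
  rw [sum_congr rfl fun i _ => sum_dividedPow_neg (k := k) (adOperator A b) i] at h2
  rw [sum_ite_eq_of_mem' _ _ _ (by simp; omega)] at h2
  change _ ∈ operatorFiltration F n at h2
  have h3 := sub_mem (apply_mem_incorporatedFiltration h2 (p, 1)) (by rwa [zero_add] at h1)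
  rw [map_neg]
  convert h3 using 1
  simp only [LinearMap.sub_apply, Module.End.mul_apply, map_sub, Module.End.one_apply, expSum]
  abel

end Operators

/-! ### Series of elements of `L` -/

section Series

variable {k : Type*} [Field k] {L : Type*} [AddCommGroup L] [Module k L]
variable (A : DGLieAlgebra k L)

/-- The bracket of two series with coefficients in `L`. -/
def seriesBracket (c y : ℕ → L) (n : ℕ) : L :=
  ∑ ij ∈ antidiagonal n, A.bracket (c ij.1) (y ij.2)

variable (k) in
/-- The integral without constant term of a series with coefficients in `L`. -/
def seriesIntegral (e : ℕ → L) : ℕ → L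
  | 0 => 0
  | n + 1 => ((n : k) + 1)⁻¹ • e n

/-- The series of operators `∑ ad (c_n) t^n`. -/
def adSeries (c : ℕ → L) : PowerSeries (Module.End k (L × k)) :=
  PowerSeries.mk fun n => adOperator A (c n)

variable {A}

theorem seriesBracket_mem_deg {c y : ℕ → L} {i j : ℤ} (hc : ∀ n, c n ∈ A.deg i)
    (hy : ∀ n, y n ∈ A.deg j) (n : ℕ) : seriesBracket A c y n ∈ A.deg (i + j) :=
  Submodule.sum_mem _ fun _ _ => A.bracket_mem _ _ _ (hc _) _ (hy _)

theorem adSeries_seriesBracket {c y : ℕ → L} (hc : ∀ n, c n ∈ A.deg 0)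
    (hy : ∀ n, y n ∈ A.deg 0) :
    adSeries A (seriesBracket A c y) = commutator k (adSeries A c) (adSeries A y) := by
  ext1 n
  rw [commutator_apply, map_sub, PowerSeries.coeff_mul, PowerSeries.coeff_mul]
  simp only [adSeries, PowerSeries.coeff_mk, seriesBracket, map_sum]
  rw [← Nat.sum_antidiagonal_swap (f := fun ij => adOperator A (y ij.1) * adOperator A (c ij.2)),
    ← sum_sub_distrib]
  exact sum_congr rfl fun ij _ => adOperator_bracket (hc _) (hy _)

theorem adSeries_seriesBracket_iterate {c y : ℕ → L} (hc : ∀ n, c n ∈ A.deg 0)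
    (hy : ∀ n, y n ∈ A.deg 0) (i : ℕ) : (∀ n, (seriesBracket A c)^[i] y n ∈ A.deg 0) ∧
    adSeries A ((seriesBracket A c)^[i] y) = (commutator k (adSeries A c) ^ i) (adSeries A y) := by
  induction i with
  | zero => exact ⟨hy, rfl⟩
  | succ i ih =>
    rw [Function.iterate_succ_apply']
    refine ⟨fun n => by simpa using seriesBracket_mem_deg hc ih.1 n, ?_⟩
    rw [adSeries_seriesBracket hc ih.1, ih.2, pow_succ']
    rfl

theorem seriesDeriv_adSeries_seriesIntegral [CharZero k] (e : ℕ → L) :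
    seriesDeriv k (adSeries A (seriesIntegral k e)) = adSeries A e := by
  ext1 n
  rw [coeff_seriesDeriv]
  simp only [adSeries, PowerSeries.coeff_mk, seriesIntegral, ← map_smul]
  rw [smul_smul, mul_inv_cancel₀ (Nat.cast_add_one_ne_zero n), one_smul]

/-! ### Logarithms and sums of series in `L` -/

/-- When coefficient `n` of `Θ x` depends only on the earlier coefficients of `x`, coefficient `n`
of the iterates starting from zero is constant from the `(n + 1)`-st iterate on. The stable values
form the fixed point, and they stay in the sets `S n`. -/
theorem exists_fixedPoint_of_causal {M : Type*} [Zero M] (Θ : (ℕ → M) → ℕ → M)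
    (S : ℕ → Set M) (h0 : ∀ n, 0 ∈ S n) (hS : ∀ x, (∀ n, x n ∈ S n) → ∀ n, Θ x n ∈ S n)
    (hΘ : ∀ n x y, (∀ i < n, x i = y i) → Θ x n = Θ y n) :
    ∃ x, (∀ n, x n ∈ S n) ∧ ∀ n, x n = Θ x n := by
  have h1 : ∀ n a b, n < a → n < b → Θ^[a] 0 n = Θ^[b] 0 n := by
    intro n
    induction n using Nat.strong_induction_on with
    | _ n ih =>
      intro a b ha hb
      obtain ⟨a, rfl⟩ := Nat.exists_eq_add_of_lt ha
      obtain ⟨b, rfl⟩ := Nat.exists_eq_add_of_lt hb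
      rw [Function.iterate_succ_apply', Function.iterate_succ_apply']
      exact hΘ n _ _ fun i hi => ih i hi _ _ (by omega) (by omega)
  have h2 : ∀ m n, Θ^[m] 0 n ∈ S n := by
    intro m
    induction m with
    | zero => exact h0
    | succ m ih => rw [Function.iterate_succ_apply']; exact hS _ ih
  refine ⟨fun n => Θ^[n + 1] 0 n, fun n => h2 _ _, fun n => ?_⟩
  change Θ^[n + 1] 0 n = _
  rw [Function.iterate_succ_apply']
  exact hΘ n _ _ fun i hi => h1 i _ _ hi i.lt_succ_self

/-- Every series `b` with positive filtration is `∑ (ad c)^i c' / (i + 1)!` for some `c`. -/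
theorem exists_logarithm (F : CompleteFiltration A) {b : ℕ → L}
    (hb : ∀ n, b n ∈ A.deg 0) (hb' : ∀ n, b n ∈ F.F n) :
    ∃ e : ℕ → L, (∀ n, e n ∈ A.deg 0) ∧ (∀ n, e n ∈ F.F (n / 2 + 1)) ∧
      ∀ n, b n = ∑ i ∈ range (n + 1), (((i + 1).factorial : k)⁻¹) •
        (seriesBracket A (seriesIntegral k e))^[i] e n := by
  -- The equation is solved for its term `i = 0`, which is `e n` itself; hence the shifted indices
  -- `i + 1` and `i + 2`.
  let Θ : (ℕ → L) → ℕ → L := fun e n => b n - ∑ i ∈ range n, (((i + 2).factorial : k)⁻¹) •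
    (seriesBracket A (seriesIntegral k e))^[i + 1] e n
  -- The terms `b 0` and `b 1` are only known to lie in `F_1`, which suggests the rate `n / 2 + 1`.
  -- The bracket preserves it: the integral gains half a step, and `(j + 1) / 2 + (l / 2 + 1) ≥ (j +
  -- l) / 2 + 1`.
  let S : ℕ → Submodule k L := fun n => A.deg 0 ⊓ F.F (n / 2 + 1)
  have hI : ∀ e : ℕ → L, (∀ n, e n ∈ S n) → ∀ n,
      seriesIntegral k e n ∈ A.deg 0 ⊓ F.F ((n + 1) / 2) := by
    intro e he n
    cases n with
    | zero => exact zero_mem _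
    | succ n =>
      have h := he n
      exact ⟨Submodule.smul_mem _ _ h.1, Submodule.smul_mem _ _ (F.anti (by omega) h.2)⟩
  have hS : ∀ e : ℕ → L, (∀ n, e n ∈ S n) → ∀ i n,
      (seriesBracket A (seriesIntegral k e))^[i] e n ∈ S n := by
    intro e he i
    induction i with
    | zero => exact he
    | succ i ih =>
      intro n
      rw [Function.iterate_succ_apply']
      refine Submodule.sum_mem _ fun jl hjl => ⟨?_, ?_⟩
      · simpa using A.bracket_mem 0 0 _ (hI e he jl.1).1 _ (ih jl.2).1
      · refine F.anti ?_ (F.bracket_mem _ _ _ (hI e he jl.1).2 _ (ih jl.2).2)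
        have := HasAntidiagonal.mem_antidiagonal.1 hjl
        omega
  have hb'' : ∀ n, b n ∈ S n := by
    intro n
    refine ⟨hb n, ?_⟩
    by_cases h : n < 2
    · rw [Nat.div_eq_of_lt h]
      exact F.deg_zero_le (hb n)
    · exact F.anti (by omega) (hb' n)
  -- The integral of `e` has no constant term and its coefficient `j + 1` involves only `e j`. So a
  -- bracket with it delays the dependence on `e` by one index, and every term with at least one
  -- bracket is causal.
  have hcausal : ∀ n (e e' : ℕ → L), (∀ i < n, e i = e' i) → ∀ i, ∀ j < n + 1,
      (seriesBracket A (seriesIntegral k e))^[i + 1] e j =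
        (seriesBracket A (seriesIntegral k e'))^[i + 1] e' j := by
    intro n e e' h
    have hI' : ∀ j < n + 1, seriesIntegral k e j = seriesIntegral k e' j := by
      intro j hj
      cases j with
      | zero => rfl
      | succ j => rw [seriesIntegral, seriesIntegral, h j (by omega)]
    have step : ∀ y y' : ℕ → L, (∀ j < n, y j = y' j) → ∀ j < n + 1,
        seriesBracket A (seriesIntegral k e) y j = seriesBracket A (seriesIntegral k e') y' j := by
      intro y y' hy j hj
      refine sum_congr rfl fun ab hab => ?_
      have := HasAntidiagonal.mem_antidiagonal.1 hab
      rw [hI' _ (by omega)]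
      by_cases h0 : ab.1 = 0
      · rw [h0, seriesIntegral, map_zero, LinearMap.zero_apply, LinearMap.zero_apply]
      · rw [hy _ (by omega)]
    intro i
    induction i with
    | zero => exact step _ _ h
    | succ i ih =>
      rw [Function.iterate_succ_apply', Function.iterate_succ_apply' (n := i + 1)]
      exact step _ _ fun j hj => ih j (by omega)
  obtain ⟨e, he, he'⟩ := exists_fixedPoint_of_causal Θ (fun n => (S n : Set L))
    (fun n => zero_mem _)
    (fun e he n => sub_mem (hb'' n) (Submodule.sum_mem _ fun i _ =>
      Submodule.smul_mem _ _ (hS e he _ n)))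
    (fun n e e' h => by
      simp only [Θ]
      rw [sum_congr rfl fun i _ => by rw [hcausal n e e' h i n n.lt_succ_self]])
  refine ⟨e, fun n => (he n).1, fun n => (he n).2, fun n => ?_⟩
  have h := he' n
  simp only [Θ] at h
  rw [sum_range_succ']
  simp only [Function.iterate_zero, id, zero_add, Nat.factorial_one, Nat.cast_one, inv_one,
    one_smul]
  rw [eq_sub_iff_add_eq'] at h
  exact h.symm

/-- A series of degree `i` whose coefficients tend to zero has a sum. -/
theorem exists_sum (F : CompleteFiltration A) {i : ℤ} {c : ℕ → L} (hc : ∀ n, c n ∈ A.deg i)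
    {w : ℕ → ℕ} (hw : Monotone w) (hw' : ∀ n, n ≤ w (2 * n)) (hc' : ∀ n, c n ∈ F.F (w n)) :
    ∃ C ∈ A.deg i, ∀ N, ∑ n ∈ range N, c n - C ∈ F.F (w N) := by
  have hd : ∀ m n, m ≤ n → ∑ i ∈ range n, c i - ∑ i ∈ range m, c i ∈ F.F (w m) := by
    intro m n h
    rw [← sum_range_add_sum_Ico _ h, add_sub_cancel_left]
    exact Submodule.sum_mem _ fun j hj => F.anti (hw (mem_Ico.1 hj).1) (hc' j)
  -- Completeness asks for errors in `F_p` at stage `p`. Partial sums with `2 p` terms achieve this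
  -- because `p ≤ w (2 p)`.
  obtain ⟨C, hC, h⟩ := F.complete i (fun p => ∑ n ∈ range (2 * p), c n)
    (fun p => Submodule.sum_mem _ fun n _ => hc n)
    (fun p => F.anti (hw' p) (hd _ _ (by omega)))
  -- The partial sum at `N` is compared with `C` through the one at `2 * max (w N) N`, which has at
  -- least `N` terms and is within `F_(w N)` of `C`.
  refine ⟨C, hC, fun N => ?_⟩
  have h1 := F.anti (le_max_left (w N) N) (h (max (w N) N))
  have h2 := hd N (2 * max (w N) N) (by omega)
  have h3 := neg_mem (add_mem h1 h2)
  convert h3 using 1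
  abel

/-- A solution of `v' = (ad B) v` which tends to a sum `(q, 1)` moves `p` to `q` by a gauge
transformation. -/
theorem exists_gaugeAct_of_flow [CharZero k] (F : CompleteFiltration A) {B : ℕ → L}
    (hB : ∀ n, B n ∈ A.deg 0) (hB' : ∀ n, B n ∈ F.F n) {v : ℕ → L × k} {p q : L}
    (hv : v 0 = (p, 1)) (hflow : ∀ n : ℕ, ((n : k) + 1) • v (n + 1) =
      ∑ ij ∈ antidiagonal n, adOperator A (B ij.1) (v ij.2))
    (hsum : ∀ m, ∃ n₀, ∀ n ≥ n₀, ∑ i ∈ range n, v i - (q, 1) ∈ incorporatedFiltration F m) :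
    ∃ C ∈ A.deg 0, GaugeAct F C p q := by
  obtain ⟨e, he, he', heq⟩ := exists_logarithm F hB hB'
  have hw : Monotone fun n : ℕ => (n + 1) / 2 := fun a b h => Nat.div_le_div_right (by omega)
  have hc : ∀ n, seriesIntegral k e n ∈ A.deg 0 := by
    intro n
    cases n with
    | zero => exact zero_mem _
    | succ n => exact Submodule.smul_mem _ _ (he n)
  have hc' : ∀ n, seriesIntegral k e n ∈ F.F ((n + 1) / 2) := by
    intro n
    cases n with
    | zero => exact zero_mem _
    | succ n => exact Submodule.smul_mem _ _ (F.anti (by omega) (he' n))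
  obtain ⟨C, hC, hCsum⟩ := exists_sum F hc hw (fun n => by omega) hc'
  set X := adSeries A (seriesIntegral k e) with hX
  have hX0 : PowerSeries.coeff 0 X = 0 := by
    simp [hX, adSeries, seriesIntegral]
  -- `heq` says precisely that `B` is the logarithmic derivative of `exp(ad c)`.
  have hode : seriesDeriv k (expSeries k X) = adSeries A B * expSeries k X := by
    refine seriesDeriv_expSeries hX0 fun n => ?_
    rw [adSeries, PowerSeries.coeff_mk, heq, map_sum]
    refine sum_congr rfl fun i _ => ?_
    rw [hX, seriesDeriv_adSeries_seriesIntegral,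
      ← (adSeries_seriesBracket_iterate hc he i).2, map_smul]
    simp [adSeries]
  -- Uniqueness of formal solutions: in characteristic zero `n + 1` can be cancelled, so each
  -- coefficient is determined by the previous ones.
  have hv' : ∀ n, v n = PowerSeries.coeff n (expSeries k X) (p, 1) := by
    intro n
    induction n using Nat.strong_induction_on with
    | _ n ih =>
      cases n with
      | zero => rw [hv, coeff_expSeries hX0 zero_lt_one]; simp
      | succ n =>
        have h := congrArg (fun f : PowerSeries (Module.End k (L × k)) =>
          PowerSeries.coeff n f (p, 1)) hode
        simp only [coeff_seriesDeriv, PowerSeries.coeff_mul, LinearMap.smul_apply,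
          LinearMap.sum_apply, Module.End.mul_apply] at h
        refine smul_right_injective _ (Nat.cast_add_one_ne_zero n : (n : k) + 1 ≠ 0) ?_
        change ((n : k) + 1) • _ = ((n : k) + 1) • _
        rw [h, hflow]
        refine sum_congr rfl fun ij hij => ?_
        have := HasAntidiagonal.mem_antidiagonal.1 hij
        rw [ih _ (by omega)]
        simp [adSeries]
  -- Evaluation at `t = 1` is multiplicative: the coefficients of `(ad c)^j` sum to `(ad C)^j`, with
  -- rate `(N + 1) / 2` uniformly in `j`.
  have hpow : ∀ j, (∀ n, PowerSeries.coeff n (X ^ j) ∈ operatorFiltration F ((n + 1) / 2)) ∧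
      ∀ N, ∑ n ∈ range N, PowerSeries.coeff n (X ^ j) - adOperator A C ^ j
        ∈ operatorFiltration F ((N + 1) / 2) := by
    have h1 : ∀ n, PowerSeries.coeff n X ∈ operatorFiltration F ((n + 1) / 2) := fun n => by
      simpa [hX, adSeries] using adOperator_mem (hc' n)
    have h2 : ∀ N, ∑ n ∈ range N, PowerSeries.coeff n X - adOperator A C
        ∈ operatorFiltration F ((N + 1) / 2) := fun N => by
      simpa [hX, adSeries] using adOperator_mem (hCsum N)
    intro j
    induction j with
    | zero =>
      refine ⟨fun n => ?_, fun N => ?_⟩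
      · rw [pow_zero, PowerSeries.coeff_one]
        split_ifs with h
        · rw [h]; exact one_mem_operatorFiltration F
        · exact zero_mem _
      · cases N with
        | zero =>
          simpa using one_mem_operatorFiltration F
        | succ N =>
          rw [sum_range_succ']
          simp [PowerSeries.coeff_one]
    | succ j ih =>
      refine ⟨fun n => ?_, fun N => ?_⟩
      · rw [pow_succ, PowerSeries.coeff_mul]
        refine Submodule.sum_mem _ fun ij hij => ?_
        have := HasAntidiagonal.mem_antidiagonal.1 hij
        exact operatorFiltration_anti F (by omega)
          (mul_mem_operatorFiltration (ih.1 ij.1) (h1 ij.2))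
      -- With `S` the partial sum of `X` and `T` that of `X ^ j`, the error splits as `(T - (ad
      -- C)^j) S + (ad C)^j (S - ad C)`, up to the truncation error of the product `T S`.
      · have h3 := sum_mul_sum_sub_mem_operatorFiltration (F := F) hw
          (fun a b => (by omega : (a + b + 1) / 2 ≤ (a + 1) / 2 + (b + 1) / 2)) ih.1 h1 N
        have h4 : ∑ n ∈ range N, PowerSeries.coeff n X ∈ operatorFiltration F 0 :=
          Submodule.sum_mem _ fun n _ => operatorFiltration_anti F (Nat.zero_le _) (h1 n)
        have h5 := mul_mem_operatorFiltration (ih.2 N) h4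
        have h6 := mul_mem_operatorFiltration (pow_mem_operatorFiltration (p := 0)
          (adOperator_mem_zero (F := F) C) j) (h2 N)
        rw [mul_zero, zero_add] at h6
        rw [add_zero] at h5
        have h7 := add_mem (sub_mem h5 h3) h6
        simp only [pow_succ, PowerSeries.coeff_mul]
        convert h7 using 1
        rw [mul_sub, sub_mul]
        abel
  refine ⟨C, hC, gaugeAct_iff.2 fun m => ?_⟩
  obtain ⟨n₀, hn₀⟩ := hsum m
  -- The factor `2` compensates the rate `(n + 1) / 2`.
  refine ⟨max n₀ (2 * m), fun n hn => ?_⟩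
  have h1 : ∑ i ∈ range n, PowerSeries.coeff i (expSeries k X) - expSum (adOperator A C) n
      ∈ operatorFiltration F ((n + 1) / 2) := by
    have h2 : ∑ i ∈ range n, PowerSeries.coeff i (expSeries k X) =
        ∑ j ∈ range n, ((j.factorial : k)⁻¹) • ∑ i ∈ range n, PowerSeries.coeff i (X ^ j) := by
      rw [sum_congr rfl fun i hi => coeff_expSeries hX0 (mem_range.1 hi), sum_comm]
      simp only [smul_sum]
    rw [h2, expSum, ← sum_sub_distrib]
    refine Submodule.sum_mem _ fun j _ => ?_
    convert Submodule.smul_mem _ ((j.factorial : k)⁻¹) ((hpow j).2 n) using 1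
    exact (smul_sub (_ : k) _ _).symm
  have h3 := incorporatedFiltration_anti F (by omega : m ≤ (n + 1) / 2)
    (apply_mem_incorporatedFiltration h1 (p, 1))
  have h4 := sub_mem (hn₀ n (by omega)) h3
  convert h4 using 1
  simp only [hv', LinearMap.sub_apply, LinearMap.sum_apply]
  abel

end Series

/-! ### Composition of gauge transformations and their relation to paths -/

section Gauge

variable {k : Type*} [Field k] [CharZero k] {L : Type*} [AddCommGroup L] [Module k L]
variable {A : DGLieAlgebra k L} {F : CompleteFiltration A}

/-- The composite of two gauge transformations is a gauge transformation. -/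
theorem GaugeAct.trans {a b p q r : L} (ha : a ∈ A.deg 0) (hb : b ∈ A.deg 0)
    (hpq : GaugeAct F b p q) (hqr : GaugeAct F a q r) : ∃ C ∈ A.deg 0, GaugeAct F C p r := by
  let α := adOperator A a
  let β := adOperator A b
  let x : ℕ → Module.End k (L × k) := fun i => ((i.factorial : k)⁻¹) • α ^ i
  let y : ℕ → Module.End k (L × k) := fun i => ((i.factorial : k)⁻¹) • β ^ i
  -- `g` lists the coefficients of `exp(t a) exp(t b)` and `c` those of `exp(t ad a) b`. The
  -- logarithmic derivative of `g` is `a + exp(t ad a) b`, whose coefficients form `B`.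
  let g : ℕ → Module.End k (L × k) := fun n => ∑ ij ∈ antidiagonal n, x ij.1 * y ij.2
  let c : ℕ → L := fun n => ((n.factorial : k)⁻¹) • (A.bracket a)^[n] b
  let B : ℕ → L := fun n => (if n = 0 then a else 0) + c n
  have hiter : ∀ n, (A.bracket a)^[n] b ∈ A.deg 0 ∧ (A.bracket a)^[n] b ∈ F.F (n + 1) ∧
      adOperator A ((A.bracket a)^[n] b) = (commutator k α ^ n) β := by
    intro n
    induction n with
    | zero => exact ⟨hb, F.deg_zero_le hb, rfl⟩
    | succ n ih =>
      rw [Function.iterate_succ_apply']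
      refine ⟨by simpa using A.bracket_mem 0 0 _ ha _ ih.1, ?_, ?_⟩
      · rw [add_comm]
        exact F.bracket_mem _ _ _ (F.deg_zero_le ha) _ ih.2.1
      · rw [adOperator_bracket ha ih.1, ih.2.2, pow_succ']
        rfl
  have hB : ∀ n, B n ∈ A.deg 0 := fun n =>
    add_mem (by split_ifs; exacts [ha, zero_mem _]) (Submodule.smul_mem _ _ (hiter n).1)
  have hB' : ∀ n, B n ∈ F.F n := by
    intro n
    refine add_mem ?_ (Submodule.smul_mem _ _ (F.anti n.le_succ (hiter n).2.1))
    split_ifs with h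
    · rw [h, F.F_zero]
      exact Submodule.mem_top
    · exact zero_mem _
  have hx : ∀ n : ℕ, ((n : k) + 1) • x (n + 1) = α * x n := by
    intro n
    simp only [x]
    rw [smul_smul, Nat.factorial_succ, Nat.cast_mul, Nat.cast_succ, mul_inv, ← mul_assoc,
      mul_inv_cancel₀ (Nat.cast_add_one_ne_zero n), one_mul, pow_succ', mul_smul_comm]
  have hy : ∀ n : ℕ, ((n : k) + 1) • y (n + 1) = β * y n := by
    intro n
    simp only [y]
    rw [smul_smul, Nat.factorial_succ, Nat.cast_mul, Nat.cast_succ, mul_inv, ← mul_assoc,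
      mul_inv_cancel₀ (Nat.cast_add_one_ne_zero n), one_mul, pow_succ', mul_smul_comm]
  have hg : ∀ n : ℕ, ((n : k) + 1) • g (n + 1) =
      ∑ ij ∈ antidiagonal n, adOperator A (B ij.1) * g ij.2 := by
    intro n
    -- This is `exp(t a) b = (exp(t ad a) b) exp(t a)`: it moves the `b` that arises from
    -- differentiating the second factor to the left.
    have h1 : PowerSeries.mk (fun i => x i * β) =
        PowerSeries.mk (fun i => adOperator A (c i)) * PowerSeries.mk x := by
      ext1 i
      rw [PowerSeries.coeff_mul, PowerSeries.coeff_mk]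
      simp only [x, PowerSeries.coeff_mk, smul_mul_assoc]
      rw [← smul_mul_assoc, smul_mul_assoc, dividedPow_mul]
      refine sum_congr rfl fun ij _ => ?_
      rw [map_smul, (hiter _).2.2, smul_mul_assoc]
    have h2 : ∑ ij ∈ antidiagonal n, x ij.1 * β * y ij.2 =
        ∑ ij ∈ antidiagonal n, adOperator A (c ij.1) * g ij.2 := by
      have h3 := congrArg (fun f => PowerSeries.coeff n (f * PowerSeries.mk y)) h1
      simp only [mul_assoc (PowerSeries.mk fun i => adOperator A (c i))] at h3
      simpa [PowerSeries.coeff_mul] using h3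
    have h4 : ∑ ij ∈ antidiagonal n, adOperator A (if ij.1 = 0 then a else 0) * g ij.2 =
        α * g n := by
      rw [sum_eq_single (0, n)]
      · simp [α]
      · rintro ⟨i, j⟩ hij hne
        have : i ≠ 0 := by
          rintro rfl
          exact hne (by simpa using HasAntidiagonal.mem_antidiagonal.1 hij)
        simp [this]
      · intro h
        exact absurd (HasAntidiagonal.mem_antidiagonal.2 (zero_add n)) h
    simp only [g] at h2 h4 ⊢
    rw [sum_antidiagonal_leibniz (fun i j => x i * y j), sum_add_distrib]
    simp only [B, map_add, add_mul, sum_add_distrib, h4, ← h2]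
    congr 1
    · rw [mul_sum]
      refine sum_congr rfl fun ij _ => ?_
      rw [← smul_mul_assoc, hx, mul_assoc]
    · refine sum_congr rfl fun ij _ => ?_
      rw [← mul_smul_comm, hy, mul_assoc]
  refine exists_gaugeAct_of_flow F hB hB' (v := fun n => g n (p, 1)) (by simp [g, x, y])
    (fun n => ?_) (fun m => ⟨m, fun n hn => incorporatedFiltration_anti F hn ?_⟩)
  · have h := congrArg (fun φ : Module.End k (L × k) => φ (p, 1)) (hg n)
    simpa only [LinearMap.smul_apply, LinearMap.sum_apply, Module.End.mul_apply] using h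
  · have h1 := sum_mul_sum_sub_mem_operatorFiltration (F := F) (w := id) monotone_id
      (fun _ _ => le_rfl) (dividedPow_adOperator_mem ha) (dividedPow_adOperator_mem hb) n
    change _ ∈ operatorFiltration F n at h1
    have h2 := expSum_mem (F := F) a n n _ (hpq.expSum_sub_mem hb n)
    rw [zero_add] at h2
    have h3 := add_mem (sub_mem h2 (apply_mem_incorporatedFiltration h1 (p, 1)))
      (hqr.expSum_sub_mem ha n)
    convert h3 using 1
    simp only [LinearMap.sub_apply, Module.End.mul_apply, map_sub, LinearMap.sum_apply, expSum, g,
      x, y, α, β]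
    abel

theorem gaugeEquivalent_equivalence (F : CompleteFiltration A) :
    Equivalence (GaugeEquivalent F) where
  refl p := ⟨0, zero_mem _, gaugeAct_zero p.1⟩
  symm := fun ⟨b, hb, h⟩ => ⟨-b, neg_mem hb, h.symm hb⟩
  trans := fun ⟨_, hb, h⟩ ⟨_, ha, h'⟩ => h.trans ha hb h'

/-! ### Paths of Maurer-Cartan elements -/

/-- The Maurer-Cartan elements `∑ P_n t^n + ∑ B_n t^n dt` of the completed tensor product of `L`
with the polynomial forms on the line. -/
structure IsPath (F : CompleteFiltration A) (P B : ℕ → L) : Prop where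
  P_deg : ∀ n, P n ∈ A.deg 1
  P_mem : ∀ n, P n ∈ F.F n
  B_deg : ∀ n, B n ∈ A.deg 0
  B_mem : ∀ n, B n ∈ F.F n
  maurerCartan : ∀ n, A.d (P n) + (2 : k)⁻¹ • seriesBracket A P P n = 0
  flow : ∀ n : ℕ, ((n : k) + 1) • P (n + 1) = seriesBracket A B P n - A.d (B n)

/-- The path leads from `p` to `q`. -/
structure PathJoins (F : CompleteFiltration A) (P : ℕ → L) (p q : L) : Prop where
  zero : P 0 = p
  sum : ∀ N, ∑ i ∈ range N, P i - q ∈ F.F N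

/-- The flow equation for `P` is the linear equation `v' = (ad B) v` for `v = d + P(t)`; the term
`-dB` is the bracket of `B` with the constant `d`, which sits in coefficient `0`. -/
theorem IsPath.exists_gaugeAct {P B : ℕ → L} {p q : L} (h : IsPath F P B)
    (hpq : PathJoins F P p q) : ∃ b ∈ A.deg 0, GaugeAct F b p q := by
  refine exists_gaugeAct_of_flow F h.B_deg h.B_mem (v := fun n => (P n, if n = 0 then 1 else 0))
    (by simp [hpq.zero]) (fun n => ?_) (fun m => ⟨m + 1, fun n hn => ?_⟩)
  · have h1 := h.flow n
    simp only [adOperator_apply]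
    refine Prod.ext ?_ ?_
    · simp only [Prod.smul_fst, h1, Prod.fst_sum, sum_sub_distrib, seriesBracket]
      congr 1
      rw [sum_eq_single (n, 0)]
      · simp
      · rintro ⟨i, j⟩ hij hne
        have : j ≠ 0 := by
          rintro rfl
          exact hne (by simpa using HasAntidiagonal.mem_antidiagonal.1 hij)
        simp [this]
      · intro h
        exact absurd (HasAntidiagonal.mem_antidiagonal.2 (add_zero n)) h
    · simp [Prod.snd_sum]
  · refine ⟨?_, fun _ => ?_⟩
    · rw [Prod.fst_sub, Prod.fst_sum]
      exact F.anti (by omega) (hpq.sum n)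
    -- As `n ≥ m + 1 > 0`, the index `0` is in the range and the scalar components sum to `1`.
    · rw [Prod.snd_sub, Prod.snd_sum, sum_ite_eq_of_mem' _ _ _ (by simp; omega), sub_self]

/-- The path is `P(t) = exp(t b)(d + p) - d`, and `B` is the constant `b`. -/
theorem exists_path_of_gaugeAct {b p q : L} (hb : b ∈ A.deg 0) (hp : p ∈ A.deg 1)
    (hp' : A.d p + (2 : k)⁻¹ • A.bracket p p = 0) (h : GaugeAct F b p q) :
    ∃ P B : ℕ → L, IsPath F P B ∧ PathJoins F P p q := by
  let v : ℕ → L × k := fun n => (((n.factorial : k)⁻¹) • adOperator A b ^ n) (p, 1)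
  let P : ℕ → L := fun n => (v n).1
  have hP0 : P 0 = p := by simp [P, v]
  have hv2 : ∀ n, (v n).2 = if n = 0 then 1 else 0 := by
    intro n
    cases n with
    | zero => simp [v]
    | succ n => simp [v, pow_succ', adOperator_apply]
  have hv : ∀ n : ℕ, ((n : k) + 1) • v (n + 1) = adOperator A b (v n) := by
    intro n
    simp only [v, LinearMap.smul_apply]
    rw [smul_smul, Nat.factorial_succ, Nat.cast_mul, Nat.cast_succ, mul_inv, ← mul_assoc,
      mul_inv_cancel₀ (Nat.cast_add_one_ne_zero n), one_mul, pow_succ', map_smul]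
    rfl
  have hP : ∀ n : ℕ, ((n : k) + 1) • P (n + 1) =
      A.bracket b (P n) - (if n = 0 then A.d b else 0) := by
    intro n
    have h1 := congrArg Prod.fst (hv n)
    rw [adOperator_apply, hv2] at h1
    simpa using h1
  have hdeg : ∀ n, P n ∈ A.deg 1 := by
    intro n
    induction n with
    | zero => rwa [hP0]
    | succ n ih =>
      have h1 : ((n : k) + 1) • P (n + 1) ∈ A.deg 1 := by
        rw [hP]
        refine sub_mem (by simpa using A.bracket_mem 0 1 _ hb _ ih) ?_
        split_ifs
        · simpa using A.d_mem 0 _ hb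
        · exact zero_mem _
      exact (Submodule.smul_mem_iff _ (Nat.cast_add_one_ne_zero n)).1 h1
  have hsymm : ∀ x ∈ A.deg 1, ∀ y ∈ A.deg 1, A.bracket x y = A.bracket y x := fun x hx y hy => by
    simpa using A.bracket_skew 1 1 x hx y hy
  have hdb : A.d b ∈ A.deg 1 := by simpa using A.d_mem 0 _ hb
  have hbr : ∀ x ∈ A.deg 1, A.bracket b x ∈ A.deg 1 := fun x hx => by
    simpa using A.bracket_mem 0 1 _ hb _ hx
  have hjac : ∀ x ∈ A.deg 1, ∀ y, A.bracket b (A.bracket x y) =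
      A.bracket (A.bracket b x) y + A.bracket x (A.bracket b y) := fun x hx y => by
    simpa using A.jacobi 0 1 b hb x hx y
  have hd : ∀ x, A.d (A.bracket b x) = A.bracket (A.d b) x + A.bracket b (A.d x) := fun x => by
    simpa using A.leibniz 0 b hb x
  -- For `R = dP + 1/2 [P, P]` the flow gives `R' = [b, R]`, the two contributions `[P, db]`
  -- cancelling. Hence `R(0) = 0` propagates to all coefficients.
  have hmc : ∀ n, A.d (P n) + (2 : k)⁻¹ • seriesBracket A P P n = 0 := by
    intro n
    induction n with
    | zero => simpa [seriesBracket, hP0] using hp'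
    | succ n ih =>
      refine (smul_eq_zero.1 ?_).resolve_left (Nat.cast_add_one_ne_zero n : (n : k) + 1 ≠ 0)
      have h1 : ((n : k) + 1) • seriesBracket A P P (n + 1) =
          (2 : k) • ∑ ij ∈ antidiagonal n, A.bracket (P ij.1) (((ij.2 : k) + 1) • P (ij.2 + 1)) := by
        rw [seriesBracket, sum_antidiagonal_leibniz (fun i j => A.bracket (P i) (P j)),
          sum_add_distrib, two_smul]
        congr 1
        · rw [← Nat.sum_antidiagonal_swap]
          refine sum_congr rfl fun ij _ => ?_
          rw [hsymm _ (hdeg _) _ (Submodule.smul_mem _ _ (hdeg _)), map_smul,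
            LinearMap.smul_apply]
          rfl
        · refine sum_congr rfl fun ij _ => ?_
          rw [map_smul]
      have h2 : ∑ ij ∈ antidiagonal n, A.bracket (P ij.1) (((ij.2 : k) + 1) • P (ij.2 + 1)) =
          ∑ ij ∈ antidiagonal n, A.bracket (P ij.1) (A.bracket b (P ij.2)) -
            A.bracket (P n) (A.d b) := by
        simp only [hP, map_sub, sum_sub_distrib]
        congr 1
        rw [sum_eq_single (n, 0)]
        · simp
        · rintro ⟨i, j⟩ hij hne
          have : j ≠ 0 := by
            rintro rfl
            exact hne (by simpa using HasAntidiagonal.mem_antidiagonal.1 hij)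
          simp [this]
        · intro h
          exact absurd (HasAntidiagonal.mem_antidiagonal.2 (add_zero n)) h
      have h3 : A.bracket b (seriesBracket A P P n) =
          (2 : k) • ∑ ij ∈ antidiagonal n, A.bracket (P ij.1) (A.bracket b (P ij.2)) := by
        rw [seriesBracket, map_sum, sum_congr rfl fun ij _ => hjac _ (hdeg _) _, sum_add_distrib, two_smul]
        congr 1
        rw [← Nat.sum_antidiagonal_swap]
        refine sum_congr rfl fun ij _ => ?_
        rw [hsymm _ (hbr _ (hdeg _)) _ (hdeg _)]
        rfl
      have h4 : A.d (((n : k) + 1) • P (n + 1)) =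
          A.bracket (P n) (A.d b) + A.bracket b (A.d (P n)) := by
        rw [hP, map_sub, hd, hsymm _ hdb _ (hdeg n)]
        split_ifs <;> simp [A.d_d]
      have h5 : (2 : k)⁻¹ • (2 : k) • ∑ ij ∈ antidiagonal n,
          A.bracket (P ij.1) (A.bracket b (P ij.2)) =
          (2 : k)⁻¹ • A.bracket b (seriesBracket A P P n) := by rw [h3]
      rw [smul_smul, inv_mul_cancel₀ two_ne_zero, one_smul] at h5
      rw [smul_add, ← map_smul, h4, smul_comm, h1, smul_smul, inv_mul_cancel₀ two_ne_zero, one_smul,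
        h2, h5, ← map_smul]
      have h6 : A.bracket b (A.d (P n) + (2 : k)⁻¹ • seriesBracket A P P n) = 0 := by
        rw [ih, map_zero]
      rw [map_add] at h6
      rw [← h6]
      abel
  refine ⟨P, fun n => if n = 0 then b else 0, ⟨hdeg, fun n => ?_, fun n => ?_, fun n => ?_, hmc,
    fun n => ?_⟩, ⟨hP0, fun N => ?_⟩⟩
  · exact (apply_mem_incorporatedFiltration (F := F) (dividedPow_adOperator_mem hb n) (p, 1)).1
  · split_ifs
    exacts [hb, zero_mem _]
  · split_ifs with hn
    · rw [hn, F.F_zero]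
      exact Submodule.mem_top
    · exact zero_mem _
  · rw [hP, seriesBracket, sum_eq_single (0, n)]
    · congr 1
      split_ifs <;> simp
    · rintro ⟨i, j⟩ hij hne
      have : i ≠ 0 := by
        rintro rfl
        exact hne (by simpa using HasAntidiagonal.mem_antidiagonal.1 hij)
      simp [this]
    · intro h
      exact absurd (HasAntidiagonal.mem_antidiagonal.2 (zero_add n)) h
  · have h1 := (h.expSum_sub_mem hb N).1
    simpa [expSum, Prod.fst_sum, P, v] using h1

end Gauge

/-! ### Antidiagonals in `ℕ × ℕ` -/

/-- In an index `(n, e)`, `n` is the power of `t` and `e` the number of factors `u`. Sums over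
antidiagonals then treat both kinds of basis elements of `J` at once; only `e ≤ 1` occurs in `J`. -/
instance natProdHasAntidiagonal : HasAntidiagonal (ℕ × ℕ) where
  antidiagonal n := (antidiagonal n.1 ×ˢ antidiagonal n.2).map
    (Equiv.prodProdProdComm ℕ ℕ ℕ ℕ).toEmbedding
  mem_antidiagonal := by
    rintro ⟨n, e⟩ ⟨⟨i, a⟩, ⟨j, b⟩⟩
    simp only [mem_map_equiv, mem_product, HasAntidiagonal.mem_antidiagonal,
      Equiv.prodProdProdComm_symm, Equiv.prodProdProdComm_apply, Prod.mk_add_mk, Prod.mk.injEq]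

theorem sum_antidiagonal_prod {M : Type*} [AddCommMonoid M] (f : (ℕ × ℕ) × (ℕ × ℕ) → M)
    (n e : ℕ) : ∑ ab ∈ antidiagonal (n, e), f ab =
      ∑ ij ∈ antidiagonal n, ∑ cd ∈ antidiagonal e, f ((ij.1, cd.1), (ij.2, cd.2)) := by
  rw [← sum_product']
  exact sum_map _ _ _

theorem sum_antidiagonal_prod_zero {M : Type*} [AddCommMonoid M] (f : (ℕ × ℕ) × (ℕ × ℕ) → M)
    (n : ℕ) : ∑ ab ∈ antidiagonal (n, 0), f ab =
      ∑ ij ∈ antidiagonal n, f ((ij.1, 0), (ij.2, 0)) := by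
  simp [sum_antidiagonal_prod]

theorem sum_antidiagonal_prod_one {M : Type*} [AddCommMonoid M] (f : (ℕ × ℕ) × (ℕ × ℕ) → M)
    (n : ℕ) : ∑ ab ∈ antidiagonal (n, 1), f ab =
      ∑ ij ∈ antidiagonal n, (f ((ij.1, 0), (ij.2, 1)) + f ((ij.1, 1), (ij.2, 0))) := by
  rw [sum_antidiagonal_prod]
  refine sum_congr rfl fun ij _ => ?_
  rw [Nat.sum_antidiagonal_succ]
  simp

theorem sum_antidiagonal_assoc {Γ M : Type*} [AddCommMonoid Γ] [HasAntidiagonal Γ]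
    [AddCommMonoid M] (f : Γ → Γ → Γ → M) (n : Γ) :
    ∑ ab ∈ antidiagonal n, ∑ cd ∈ antidiagonal ab.2, f ab.1 cd.1 cd.2 =
      ∑ ab ∈ antidiagonal n, ∑ cd ∈ antidiagonal ab.1, f cd.1 cd.2 ab.2 := by
  rw [sum_sigma', sum_sigma']
  refine sum_nbij' (fun x => ⟨(x.1.1 + x.2.1, x.2.2), (x.1.1, x.2.1)⟩)
    (fun x => ⟨(x.2.1, x.2.2 + x.1.2), (x.2.2, x.1.2)⟩) ?_ ?_ ?_ ?_ ?_
  · rintro ⟨⟨a, b⟩, ⟨c, d⟩⟩ h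
    simp only [mem_sigma, HasAntidiagonal.mem_antidiagonal] at h ⊢
    exact ⟨by rw [add_assoc, h.2, h.1], trivial⟩
  · rintro ⟨⟨a, b⟩, ⟨c, d⟩⟩ h
    simp only [mem_sigma, HasAntidiagonal.mem_antidiagonal] at h ⊢
    exact ⟨by rw [← add_assoc, h.2, h.1], trivial⟩
  · rintro ⟨⟨a, b⟩, ⟨c, d⟩⟩ h
    simp only [mem_sigma, HasAntidiagonal.mem_antidiagonal] at h
    simp [h.2]
  · rintro ⟨⟨a, b⟩, ⟨c, d⟩⟩ h
    simp only [mem_sigma, HasAntidiagonal.mem_antidiagonal] at h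
    simp [h.2]
  · intro _ _
    rfl

theorem sum_antidiagonal_comm {Γ M : Type*} [AddCommMonoid Γ] [HasAntidiagonal Γ]
    [AddCommMonoid M] (n : Γ) (f : Γ → Γ → M) :
    ∑ ab ∈ antidiagonal n, f ab.1 ab.2 = ∑ ab ∈ antidiagonal n, f ab.2 ab.1 :=
  sum_equiv (Equiv.prodComm _ _) (by simp [add_comm]) (by simp)

/-! ### Linear maps on the tensor coalgebra -/

section TensorMaps

variable {k : Type*} [Field k] {L : Type*} [AddCommGroup L] [Module k L]

theorem mem_span_word (t : TensorAlgebra k L) :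
    t ∈ Submodule.span k (Set.range (word (k := k) (L := L))) := by
  induction t using TensorAlgebra.induction with
  | algebraMap r =>
    rw [Algebra.algebraMap_eq_smul_one]
    exact Submodule.smul_mem _ _ (Submodule.subset_span ⟨[], rfl⟩)
  | ι x => exact Submodule.subset_span ⟨[x], by simp [word]⟩
  | mul a b ha hb =>
    have h := Submodule.mul_mem_mul ha hb
    rw [Submodule.span_mul_span] at h
    refine Submodule.span_mono ?_ h
    rintro _ ⟨_, ⟨l, rfl⟩, _, ⟨l', rfl⟩, rfl⟩
    exact ⟨l ++ l', word_append l l'⟩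
  | add a b ha hb => exact add_mem ha hb

theorem tensor_linearMap_ext {M : Type*} [AddCommGroup M] [Module k M]
    {f g : TensorAlgebra k L →ₗ[k] M} (h1 : f 1 = g 1)
    (h : ∀ x t, f t = g t → f (TensorAlgebra.ι k x * t) = g (TensorAlgebra.ι k x * t))
    (t : TensorAlgebra k L) : f t = g t := by
  have h2 : ∀ l : List L, f (word l) = g (word l) := by
    intro l
    induction l with
    | nil => exact h1
    | cons x l ih => exact h x _ ih
  induction mem_span_word t using Submodule.span_induction with
  | mem t ht =>
    obtain ⟨l, rfl⟩ := ht
    exact h2 l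
  | zero => rw [map_zero, map_zero]
  | add a b _ _ ha hb => rw [map_add, map_add, ha, hb]
  | smul c a _ ha => rw [map_smul, map_smul, ha]

theorem counit_ι_mul (x : L) (t : TensorAlgebra k L) :
    TensorAlgebra.algebraMapInv (R := k) (TensorAlgebra.ι k x * t) = 0 := by
  simp [TensorAlgebra.algebraMapInv]

theorem counit_deconcatenation (t : TensorAlgebra k L) :
    TensorProduct.map (TensorAlgebra.algebraMapInv (R := k) (M := L)).toLinearMap LinearMap.id
      (deconcatenation k L t) = 1 ⊗ₜ[k] t := by
  induction mem_span_word t using Submodule.span_induction with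
  | mem t ht =>
    obtain ⟨l, rfl⟩ := ht
    exact counit_deconcatenation_word l
  | zero => simp
  | add a b _ _ ha hb => rw [map_add, map_add, ha, hb, TensorProduct.tmul_add]
  | smul c a _ ha => rw [map_smul, map_smul, ha, TensorProduct.tmul_smul]

theorem lengthTwo_one : lengthTwo k L 1 = 0 := lengthTwo_word_nil

theorem lengthTwo_ι_mul (x : L) (t : TensorAlgebra k L) :
    lengthTwo k L (TensorAlgebra.ι k x * t) = x ⊗ₜ[k] cogenerator k L t := by
  induction mem_span_word t using Submodule.span_induction with
  | mem t ht =>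
    obtain ⟨l, rfl⟩ := ht
    exact lengthTwo_word_cons x l
  | zero => simp
  | add a b _ _ ha hb => rw [mul_add, map_add, map_add, ha, hb, TensorProduct.tmul_add]
  | smul c a _ ha => rw [mul_smul_comm, map_smul, map_smul, ha, TensorProduct.tmul_smul]

/-- The map that sends `x ⊗ w` to `φ x ⊗ w` for `x` of length one. -/
def mapFirst (φ : L →ₗ[k] L) : TensorAlgebra k L →ₗ[k] TensorAlgebra k L :=
  (LinearMap.mul' k (TensorAlgebra k L)).comp ((TensorProduct.map
    ((TensorAlgebra.ι k).comp (φ.comp (cogenerator k L))) LinearMap.id).comp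
      (deconcatenation k L))

theorem mapFirst_one (φ : L →ₗ[k] L) : mapFirst φ 1 = 0 := by
  simp [mapFirst, deconcatenation_one, cogenerator_one]

theorem mapFirst_ι_mul (φ : L →ₗ[k] L) (x : L) (t : TensorAlgebra k L) :
    mapFirst φ (TensorAlgebra.ι k x * t) = TensorAlgebra.ι k (φ x) * t := by
  have h : ∀ z : TensorAlgebra k L ⊗[k] TensorAlgebra k L,
      LinearMap.mul' k (TensorAlgebra k L) (TensorProduct.map
        ((TensorAlgebra.ι k).comp (φ.comp (cogenerator k L))) LinearMap.id
          ((TensorAlgebra.ι k x ⊗ₜ[k] 1) * z)) =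
      TensorAlgebra.ι k (φ x) * (TensorProduct.lid k _
        (TensorProduct.map (TensorAlgebra.algebraMapInv (R := k) (M := L)).toLinearMap
          LinearMap.id z)) := by
    intro z
    induction z using TensorProduct.induction_on with
    | zero => simp
    | tmul a b => simp [cogenerator_ι_mul]
    | add a b ha hb => simp only [mul_add, map_add, ha, hb]
  rw [mapFirst, LinearMap.comp_apply, LinearMap.comp_apply, deconcatenation_ι_mul, map_add, map_add,
    h, counit_deconcatenation]
  simp [cogenerator_one]

/-- Splitting off the first letter and multiplying it back loses only the constant term. This
identity is the source of the recursion for coalgebra maps. -/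
theorem mapFirst_id (t : TensorAlgebra k L) : mapFirst LinearMap.id t =
    t - algebraMap k _ (TensorAlgebra.algebraMapInv (R := k) (M := L) t) := by
  refine tensor_linearMap_ext (f := mapFirst LinearMap.id)
    (g := LinearMap.id - (Algebra.linearMap k _).comp
      (TensorAlgebra.algebraMapInv (R := k) (M := L)).toLinearMap) ?_ (fun x t _ => ?_) t
  · simp [mapFirst_one]
  · rw [mapFirst_ι_mul]
    simp [counit_ι_mul]

variable {A : DGLieAlgebra k L}

theorem cogeneratingMap_one : cogeneratingMap A 1 = 0 := cogeneratingMap_word_nil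

theorem cogeneratingMap_ι_mul (x : L) (t : TensorAlgebra k L) :
    cogeneratingMap A (TensorAlgebra.ι k x * t) = (2 : k)⁻¹ • A.bracket (A.parity x)
      (cogenerator k L t) - TensorAlgebra.algebraMapInv t • A.d x := by
  simp [cogeneratingMap, lengthTwo_ι_mul, cogenerator_ι_mul]

theorem deconcatenation₃_one : deconcatenation₃ k L 1 = 1 ⊗ₜ[k] (1 ⊗ₜ[k] 1) := by
  simp [deconcatenation₃, deconcatenation_one]

theorem deconcatenation₃_ι_mul (x : L) (t : TensorAlgebra k L) :
    deconcatenation₃ k L (TensorAlgebra.ι k x * t) =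
      1 ⊗ₜ[k] deconcatenation k L (TensorAlgebra.ι k x * t) +
        (TensorAlgebra.ι k x ⊗ₜ[k] 1) * deconcatenation₃ k L t := by
  have h : ∀ z : TensorAlgebra k L ⊗[k] TensorAlgebra k L,
      TensorProduct.map LinearMap.id (deconcatenation k L) ((TensorAlgebra.ι k x ⊗ₜ[k] 1) * z) =
      (TensorAlgebra.ι k x ⊗ₜ[k] 1) *
        TensorProduct.map LinearMap.id (deconcatenation k L) z := by
    intro z
    induction z using TensorProduct.induction_on with
    | zero => simp
    | tmul a b => simp
    | add a b ha hb => simp only [mul_add, map_add, ha, hb]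
  rw [deconcatenation₃, LinearMap.comp_apply, deconcatenation_ι_mul x t, map_add, h,
    TensorProduct.map_tmul, deconcatenation_ι_mul]
  rfl

theorem coderivation_one : coderivation A 1 = 0 := by
  simp [coderivation, deconcatenation₃_one, cogeneratingMap_one]

/-- Decompositions `w₁ ⊗ w₂ ⊗ w₃` of `x ⊗ t` are sorted by whether `w₁` is empty. If not, `x` passes
to the left with its sign; if so, `w₂` begins with `x` and contributes only when its length is one
or two. -/
theorem coderivation_ι_mul (x : L) (t : TensorAlgebra k L) :
    coderivation A (TensorAlgebra.ι k x * t) =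
      TensorAlgebra.ι k (suspendedParity A x) * coderivation A t - TensorAlgebra.ι k (A.d x) * t +
        (2 : k)⁻¹ • mapFirst (A.bracket (A.parity x)) t := by
  set N : TensorAlgebra k L ⊗[k] TensorAlgebra k L →ₗ[k] TensorAlgebra k L :=
    (LinearMap.mul' k (TensorAlgebra k L)).comp
        (TensorProduct.map ((TensorAlgebra.ι k).comp (cogeneratingMap A)) LinearMap.id) with hN
  have h1 : ∀ z : TensorAlgebra k L ⊗[k] (TensorAlgebra k L ⊗[k] TensorAlgebra k L),
      LinearMap.mul' k (TensorAlgebra k L) (TensorProduct.map (tensorParity A) N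
        ((TensorAlgebra.ι k x ⊗ₜ[k] 1) * z)) = TensorAlgebra.ι k (suspendedParity A x) *
      LinearMap.mul' k (TensorAlgebra k L) (TensorProduct.map (tensorParity A) N z) := by
    intro z
    induction z using TensorProduct.induction_on with
    | zero => simp
    | tmul a b => simp [tensorParity, mul_assoc]
    | add a b ha hb => simp only [mul_add, map_add, ha, hb]
  have h2 : ∀ z : TensorAlgebra k L ⊗[k] TensorAlgebra k L,
      N ((TensorAlgebra.ι k x ⊗ₜ[k] 1) * z) = (2 : k)⁻¹ • LinearMap.mul' k (TensorAlgebra k L)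
        (TensorProduct.map ((TensorAlgebra.ι k).comp
          ((A.bracket (A.parity x)).comp (cogenerator k L))) LinearMap.id z) -
      TensorAlgebra.ι k (A.d x) * (TensorProduct.lid k _
        (TensorProduct.map (TensorAlgebra.algebraMapInv (R := k) (M := L)).toLinearMap
          LinearMap.id z)) := by
    intro z
    induction z using TensorProduct.induction_on with
    | zero => simp
    | tmul a b => simp [hN, cogeneratingMap_ι_mul, sub_mul]
    | add a b ha hb =>
      simp only [mul_add, map_add, ha, hb, smul_add]
      abel
  have h3 : N (deconcatenation k L (TensorAlgebra.ι k x * t)) =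
      (2 : k)⁻¹ • mapFirst (A.bracket (A.parity x)) t - TensorAlgebra.ι k (A.d x) * t := by
    rw [deconcatenation_ι_mul, map_add, h2, counit_deconcatenation]
    simp [hN, cogeneratingMap_one, mapFirst]
  have h4 : ∀ t, coderivation A t = LinearMap.mul' k (TensorAlgebra k L)
      (TensorProduct.map (tensorParity A) N (deconcatenation₃ k L t)) := fun t => rfl
  rw [h4, h4, deconcatenation₃_ι_mul, map_add, map_add, h1, TensorProduct.map_tmul, h3]
  simp [tensorParity]
  abel

theorem cogenerator_coderivation (t : TensorAlgebra k L) :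
    cogenerator k L (coderivation A t) = cogeneratingMap A t := by
  have hpar : ∀ t, TensorAlgebra.algebraMapInv (R := k) (M := L) (coderivation A t) = 0 := by
    intro t
    refine tensor_linearMap_ext (g := 0)
      (f := (TensorAlgebra.algebraMapInv (R := k) (M := L)).toLinearMap.comp (coderivation A))
      (by simp [coderivation_one]) (fun x t _ => ?_) t
    have h : ∀ t, TensorAlgebra.algebraMapInv (R := k) (M := L)
        (mapFirst (A.bracket (A.parity x)) t) = 0 := by
      intro t
      refine tensor_linearMap_ext (g := 0)
        (f := (TensorAlgebra.algebraMapInv (R := k) (M := L)).toLinearMap.comp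
          (mapFirst (A.bracket (A.parity x)))) (by simp [mapFirst_one]) (fun y t _ => ?_) t
      simp [mapFirst_ι_mul, counit_ι_mul]
    simp [coderivation_ι_mul, counit_ι_mul, h]
  refine tensor_linearMap_ext (f := (cogenerator k L).comp (coderivation A))
    (by simp [coderivation_one, cogeneratingMap_one]) (fun x t _ => ?_) t
  have h : ∀ t, cogenerator k L (mapFirst (A.bracket (A.parity x)) t) =
      A.bracket (A.parity x) (cogenerator k L t) := by
    intro t
    refine tensor_linearMap_ext (g := (A.bracket (A.parity x)).comp (cogenerator k L))
      (f := (cogenerator k L).comp (mapFirst (A.bracket (A.parity x))))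
      (by simp [mapFirst_one, cogenerator_one]) (fun y t _ => ?_) t
    simp [mapFirst_ι_mul, cogenerator_ι_mul]
  simp only [LinearMap.comp_apply]
  rw [coderivation_ι_mul, cogeneratingMap_ι_mul, map_add, map_sub, cogenerator_ι_mul,
    cogenerator_ι_mul, hpar, map_smul, h, zero_smul, zero_sub]
  abel

end TensorMaps

/-! ### Powers of a family of elements of `L` in the tensor coalgebra -/

section TensorPowers

variable {k : Type*} [Field k] {L : Type*} [AddCommGroup L] [Module k L]

variable (k) in
/-- The powers of the series `∑ x_γ e_γ` with values in the tensor algebra. -/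
def tensorPow (x : ℕ × ℕ → L) : ℕ → ℕ × ℕ → TensorAlgebra k L
  | 0, γ => if γ = 0 then 1 else 0
  | r + 1, γ => ∑ ab ∈ antidiagonal γ, TensorAlgebra.ι k (x ab.1) * tensorPow x r ab.2

variable (k) in
/-- The partial sums of the geometric series of `∑ x_γ e_γ`. -/
def tensorSum (x : ℕ × ℕ → L) (N : ℕ) (γ : ℕ × ℕ) : TensorAlgebra k L :=
  ∑ r ∈ range N, tensorPow k x r γ

variable (x : ℕ × ℕ → L)

theorem tensorPow_succ (r : ℕ) (γ : ℕ × ℕ) : tensorPow k x (r + 1) γ =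
    ∑ ab ∈ antidiagonal γ, TensorAlgebra.ι k (x ab.1) * tensorPow k x r ab.2 := rfl

theorem tensorSum_succ (N : ℕ) (γ : ℕ × ℕ) : tensorSum k x (N + 1) γ =
    (if γ = 0 then 1 else 0) +
      ∑ ab ∈ antidiagonal γ, TensorAlgebra.ι k (x ab.1) * tensorSum k x N ab.2 := by
  rw [tensorSum, sum_range_succ', add_comm]
  simp only [tensorPow_succ, tensorSum, mul_sum]
  rw [sum_comm]
  rfl

theorem antidiagonal_prod_zero : antidiagonal (0 : ℕ × ℕ) = {(0, 0)} := rfl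

theorem tensorPow_zero_right (r : ℕ) : tensorPow k x r 0 = TensorAlgebra.ι k (x 0) ^ r := by
  induction r with
  | zero => simp [tensorPow]
  | succ r ih => rw [tensorPow_succ, antidiagonal_prod_zero, sum_singleton, ih, pow_succ']

/-- Cutting a word of length `r` into lengths `a` and `c` distributes the index `γ` over the two
pieces, just as `Δ` does in `J`. This is why the geometric series defines a coalgebra map. -/
theorem deconcatenation_tensorPow (r : ℕ) (γ : ℕ × ℕ) :
    deconcatenation k L (tensorPow k x r γ) = ∑ ac ∈ antidiagonal r, ∑ ab ∈ antidiagonal γ,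
      tensorPow k x ac.1 ab.1 ⊗ₜ[k] tensorPow k x ac.2 ab.2 := by
  have hδ : ∀ (γ : ℕ × ℕ) (f : ℕ × ℕ → TensorAlgebra k L), ∑ ab ∈ antidiagonal γ,
      tensorPow k x 0 ab.1 ⊗ₜ[k] f ab.2 = 1 ⊗ₜ[k] f γ := by
    intro γ f
    rw [sum_eq_single (0, γ)]
    · rfl
    · rintro ⟨a, b⟩ hab hne
      have : a ≠ 0 := by
        rintro rfl
        exact hne (by simpa using HasAntidiagonal.mem_antidiagonal.1 hab)
      simp [tensorPow, this]
    · intro h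
      exact absurd (HasAntidiagonal.mem_antidiagonal.2 (zero_add γ)) h
  induction r generalizing γ with
  | zero =>
    rw [Nat.antidiagonal_zero, sum_singleton, hδ]
    simp only [tensorPow]
    split_ifs
    · exact deconcatenation_one
    · simp
  | succ r ih =>
    rw [Nat.sum_antidiagonal_succ, hδ]
    simp only [tensorPow_succ, map_sum, deconcatenation_ι_mul, sum_add_distrib,
      TensorProduct.tmul_sum]
    congr 1
    simp only [ih, mul_sum, Algebra.TensorProduct.tmul_mul_tmul, one_mul, TensorProduct.sum_tmul]
    rw [sum_comm]
    refine sum_congr rfl fun ac _ => ?_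
    exact sum_antidiagonal_assoc (fun a b c => (TensorAlgebra.ι k (x a) * tensorPow k x ac.1 b) ⊗ₜ[k]
      tensorPow k x ac.2 c) γ

theorem counit_tensorSum {N : ℕ} (hN : N ≠ 0) (γ : ℕ × ℕ) :
    TensorAlgebra.algebraMapInv (R := k) (tensorSum k x N γ) = if γ = 0 then 1 else 0 := by
  obtain ⟨N, rfl⟩ := Nat.exists_eq_succ_of_ne_zero hN
  rw [Nat.succ_eq_add_one, tensorSum_succ, map_add, map_sum,
    sum_eq_zero fun _ _ => counit_ι_mul _ _]
  split_ifs <;> simp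

theorem sum_antidiagonal_ite {M : Type*} [AddCommMonoid M] (γ : ℕ × ℕ) (f : ℕ × ℕ → M) :
    ∑ ab ∈ antidiagonal γ, (if ab.2 = 0 then f ab.1 else 0) = f γ := by
  rw [sum_eq_single (γ, 0)]
  · simp
  · rintro ⟨a, b⟩ hab hne
    have : b ≠ 0 := by
      rintro rfl
      exact hne (by simpa using HasAntidiagonal.mem_antidiagonal.1 hab)
    simp [this]
  · intro h
    exact absurd (HasAntidiagonal.mem_antidiagonal.2 (add_zero γ)) h

theorem cogenerator_tensorSum {N : ℕ} (hN : 2 ≤ N) (γ : ℕ × ℕ) :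
    cogenerator k L (tensorSum k x N γ) = x γ := by
  obtain ⟨N, rfl⟩ := Nat.exists_eq_add_of_le' hN
  rw [tensorSum_succ, map_add, map_sum]
  simp only [cogenerator_ι_mul, counit_tensorSum x (Nat.succ_ne_zero N), ite_smul, one_smul,
    zero_smul, sum_antidiagonal_ite]
  split_ifs <;> simp [cogenerator_one]

theorem cogenerator_tensorPow (r : ℕ) (γ : ℕ × ℕ) :
    cogenerator k L (tensorPow k x r γ) = if r = 1 then x γ else 0 := by
  rcases r with _ | _ | r
  · simp only [tensorPow]
    split_ifs <;> simp_all [cogenerator_one]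
  · rw [tensorPow_succ, map_sum]
    simp only [cogenerator_ι_mul, tensorPow]
    simp only [apply_ite (TensorAlgebra.algebraMapInv (R := k) (M := L)), map_one, map_zero,
      ite_smul, one_smul, zero_smul, sum_antidiagonal_ite, if_true]
  · rw [tensorPow_succ, map_sum]
    simp [cogenerator_ι_mul, tensorPow_succ, counit_ι_mul]

variable (A : DGLieAlgebra k L)

/-- The curvature `∑ 1/2 [(-1)^|x_a| x_a, x_b] - d x_γ` of a family. -/
def curvature (γ : ℕ × ℕ) : L :=
  (2 : k)⁻¹ • ∑ ab ∈ antidiagonal γ, A.bracket (A.parity (x ab.1)) (x ab.2) - A.d (x γ)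

variable {A}

/-- The cogenerating map sees only lengths one and two, which are complete in the partial sum once
`N ≥ 3`. -/
theorem cogeneratingMap_tensorSum {N : ℕ} (hN : 3 ≤ N) (γ : ℕ × ℕ) :
    cogeneratingMap A (tensorSum k x N γ) = curvature x A γ := by
  obtain ⟨N, rfl⟩ := Nat.exists_eq_add_of_le' hN
  rw [tensorSum_succ, map_add, map_sum]
  simp only [cogeneratingMap_ι_mul, counit_tensorSum x (Nat.succ_ne_zero _),
    cogenerator_tensorSum x (by omega : 2 ≤ N + 2), ite_smul, one_smul, zero_smul,
    sum_sub_distrib]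
  rw [sum_antidiagonal_ite γ fun a => A.d (x a), curvature, smul_sum]
  split_ifs <;> simp [cogeneratingMap_one]

theorem mapFirst_tensorSum_succ (φ : L →ₗ[k] L) (N : ℕ) (γ : ℕ × ℕ) :
    mapFirst φ (tensorSum k x (N + 1) γ) =
      ∑ ab ∈ antidiagonal γ, TensorAlgebra.ι k (φ (x ab.1)) * tensorSum k x N ab.2 := by
  rw [tensorSum_succ, map_add, map_sum]
  simp only [mapFirst_ι_mul]
  split_ifs <;> simp [mapFirst_one]

/-- Summing the recursion for the coderivation, the terms with `d` and with the bracket combine into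
the curvature. They reach truncations `N + 1` and `N`, respectively; the final sum is this mismatch
and consists of tensors of length at least `N + 1`. -/
theorem coderivation_tensorSum (N : ℕ) (γ : ℕ × ℕ) :
    coderivation A (tensorSum k x (N + 2) γ) =
      ∑ ab ∈ antidiagonal γ, TensorAlgebra.ι k (suspendedParity A (x ab.1)) *
        coderivation A (tensorSum k x (N + 1) ab.2) +
      ∑ ab ∈ antidiagonal γ, TensorAlgebra.ι k (curvature x A ab.1) * tensorSum k x N ab.2 -
      ∑ ab ∈ antidiagonal γ, TensorAlgebra.ι k (A.d (x ab.1)) * tensorPow k x N ab.2 := by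
  have h := sum_antidiagonal_assoc (fun a b c => TensorAlgebra.ι k (A.bracket (A.parity (x a))
    (x b)) * tensorSum k x N c) γ
  rw [tensorSum_succ, map_add, map_sum]
  simp only [coderivation_ι_mul, mapFirst_tensorSum_succ, sum_add_distrib, sum_sub_distrib,
    curvature, map_sub, map_smul, map_sum, sub_mul, smul_mul_assoc, sum_mul, ← smul_sum, ← h]
  have h1 : ∀ γ, tensorSum k x (N + 1) γ = tensorSum k x N γ + tensorPow k x N γ := fun γ =>
    sum_range_succ _ _
  have h2 : coderivation A (if γ = 0 then 1 else 0) = 0 := by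
    split_ifs <;> simp [coderivation_one]
  simp only [h2, zero_add]
  have h3 : ∑ ab ∈ antidiagonal γ, TensorAlgebra.ι k (A.d (x ab.1)) * tensorSum k x (N + 1) ab.2 =
      ∑ ab ∈ antidiagonal γ, TensorAlgebra.ι k (A.d (x ab.1)) * tensorSum k x N ab.2 +
      ∑ ab ∈ antidiagonal γ, TensorAlgebra.ι k (A.d (x ab.1)) * tensorPow k x N ab.2 := by
    simp only [h1, mul_add, sum_add_distrib]
  rw [h3]
  abel

/-! ### Length, weight and degree -/

variable (k L) in
/-- The tensors of length at least `r`. -/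
def lengthFiltration (r : ℕ) : Submodule k (TensorAlgebra k L) :=
  Submodule.span k {t | ∃ l : List L, r ≤ l.length ∧ t = word l}

/-- The tensors of weight at least `n` for the filtration of `L`. -/
def weightFiltration (F : CompleteFiltration A) (n : ℕ) : Submodule k (TensorAlgebra k L) :=
  Submodule.span k {t | ∃ l : List (L × ℕ), (∀ a ∈ l, a.1 ∈ F.F a.2) ∧
    n ≤ (l.map Prod.snd).sum ∧ t = word (l.map Prod.fst)}

theorem mul_mem_of_span {s : Set (TensorAlgebra k L)} {S : Submodule k (TensorAlgebra k L)}
    (a : TensorAlgebra k L) (h : ∀ t ∈ s, a * t ∈ S) {t : TensorAlgebra k L}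
    (ht : t ∈ Submodule.span k s) : a * t ∈ S :=
  (Submodule.span_le.2 h : Submodule.span k s ≤ S.comap (LinearMap.mulLeft k a)) ht

theorem ι_mul_mem_lengthFiltration (y : L) {r : ℕ} {t : TensorAlgebra k L}
    (ht : t ∈ lengthFiltration k L r) : TensorAlgebra.ι k y * t ∈ lengthFiltration k L (r + 1) := by
  refine mul_mem_of_span _ ?_ ht
  rintro _ ⟨l, hl, rfl⟩
  exact Submodule.subset_span ⟨y :: l, by simpa using hl, rfl⟩

theorem mem_lengthFiltration_zero (t : TensorAlgebra k L) : t ∈ lengthFiltration k L 0 := by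
  refine Submodule.span_mono ?_ (mem_span_word t)
  rintro _ ⟨l, rfl⟩
  exact ⟨l, Nat.zero_le _, rfl⟩

theorem tensorPow_mem_lengthFiltration (r : ℕ) (γ : ℕ × ℕ) :
    tensorPow k x r γ ∈ lengthFiltration k L r := by
  induction r generalizing γ with
  | zero => exact mem_lengthFiltration_zero _
  | succ r ih =>
    exact Submodule.sum_mem _ fun ab _ => ι_mul_mem_lengthFiltration _ (ih _)

variable (F : CompleteFiltration A)

theorem lengthFiltration_le (m : ℕ) :
    lengthFiltration k L m ≤ (tensorCoalgebraFiltration F).F m := by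
  refine Submodule.span_mono ?_
  rintro _ ⟨l, hl, rfl⟩
  refine ⟨l.map fun y => (y, 0), ?_, Or.inr (by simpa using hl), by simp [Function.comp_def]⟩
  intro a ha
  obtain ⟨y, -, rfl⟩ := List.mem_map.1 ha
  rw [F.F_zero]
  exact Submodule.mem_top

theorem weightFiltration_le (m : ℕ) :
    weightFiltration F m ≤ (tensorCoalgebraFiltration F).F m := by
  refine Submodule.span_mono ?_
  rintro _ ⟨l, hl, hm, rfl⟩
  exact ⟨l, hl, Or.inl hm, rfl⟩

variable {F}

theorem ι_mul_mem_weightFiltration {y : L} {p n : ℕ} (hy : y ∈ F.F p) {t : TensorAlgebra k L}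
    (ht : t ∈ weightFiltration F n) :
    TensorAlgebra.ι k y * t ∈ weightFiltration F (p + n) := by
  refine mul_mem_of_span _ ?_ ht
  rintro _ ⟨l, hl, hn, rfl⟩
  refine Submodule.subset_span ⟨(y, p) :: l, ?_, by simpa using hn, rfl⟩
  intro a ha
  rcases List.mem_cons.1 ha with rfl | ha
  exacts [hy, hl a ha]

theorem mem_weightFiltration_zero (t : TensorAlgebra k L) : t ∈ weightFiltration F 0 := by
  refine Submodule.span_mono ?_ (mem_span_word t)
  rintro _ ⟨l, rfl⟩
  refine ⟨l.map fun y => (y, 0), ?_, Nat.zero_le _, by simp [Function.comp_def]⟩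
  intro a ha
  obtain ⟨y, -, rfl⟩ := List.mem_map.1 ha
  rw [F.F_zero]
  exact Submodule.mem_top

variable {x}

theorem tensorPow_mem_weightFiltration (hx : ∀ γ, x γ ∈ F.F γ.1) (r : ℕ) (γ : ℕ × ℕ) :
    tensorPow k x r γ ∈ weightFiltration F γ.1 := by
  induction r generalizing γ with
  | zero =>
    simp only [tensorPow]
    split_ifs with h
    · rw [h]
      exact mem_weightFiltration_zero _
    · exact zero_mem _
  | succ r ih =>
    refine Submodule.sum_mem _ fun ab hab => ?_
    have h := ι_mul_mem_weightFiltration (hx ab.1) (ih ab.2)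
    rwa [← Prod.fst_add, HasAntidiagonal.mem_antidiagonal.1 hab] at h

theorem tensorSum_mem (hx : ∀ γ, x γ ∈ F.F γ.1) (N : ℕ) (γ : ℕ × ℕ) :
    tensorSum k x N γ ∈ (tensorCoalgebraFiltration F).F γ.1 :=
  Submodule.sum_mem _ fun r _ => weightFiltration_le F _ (tensorPow_mem_weightFiltration hx r γ)

theorem ι_mul_mem_tensorDeg {y : L} {i m : ℤ} (hy : y ∈ A.deg i) {t : TensorAlgebra k L}
    (ht : t ∈ tensorDeg A m) : TensorAlgebra.ι k y * t ∈ tensorDeg A (i - 1 + m) := by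
  refine mul_mem_of_span _ ?_ ht
  rintro _ ⟨l, hl, hm, rfl⟩
  refine Submodule.subset_span ⟨(y, i) :: l, ?_, by simp [hm], rfl⟩
  intro a ha
  rcases List.mem_cons.1 ha with rfl | ha
  exacts [hy, hl a ha]

theorem tensorPow_mem_tensorDeg (hx : ∀ γ, x γ ∈ A.deg (1 - γ.2)) (r : ℕ) (γ : ℕ × ℕ) :
    tensorPow k x r γ ∈ tensorDeg A (-γ.2) := by
  induction r generalizing γ with
  | zero =>
    simp only [tensorPow]
    split_ifs with h
    · rw [h]
      exact Submodule.subset_span ⟨[], by simp, by simp, rfl⟩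
    · exact zero_mem _
  | succ r ih =>
    refine Submodule.sum_mem _ fun ab hab => ?_
    have h := ι_mul_mem_tensorDeg (hx ab.1) (ih ab.2)
    have h2 := congrArg Prod.snd (HasAntidiagonal.mem_antidiagonal.1 hab)
    rw [Prod.snd_add] at h2
    convert h using 2
    rw [← h2]
    push_cast
    ring

theorem cogenerator_mem_of_tensorDeg {m : ℤ} {t : TensorAlgebra k L} (ht : t ∈ tensorDeg A m) :
    cogenerator k L t ∈ A.deg (m + 1) := by
  refine (Submodule.span_le.2 ?_ : tensorDeg A m ≤ (A.deg (m + 1)).comap (cogenerator k L)) ht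
  rintro _ ⟨l, hl, hm, rfl⟩
  change cogenerator k L _ ∈ A.deg _
  match l, hl, hm with
  | [], _, _ =>
    rw [List.map_nil, word_nil, cogenerator_one]
    exact zero_mem _
  | [a], hl, hm =>
    rw [List.map_cons, List.map_nil, cogenerator_word_singleton]
    have h := hl a (by simp)
    have h2 : a.2 = m + 1 := by simp at hm; omega
    rwa [h2] at h
  | a :: b :: l, _, _ =>
    rw [List.map_cons, List.map_cons, cogenerator_word_cons_cons]
    exact zero_mem _

/-- For `m ≥ 2` a tensor of length one can be in `G_m` only through the weight of its letter. For `m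
= 1` every letter is in `G_1` by its length, so the claim would fail; this accounts for the bounds
`2 ≤ m` that follow. -/
theorem cogenerator_mem_of_tensorCoalgebraFiltration {m : ℕ} (hm : 2 ≤ m) {t : TensorAlgebra k L}
    (ht : t ∈ (tensorCoalgebraFiltration F).F m) : cogenerator k L t ∈ F.F m := by
  refine (Submodule.span_le.2 ?_ :
    (tensorCoalgebraFiltration F).F m ≤ (F.F m).comap (cogenerator k L)) ht
  rintro _ ⟨l, hl, h, rfl⟩
  change cogenerator k L _ ∈ F.F m
  match l, hl, h with
  | [], _, _ =>
    rw [List.map_nil, word_nil, cogenerator_one]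
    exact zero_mem _
  | [a], hl, h =>
    rw [List.map_cons, List.map_nil, cogenerator_word_singleton]
    simp only [List.map_cons, List.map_nil, List.sum_cons, List.sum_nil, List.length_cons,
      List.length_nil] at h
    exact F.anti (by omega) (hl a (by simp))
  | a :: b :: l, _, _ =>
    rw [List.map_cons, List.map_cons, cogenerator_word_cons_cons]
    exact zero_mem _

/-! ### Symmetry and coproducts -/

theorem lengthTwo_tensorPow (r : ℕ) (γ : ℕ × ℕ) : lengthTwo k L (tensorPow k x r γ) =
    if r = 2 then ∑ ab ∈ antidiagonal γ, x ab.1 ⊗ₜ[k] x ab.2 else 0 := by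
  rcases r with _ | r
  · simp only [tensorPow]
    split_ifs <;> simp_all [lengthTwo_one]
  · rw [tensorPow_succ, map_sum]
    simp only [lengthTwo_ι_mul, cogenerator_tensorPow, Nat.reduceEqDiff]
    split_ifs <;> simp

/-- With at most one factor `u` in total, one of the two letters has degree zero in `sL`. The signed
exchange is then the plain one, under which the sum over the antidiagonal is invariant. -/
theorem signedSwap_lengthTwo_tensorPow [CharZero k] (hx : ∀ γ, x γ ∈ A.deg (1 - γ.2)) (r : ℕ)
    {γ : ℕ × ℕ} (hγ : γ.2 ≤ 1) : signedSwap A (lengthTwo k L (tensorPow k x r γ)) =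
      lengthTwo k L (tensorPow k x r γ) := by
  rw [lengthTwo_tensorPow]
  split_ifs
  · rw [map_sum, sum_antidiagonal_comm γ fun a b => x a ⊗ₜ[k] x b]
    refine sum_congr rfl fun ab hab => ?_
    have h2 := congrArg Prod.snd (HasAntidiagonal.mem_antidiagonal.1 hab)
    rw [Prod.snd_add] at h2
    have h3 : ab.1.2 = 0 ∨ ab.2.2 = 0 := by omega
    rw [signedSwap_of_mem _ _ _ _ (hx _) (hx _)]
    have h4 : (1 - (ab.1.2 : ℤ) - 1) * (1 - (ab.2.2 : ℤ) - 1) = 0 := by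
      rcases h3 with h | h <;> simp [h]
    rw [h4]
    simp
  · exact map_zero _

theorem tensorPow_mem_symmetricTensors [CharZero k] (hx : ∀ γ, x γ ∈ A.deg (1 - γ.2)) (r : ℕ)
    {γ : ℕ × ℕ} (hγ : γ.2 ≤ 1) : tensorPow k x r γ ∈ symmetricTensors A := by
  rw [symmetricTensors, LinearMap.mem_ker, LinearMap.sub_apply, sub_eq_zero, LinearMap.comp_apply,
    adjacentPairs, deconcatenation₃, LinearMap.comp_apply, LinearMap.comp_apply,
    deconcatenation_tensorPow]
  simp only [map_sum, TensorProduct.map_tmul, deconcatenation_tensorPow, TensorProduct.tmul_sum,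
    LinearMap.id_apply]
  refine sum_congr rfl fun ac _ => sum_congr rfl fun ab hab => sum_congr rfl fun _ _ =>
    sum_congr rfl fun cd hcd => ?_
  have h1 := congrArg Prod.snd (HasAntidiagonal.mem_antidiagonal.1 hab)
  have h2 := congrArg Prod.snd (HasAntidiagonal.mem_antidiagonal.1 hcd)
  rw [Prod.snd_add] at h1 h2
  rw [signedSwap_lengthTwo_tensorPow hx _ (by omega)]

variable (F x)

theorem deconcatenation_tensorSum_sub_mem (N : ℕ) (γ : ℕ × ℕ) :
    ∑ ab ∈ antidiagonal γ, tensorSum k x N ab.1 ⊗ₜ[k] tensorSum k x N ab.2 -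
      deconcatenation k L (tensorSum k x N γ) ∈
        (tensorFiltration (tensorCoalgebraFiltration F) (tensorCoalgebraFiltration F)).F N := by
  have h := sum_range_sum_range_sub_mem ((tensorFiltration (tensorCoalgebraFiltration F)
    (tensorCoalgebraFiltration F)).F N) (fun a c => ∑ ab ∈ antidiagonal γ,
      tensorPow k x a ab.1 ⊗ₜ[k] tensorPow k x c ab.2) N (fun a _ c _ hac =>
        Submodule.sum_mem _ fun ab _ => Submodule.subset_span ⟨a, c, hac, _,
          lengthFiltration_le F _ (tensorPow_mem_lengthFiltration x _ _), _,
          lengthFiltration_le F _ (tensorPow_mem_lengthFiltration x _ _), rfl⟩)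
  convert h using 2
  · simp only [tensorSum, TensorProduct.sum_tmul, TensorProduct.tmul_sum]
    refine (sum_congr rfl fun _ _ => sum_comm).trans (sum_comm.trans ?_)
    exact sum_congr rfl fun _ _ => sum_comm
  · rw [tensorSum, map_sum]
    exact sum_congr rfl fun r _ => deconcatenation_tensorPow x r γ

end TensorPowers

/-! ### Multiplication by elements of length one in the quotients of the tensor coalgebra -/

section Levels

variable {k : Type*} [Field k] {L : Type*} [AddCommGroup L] [Module k L]
variable {A : DGLieAlgebra k L} (F : CompleteFiltration A)

theorem ι_mul_mem_tensorCoalgebraFiltration (y : L) {m : ℕ} {t : TensorAlgebra k L}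
    (ht : t ∈ (tensorCoalgebraFiltration F).F m) :
    TensorAlgebra.ι k y * t ∈ (tensorCoalgebraFiltration F).F m := by
  refine mul_mem_of_span _ ?_ ht
  rintro _ ⟨l, hl, hm, rfl⟩
  refine Submodule.subset_span ⟨(y, 0) :: l, ?_, ?_, rfl⟩
  · intro a ha
    rcases List.mem_cons.1 ha with rfl | ha
    · rw [F.F_zero]
      exact Submodule.mem_top
    · exact hl a ha
  · simp only [List.map_cons, List.sum_cons, List.length_cons]
    omega

/-- The multiplication by `sy`, `y ∈ L`, in `T^c(sL) / G_m`. -/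
def levelMul (m : ℕ) : L →ₗ[k] Module.End k
    (TensorAlgebra k L ⧸ (tensorCoalgebraFiltration F).F m) where
  toFun y := Submodule.mapQ _ _ (LinearMap.mulLeft k (TensorAlgebra.ι k y))
    fun _ ht => ι_mul_mem_tensorCoalgebraFiltration F y ht
  map_add' y z := by
    refine Submodule.linearMap_qext _ (LinearMap.ext fun t => ?_)
    change Submodule.mkQ ((tensorCoalgebraFiltration F).F m) (TensorAlgebra.ι k (y + z) * t) =
      Submodule.mkQ ((tensorCoalgebraFiltration F).F m) (TensorAlgebra.ι k y * t) + Submodule.mkQ ((tensorCoalgebraFiltration F).F m) (TensorAlgebra.ι k z * t)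
    rw [map_add, add_mul, map_add]
  map_smul' c y := by
    refine Submodule.linearMap_qext _ (LinearMap.ext fun t => ?_)
    change Submodule.mkQ ((tensorCoalgebraFiltration F).F m) (TensorAlgebra.ι k (c • y) * t) =
      c • Submodule.mkQ ((tensorCoalgebraFiltration F).F m) (TensorAlgebra.ι k y * t)
    rw [map_smul, smul_mul_assoc, map_smul]

theorem levelMul_mk (m : ℕ) (y : L) (t : TensorAlgebra k L) :
    levelMul F m y (Submodule.mkQ _ t) = Submodule.mkQ _ (TensorAlgebra.ι k y * t) := rfl

theorem levelMul_eq_zero {m : ℕ} {y : L} (hy : y ∈ F.F m) : levelMul F m y = 0 := by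
  refine LinearMap.ext fun q => ?_
  obtain ⟨t, rfl⟩ := Submodule.mkQ_surjective _ q
  rw [levelMul_mk, LinearMap.zero_apply, Submodule.mkQ_apply, Submodule.Quotient.mk_eq_zero]
  exact weightFiltration_le F m
    (by simpa using ι_mul_mem_weightFiltration hy (mem_weightFiltration_zero (F := F) t))

variable {F}

theorem levelMul_congr {m : ℕ} {y z : L} (h : y - z ∈ F.F m) : levelMul F m y = levelMul F m z := by
  rw [← sub_eq_zero, ← map_sub, levelMul_eq_zero F h]

theorem mkQ_eq_mkQ {M : Type*} [AddCommGroup M] [Module k M] {S : Submodule k M} {a b : M} :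
    Submodule.mkQ S a = Submodule.mkQ S b ↔ a - b ∈ S := by
  rw [Submodule.mkQ_apply, Submodule.mkQ_apply, Submodule.Quotient.eq]

theorem mkQ_tensorSum (x : ℕ × ℕ → L) {m N : ℕ} (h : m ≤ N) (γ : ℕ × ℕ) :
    Submodule.mkQ ((tensorCoalgebraFiltration F).F m) (tensorSum k x N γ) =
      Submodule.mkQ _ (tensorSum k x m γ) := by
  rw [mkQ_eq_mkQ, tensorSum, tensorSum, ← sum_range_add_sum_Ico _ h, add_sub_cancel_left]
  exact Submodule.sum_mem _ fun r hr => (tensorCoalgebraFiltration F).anti (mem_Ico.1 hr).1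
    (lengthFiltration_le F r (tensorPow_mem_lengthFiltration x r γ))

/-- Each use of the recursion prefixes a letter, so a solution is represented by tensors of length
at least `r` for every `r`; for `r = m` these vanish in the quotient. The set `D` restricts the
recursion to indices with at most one factor `u`. -/
theorem eq_zero_of_recursion (x : ℕ × ℕ → L) {m : ℕ} {D : Set (ℕ × ℕ)}
    (hD : ∀ γ ∈ D, ∀ ab ∈ antidiagonal γ, ab.2 ∈ D)
    {E : ℕ × ℕ → TensorAlgebra k L ⧸ (tensorCoalgebraFiltration F).F m}
    (hE : ∀ γ ∈ D, E γ = ∑ ab ∈ antidiagonal γ, levelMul F m (x ab.1) (E ab.2)) :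
    ∀ γ ∈ D, E γ = 0 := by
  have h : ∀ r, ∀ γ ∈ D, ∃ t ∈ lengthFiltration k L r, Submodule.mkQ _ t = E γ := by
    intro r
    induction r with
    | zero =>
      intro γ _
      obtain ⟨t, ht⟩ := Submodule.mkQ_surjective _ (E γ)
      exact ⟨t, mem_lengthFiltration_zero t, ht⟩
    | succ r ih =>
      intro γ hγ
      -- The representatives are extended by `0` outside `D`, so that they can be chosen as a
      -- function on all indices.
      have h1 : ∀ b, ∃ t, b ∈ D → t ∈ lengthFiltration k L r ∧ Submodule.mkQ _ t = E b := by
        intro b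
        by_cases hb : b ∈ D
        · obtain ⟨t, ht⟩ := ih b hb
          exact ⟨t, fun _ => ht⟩
        · exact ⟨0, fun h => absurd h hb⟩
      choose t ht using h1
      refine ⟨∑ ab ∈ antidiagonal γ, TensorAlgebra.ι k (x ab.1) * t ab.2,
        Submodule.sum_mem _ fun ab hab => ι_mul_mem_lengthFiltration _ (ht _ (hD γ hγ ab hab)).1, ?_⟩
      rw [hE γ hγ, map_sum]
      refine sum_congr rfl fun ab hab => ?_
      rw [← levelMul_mk, (ht _ (hD γ hγ ab hab)).2]
  intro γ hγ
  obtain ⟨t, ht, ht'⟩ := h m γ hγ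
  rw [← ht', Submodule.mkQ_apply, Submodule.Quotient.mk_eq_zero]
  exact lengthFiltration_le F m ht

theorem mkQ_tensorSum_recursion (x : ℕ × ℕ → L) (m : ℕ) (γ : ℕ × ℕ) :
    Submodule.mkQ ((tensorCoalgebraFiltration F).F m) (tensorSum k x m γ) =
      Submodule.mkQ _ (if γ = 0 then 1 else 0) + ∑ ab ∈ antidiagonal γ,
        levelMul F m (x ab.1) (Submodule.mkQ _ (tensorSum k x m ab.2)) := by
  rw [← mkQ_tensorSum x m.le_succ, tensorSum_succ, map_add, map_sum]
  rfl

theorem eq_tensorSum_of_recursion (x : ℕ × ℕ → L) {m : ℕ} {D : Set (ℕ × ℕ)}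
    (hD : ∀ γ ∈ D, ∀ ab ∈ antidiagonal γ, ab.2 ∈ D)
    {H : ℕ × ℕ → TensorAlgebra k L ⧸ (tensorCoalgebraFiltration F).F m}
    (hH : ∀ γ ∈ D, H γ = Submodule.mkQ _ (if γ = 0 then 1 else 0) +
      ∑ ab ∈ antidiagonal γ, levelMul F m (x ab.1) (H ab.2)) :
    ∀ γ ∈ D, H γ = Submodule.mkQ _ (tensorSum k x m γ) := by
  intro γ hγ
  rw [← sub_eq_zero]
  refine eq_zero_of_recursion x hD
    (E := fun γ => H γ - Submodule.mkQ _ (tensorSum k x m γ)) (fun γ hγ => ?_) γ hγ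
  rw [hH γ hγ, mkQ_tensorSum_recursion, add_sub_add_left_eq_sub, ← sum_sub_distrib]
  simp only [map_sub]

/-- The family with the single element `p` at zero. -/
def pointFamily (p : L) (γ : ℕ × ℕ) : L := if γ = 0 then p else 0

theorem eq_sum_pow_of_recursion {p : L} {m : ℕ}
    {g : TensorAlgebra k L ⧸ (tensorCoalgebraFiltration F).F m}
    (hg : g = Submodule.mkQ _ 1 + levelMul F m p g) :
    g = Submodule.mkQ _ (∑ n ∈ range m, TensorAlgebra.ι k p ^ n) := by
  have h := eq_tensorSum_of_recursion (F := F) (m := m) (pointFamily p) (D := {0})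
    (by rintro γ rfl ab hab; rw [antidiagonal_prod_zero, mem_singleton] at hab; rw [hab]; rfl)
    (H := fun _ => g) (by
      rintro γ rfl
      rw [antidiagonal_prod_zero, sum_singleton]
      simpa [pointFamily] using hg) 0 rfl
  rw [h]
  simp only [tensorSum, tensorPow_zero_right]
  simp [pointFamily]

/-! ### The component of length one of an element of the completion -/

/-- The component of length one of `g` is `y`. -/
def HasCogenerator (F : CompleteFiltration A) (g : CompletedTensorSpace F) (y : L) : Prop :=
  ∀ m ≥ 2, ∀ t, g.1 m = Submodule.mkQ _ t → cogenerator k L t - y ∈ F.F m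

theorem completion_eq_mkQ {M : Type*} [AddCommGroup M] [Module k M] {B : Filtration k M}
    (g : completion B) {m n : ℕ} (h : m ≤ n) {t : M} (ht : g.1 n = Submodule.mkQ _ t) :
    g.1 m = Submodule.mkQ _ t := by
  rw [← g.2 m n h, ht]
  rfl

/-- The length one parts of representatives at successive levels form a Cauchy sequence in one
degree of `L`, and completeness supplies the limit. Levels start at `2`, where `G_m` controls that
part. -/
theorem exists_hasCogenerator {i : ℤ} {g : CompletedTensorSpace F}
    (hg : g ∈ (completedTensorCoalgebra F).deg i) : ∃ y ∈ A.deg (i + 1), HasCogenerator F g y := by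
  choose t ht ht' using hg
  have h : ∀ m n, 2 ≤ m → m ≤ n → cogenerator k L (t n) - cogenerator k L (t m) ∈ F.F m := by
    intro m n hm hmn
    rw [← map_sub]
    refine cogenerator_mem_of_tensorCoalgebraFiltration hm (mkQ_eq_mkQ.1 ?_)
    rw [← completion_eq_mkQ g hmn (ht' n), ht' m]
  obtain ⟨y, hy, hy'⟩ := F.complete (i + 1) (fun p => cogenerator k L (t (p + 2)))
    (fun p => cogenerator_mem_of_tensorDeg (ht _))
    (fun p => F.anti (by omega) (h (p + 2) (p + 1 + 2) (by omega) (by omega)))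
  refine ⟨y, hy, fun m hm s hs => ?_⟩
  have h1 := hy' m
  have h2 := h m (m + 2) hm (by omega)
  have h3 : cogenerator k L s - cogenerator k L (t m) ∈ F.F m := by
    rw [← map_sub]
    exact cogenerator_mem_of_tensorCoalgebraFiltration hm (mkQ_eq_mkQ.1 (by rw [← hs, ht' m]))
  convert sub_mem (sub_mem h3 h2) h1 using 1
  abel

theorem eq_of_sub_mem {i : ℤ} {y z : L} (hy : y ∈ A.deg i) (hz : z ∈ A.deg i)
    (h : ∀ m ≥ 2, y - z ∈ F.F m) : y = z :=
  sub_eq_zero.1 (F.separated i _ (sub_mem hy hz) fun p =>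
    F.anti (by omega : p ≤ p + 2) (h (p + 2) (by omega)))

theorem HasCogenerator.mem {g : CompletedTensorSpace F} {y : L} (h : HasCogenerator F g y) {p : ℕ}
    (hg : CogeneratorMem F p g) : y ∈ F.F p := by
  obtain ⟨t, ht, ht'⟩ := hg (p + 2)
  have h1 := sub_mem ht (F.anti (by omega : p ≤ p + 2) (h (p + 2) (by omega) t ht'))
  rwa [sub_sub_cancel] at h1

theorem HasCogenerator.levelMul_eq {g : CompletedTensorSpace F} {y : L} (h : HasCogenerator F g y)
    {m : ℕ} (hm : 2 ≤ m) {t : TensorAlgebra k L} (ht : g.1 m = Submodule.mkQ _ t) :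
    levelMul F m (cogenerator k L t) = levelMul F m y :=
  levelMul_congr (h m hm t ht)

/-! ### The coproduct and the recursion for elements of the completion -/

variable (F)

/-- The projection of the completion to `T^c(sL) / G_m`. -/
def levelProj (m : ℕ) : CompletedTensorSpace F →ₗ[k]
    TensorAlgebra k L ⧸ (tensorCoalgebraFiltration F).F m :=
  (LinearMap.proj m).comp (Submodule.subtype _)

/-- The multiplication by the component of length one, on `T^c(sL) / G_m`. -/
def levelMulFirst {m : ℕ} (hm : 2 ≤ m) :
    (TensorAlgebra k L ⧸ (tensorCoalgebraFiltration F).F m) →ₗ[k]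
      Module.End k (TensorAlgebra k L ⧸ (tensorCoalgebraFiltration F).F m) :=
  Submodule.liftQ _ ((levelMul F m).comp (cogenerator k L)) fun _ ht =>
    levelMul_eq_zero F (cogenerator_mem_of_tensorCoalgebraFiltration hm ht)

/-- The map `g ⊗ h ↦ π(g) ⊗ h`, with values in `T^c(sL) / G_m`. -/
def levelFirst {m : ℕ} (hm : 2 ≤ m) : CompletedTensorSpace F ⊗[k] CompletedTensorSpace F →ₗ[k]
    TensorAlgebra k L ⧸ (tensorCoalgebraFiltration F).F m :=
  TensorProduct.lift ((levelMulFirst F hm).compl₁₂ (levelProj F m) (levelProj F m))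

variable {F}

theorem levelFirst_tmul {m : ℕ} (hm : 2 ≤ m) {g : CompletedTensorSpace F} {y : L}
    (h : HasCogenerator F g y) (g' : CompletedTensorSpace F) :
    levelFirst F hm (g ⊗ₜ[k] g') = levelMul F m y (g'.1 m) := by
  obtain ⟨t, ht⟩ := Submodule.mkQ_surjective _ (g.1 m)
  rw [← h.levelMul_eq hm ht.symm]
  change levelMulFirst F hm (g.1 m) (g'.1 m) = _
  rw [← ht]
  rfl

theorem levelFirst_map_toCompletion {m : ℕ} (hm : 2 ≤ m)
    (z : TensorAlgebra k L ⊗[k] TensorAlgebra k L) :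
    levelFirst F hm (TensorProduct.map (toCompletion _) (toCompletion _) z) =
      Submodule.mkQ _ (LinearMap.mul' k (TensorAlgebra k L) (TensorProduct.map
        ((TensorAlgebra.ι k).comp (LinearMap.id.comp (cogenerator k L))) LinearMap.id z)) := by
  induction z using TensorProduct.induction_on with
  | zero => simp
  | tmul a b => rfl
  | add a b ha hb => simp only [map_add, ha, hb]

/-- If `p + q ≥ 2 m`, one of the two factors already vanishes at level `m`. So `g ⊗ h ↦ π(g) h` at
level `m` is defined on completed tensors known to level `2 m`. -/
theorem tensorFiltration_le_ker_levelFirst {m : ℕ} (hm : 2 ≤ m) {M : ℕ} (hM : 2 * m ≤ M) :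
    (tensorFiltration (completionFiltration (tensorCoalgebraFiltration F))
      (completionFiltration (tensorCoalgebraFiltration F))).F M ≤
        LinearMap.ker (levelFirst F hm) := by
  refine Submodule.span_le.2 ?_
  rintro _ ⟨p, q, hpq, g, hg, g', hg', rfl⟩
  change levelMulFirst F hm (g.1 m) (g'.1 m) = _
  rcases (by omega : m ≤ p ∨ m ≤ q) with h | h
  · have h1 : g.1 m = 0 := (completionFiltration _).anti h hg
    rw [h1, map_zero, LinearMap.zero_apply]
  · have h1 : g'.1 m = 0 := (completionFiltration _).anti h hg'
    rw [h1, map_zero]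

/-- Applying `π(-) · (-)` to `Δ g` returns `g` without its constant term, by `mapFirst_id`. The
tensor `z` may be any representative of `Δ g`, in particular one computed in the source of a
coalgebra map. -/
theorem level_eq_of_comul {m : ℕ} (hm : 2 ≤ m) {M : ℕ} (hM : 2 * m ≤ M)
    {g : CompletedTensorSpace F} {z : CompletedTensorSpace F ⊗[k] CompletedTensorSpace F}
    (hz : ((completedTensorCoalgebra F).comul g).1 M = Submodule.mkQ _ z) :
    g.1 m = Submodule.mkQ _ (algebraMap k _ ((completedTensorCoalgebra F).counit g)) +
      levelFirst F hm z := by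
  obtain ⟨t, ht⟩ := Submodule.mkQ_surjective _ (g.1 M)
  have h1 : ((completedTensorCoalgebra F).comul g).1 M = Submodule.mkQ _
      (TensorProduct.map (toCompletion (tensorCoalgebraFiltration F))
        (toCompletion (tensorCoalgebraFiltration F)) (deconcatenation k L t)) := by
    change Submodule.mapQ _ _ _ _ (g.1 M) = _
    rw [← ht]
    rfl
  have hmem : TensorProduct.map (toCompletion (tensorCoalgebraFiltration F))
      (toCompletion (tensorCoalgebraFiltration F)) (deconcatenation k L t) - z ∈
      (tensorFiltration (completionFiltration (tensorCoalgebraFiltration F))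
        (completionFiltration (tensorCoalgebraFiltration F))).F M :=
    mkQ_eq_mkQ.1 (h1.symm.trans hz)
  have h2 := tensorFiltration_le_ker_levelFirst hm hM hmem
  rw [LinearMap.mem_ker, map_sub, sub_eq_zero] at h2
  have h3 : (completedTensorCoalgebra F).counit g =
      TensorAlgebra.algebraMapInv (R := k) (M := L) t := by
    change Submodule.liftQ _ _ (algebraMapInv_mem F) (g.1 1) = _
    rw [completion_eq_mkQ g (by omega : 1 ≤ M) ht.symm]
    rfl
  have h4 := mapFirst_id (k := k) t
  rw [mapFirst, LinearMap.comp_apply, LinearMap.comp_apply] at h4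
  rw [← h2, levelFirst_map_toCompletion, h4, h3, completion_eq_mkQ g (by omega : m ≤ M) ht.symm,
    ← map_add, add_sub_cancel]

theorem DGCoalgebraMap.level_eq {X : Type*} [AddCommGroup X] [Module k X]
    {C : DGCoalgebraData k X} (f : DGCoalgebraMap C (completedTensorCoalgebra F)) {m : ℕ}
    (hm : 2 ≤ m) {M : ℕ} (hM : 2 * m ≤ M) {c : X} {z : X ⊗[k] X}
    (hz : (C.comul c).1 M = Submodule.mkQ _ z) :
    (f.toLin c).1 m = Submodule.mkQ _ (algebraMap k _ (C.counit c)) +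
      levelFirst F hm (TensorProduct.map f.toLin f.toLin z) := by
  rw [← f.map_counit]
  refine level_eq_of_comul hm hM ?_
  rw [← f.map_comul]
  change Submodule.mapQ _ _ _ _ ((C.comul c).1 M) = _
  rw [hz]
  rfl

theorem completedTensorCoalgebra_d_level (g : CompletedTensorSpace F) {m : ℕ}
    {t : TensorAlgebra k L} (ht : g.1 (m + 1) = Submodule.mkQ _ t) :
    ((completedTensorCoalgebra F).d g).1 m = Submodule.mkQ _ (coderivation A t) := by
  change Submodule.mapQ _ _ _ _ (g.1 (m + 1)) = _
  rw [ht]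
  rfl

end Levels

/-! ### Classifying maps and paths of filtered maps -/

section FromMaps

variable {k : Type*} [Field k] [CharZero k] {L : Type*} [AddCommGroup L] [Module k L]
variable {A : DGLieAlgebra k L} {F : CompleteFiltration A}

/-- The family attached to the series `∑ P_n t^n + ∑ B_n t^n dt`. -/
def pathFamily (P B : ℕ → L) (γ : ℕ × ℕ) : L :=
  if γ.2 = 0 then P γ.1 else if γ.2 = 1 then B γ.1 else 0

omit [CharZero k] in
theorem parity_of_deg_zero {y : L} (hy : y ∈ A.deg 0) : A.parity y = y := by
  simpa using parity_of_mem 0 y hy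

omit [CharZero k] in
theorem parity_of_deg_one {y : L} (hy : y ∈ A.deg 1) : A.parity y = -y := by
  simpa using parity_of_mem 1 y hy

omit [CharZero k] in
theorem curvature_pathFamily_zero {P B : ℕ → L} (hP : ∀ n, P n ∈ A.deg 1) (n : ℕ) :
    curvature (pathFamily P B) A (n, 0) =
      -(A.d (P n) + (2 : k)⁻¹ • seriesBracket A P P n) := by
  rw [curvature, sum_antidiagonal_prod_zero]
  simp only [pathFamily, if_true, parity_of_deg_one (hP _), map_neg, LinearMap.neg_apply,
    sum_neg_distrib, seriesBracket, smul_neg]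
  abel

theorem curvature_pathFamily_one {P B : ℕ → L} (hP : ∀ n, P n ∈ A.deg 1)
    (hB : ∀ n, B n ∈ A.deg 0) (n : ℕ) :
    curvature (pathFamily P B) A (n, 1) = seriesBracket A B P n - A.d (B n) := by
  rw [curvature, sum_antidiagonal_prod_one]
  simp only [pathFamily, if_true, parity_of_deg_one (hP _), parity_of_deg_zero (hB _), map_neg,
    LinearMap.neg_apply, one_ne_zero, if_false, sum_add_distrib,
    ← bracket_symm_of_mem (hB _) (hP _)]
  rw [← sum_antidiagonal_comm n fun i j => A.bracket (B i) (P j), ← two_smul k, smul_smul,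
    inv_mul_cancel₀ two_ne_zero, one_smul]
  rfl

-- From `Δ 1 = 1 ⊗ 1` the image satisfies `g = 1 + p g`, which forces the geometric series. The
-- length one part of `d g = 0` is, up to sign, the Maurer-Cartan expression of `p`.
omit [CharZero k] in
theorem FilteredMap.exists_eq_groupLike (f : FilteredMap (point k) F) :
    ∃ p : MaurerCartan A, IsClassifyingMap p f := by
  have hdeg : f.toLin 1 ∈ (completedTensorCoalgebra F).deg 0 :=
    f.map_deg 0 1 (by simp [point])
  obtain ⟨p, hp, hcog⟩ := exists_hasCogenerator hdeg
  rw [zero_add] at hp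
  have hlevel : ∀ m ≥ 2, (f.toLin 1).1 m =
      Submodule.mkQ _ (∑ n ∈ range m, TensorAlgebra.ι k p ^ n) := by
    intro m hm
    refine eq_sum_pow_of_recursion ?_
    have h := f.toDGCoalgebraMap.level_eq hm le_rfl (c := 1) (z := 1 ⊗ₜ[k] 1) rfl
    rw [TensorProduct.map_tmul, levelFirst_tmul hm hcog] at h
    simpa [point] using h
  have heq : f.toLin 1 = groupLike F p := by
    refine Subtype.ext (funext fun m => ?_)
    -- Levels `0` and `1` are recovered from a level where the recursion is available.
    rw [← (f.toLin 1).2 m (m + 2) (by omega), ← (groupLike F p).2 m (m + 2) (by omega),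
      hlevel _ (by omega)]
    rfl
  refine ⟨⟨p, hp, ?_⟩, heq⟩
  -- The point is treated as a constant path with `B = 0`, so that the curvature formula for paths
  -- applies.
  let P : ℕ → L := fun n => if n = 0 then p else 0
  have hP : ∀ n, P n ∈ A.deg 1 := fun n => by
    simp only [P]
    split_ifs
    exacts [hp, zero_mem _]
  have hd : (completedTensorCoalgebra F).d (f.toLin 1) = 0 := by
    rw [← f.map_d]
    exact map_zero _
  have hpow : ∀ N, tensorSum k (pathFamily P 0) N 0 = ∑ n ∈ range N, TensorAlgebra.ι k p ^ n := by
    intro N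
    simp only [tensorSum, tensorPow_zero_right]
    rfl
  have h0 : curvature (pathFamily P 0) A (0, 0) = 0 := by
    rw [curvature_pathFamily_zero hP]
    refine neg_eq_zero.2 (eq_of_sub_mem (i := 2) (F := F) ?_ (zero_mem _) fun m hm => ?_)
    · refine add_mem (by simpa using A.d_mem 1 _ (hP 0)) (Submodule.smul_mem _ _ ?_)
      simpa using seriesBracket_mem_deg hP hP 0
    -- Level `m + 1` is used because the coderivation lowers the filtration by one.
    · rw [sub_zero, ← neg_mem_iff, ← curvature_pathFamily_zero (B := 0) hP,
        ← cogeneratingMap_tensorSum _ (by omega : 3 ≤ m + 1), ← cogenerator_coderivation]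
      refine cogenerator_mem_of_tensorCoalgebraFiltration hm
        ((Submodule.Quotient.mk_eq_zero _).1 ?_)
      have h1 := completedTensorCoalgebra_d_level (f.toLin 1) (m := m) (hlevel (m + 1) (by omega))
      rw [hd] at h1
      exact (h1.trans (by rw [← hpow]; rfl)).symm
  rw [curvature_pathFamily_zero hP, neg_eq_zero] at h0
  simpa [seriesBracket, P] using h0

omit [CharZero k] in
theorem hasCogenerator_groupLike (F : CompleteFiltration A) (p : L) :
    HasCogenerator F (groupLike F p) p := by
  intro m hm t ht
  have h1 := cogenerator_tensorSum (k := k) (pointFamily p) hm 0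
  simp only [tensorSum, tensorPow_zero_right, pointFamily, if_true] at h1
  have h2 : (groupLike F p).1 m = Submodule.mkQ _ (∑ n ∈ range m, TensorAlgebra.ι k p ^ n) := rfl
  rw [← h1, ← map_sub]
  exact cogenerator_mem_of_tensorCoalgebraFiltration hm (mkQ_eq_mkQ.1 (ht.symm.trans h2))

omit [CharZero k] in
theorem HasCogenerator.unique {g : CompletedTensorSpace F} {i : ℤ} {y z : L} (hy : y ∈ A.deg i)
    (hz : z ∈ A.deg i) (h : HasCogenerator F g y) (h' : HasCogenerator F g z) : y = z := by
  refine eq_of_sub_mem (F := F) hy hz fun m hm => ?_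
  obtain ⟨t, ht⟩ := Submodule.mkQ_surjective _ (g.1 m)
  have h1 := sub_mem (h' m hm t ht.symm) (h m hm t ht.symm)
  rwa [sub_sub_sub_cancel_left] at h1

omit [CharZero k] in
theorem intervalComulTerm_tElt (r n : ℕ) : intervalComulTerm r (tElt n : IntervalSpace k) =
    if r = n then ∑ ij ∈ antidiagonal n, tElt ij.1 ⊗ₜ[k] tElt ij.2 else 0 := by
  split_ifs with h
  · subst h
    simp [intervalComulTerm, tElt]
  · simp [intervalComulTerm, tElt, h]

omit [CharZero k] in
theorem intervalComulTerm_tuElt (r n : ℕ) : intervalComulTerm r (tuElt n : IntervalSpace k) =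
    if r = n then ∑ ij ∈ antidiagonal n,
      (tuElt ij.1 ⊗ₜ[k] tElt ij.2 + tElt ij.1 ⊗ₜ[k] tuElt ij.2) else 0 := by
  split_ifs with h
  · subst h
    simp [intervalComulTerm, tuElt]
  · simp [intervalComulTerm, tuElt, h]

/-- The coproducts of `t_n` and `t_n u` make `h` the geometric series of the family `P`, `B`. The
length one parts of `d t_n = 0` and `d(t_n u) = (n + 1) t_(n+1)` are the two equations of a path. -/
theorem FilteredMap.exists_path (h : FilteredMap (interval k) F) {p q : L} (hp : p ∈ A.deg 1)
    (h0 : h.toLin (tElt 0) = groupLike F p) (h1 : h.toLin (fun _ => 1, 0) = groupLike F q) :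
    ∃ P B : ℕ → L, IsPath F P B ∧ PathJoins F P p q := by
  have ht : ∀ n, h.toLin (tElt n) ∈ (completedTensorCoalgebra F).deg 0 := fun n =>
    h.map_deg 0 _ (by simp [interval, tElt])
  have htu : ∀ n, h.toLin (tuElt n) ∈ (completedTensorCoalgebra F).deg (-1) := fun n =>
    h.map_deg (-1) _ (by simp [interval, tuElt])
  choose P hP hPc using fun n => exists_hasCogenerator (ht n)
  choose B hB hBc using fun n => exists_hasCogenerator (htu n)
  simp only [zero_add] at hP
  simp only [neg_add_cancel] at hB
  let H : ℕ × ℕ → CompletedTensorSpace F := fun γ =>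
    if γ.2 = 0 then h.toLin (tElt γ.1) else h.toLin (tuElt γ.1)
  let x := pathFamily P B
  let D : Set (ℕ × ℕ) := {γ | γ.2 ≤ 1}
  have hlevel : ∀ m ≥ 2, ∀ γ ∈ D, (H γ).1 m = Submodule.mkQ _ (tensorSum k x m γ) := by
    intro m hm
    refine eq_tensorSum_of_recursion x (D := D) (H := fun γ => (H γ).1 m) ?_ ?_
    · intro γ hγ ab hab
      have h2 := congrArg Prod.snd (HasAntidiagonal.mem_antidiagonal.1 hab)
      rw [Prod.snd_add] at h2
      change γ.2 ≤ 1 at hγ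
      change ab.2.2 ≤ 1
      omega
    · rintro ⟨n, e⟩ he
      change e ≤ 1 at he
      rcases Nat.le_one_iff_eq_zero_or_eq_one.1 he with rfl | rfl
      -- The level `2 * m + n + 1` is at least `2 * m` and exceeds `n`, so the truncated coproduct
      -- contains the whole of `Δ t_n`.
      · have h2 := h.toDGCoalgebraMap.level_eq hm (by omega : 2 * m ≤ 2 * m + n + 1)
          (c := tElt n) (z := ∑ ij ∈ antidiagonal n, tElt ij.1 ⊗ₜ[k] tElt ij.2) (by
            change Submodule.mkQ _ _ = _
            rw [sum_congr rfl fun r _ => intervalComulTerm_tElt r n,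
              sum_ite_eq_of_mem' _ _ _ (by simp)]
            rfl)
        rw [sum_antidiagonal_prod_zero]
        simp only [map_sum, TensorProduct.map_tmul, levelFirst_tmul hm (hPc _)] at h2
        refine h2.trans ?_
        congr 2
        simp only [interval, tElt, LinearMap.comp_apply, LinearMap.fst_apply, LinearMap.proj_apply]
        by_cases hn : n = 0
        · subst hn; simp
        · rw [Pi.single_eq_of_ne (Ne.symm hn), map_zero, if_neg (by simp [hn])]
      · have h2 := h.toDGCoalgebraMap.level_eq hm (by omega : 2 * m ≤ 2 * m + n + 1)
          (c := tuElt n) (z := ∑ ij ∈ antidiagonal n,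
            (tuElt ij.1 ⊗ₜ[k] tElt ij.2 + tElt ij.1 ⊗ₜ[k] tuElt ij.2)) (by
            change Submodule.mkQ _ _ = _
            rw [sum_congr rfl fun r _ => intervalComulTerm_tuElt r n,
              sum_ite_eq_of_mem' _ _ _ (by simp)]
            rfl)
        rw [sum_antidiagonal_prod_one]
        simp only [map_sum, map_add, TensorProduct.map_tmul, levelFirst_tmul hm (hPc _),
          levelFirst_tmul hm (hBc _)] at h2
        refine h2.trans ?_
        congr 1
        · congr 1
          simp [interval, tuElt]
        · exact sum_congr rfl fun ij _ => add_comm _ _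
  have hx0 : ∀ n, x (n, 0) = P n := fun n => rfl
  have hPmem : ∀ n, P n ∈ F.F n := fun n => (hPc n).mem (h.filtered n _ (tElt_mem n))
  have hmc : ∀ n, A.d (P n) + (2 : k)⁻¹ • seriesBracket A P P n = 0 := by
    intro n
    refine eq_of_sub_mem (i := 2) (F := F) ?_ (zero_mem _) fun m hm => ?_
    · refine add_mem (by simpa using A.d_mem 1 _ (hP n)) (Submodule.smul_mem _ _ ?_)
      simpa using seriesBracket_mem_deg hP hP n
    · rw [sub_zero, ← neg_mem_iff, ← curvature_pathFamily_zero (B := B) hP,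
        ← cogeneratingMap_tensorSum _ (by omega : 3 ≤ m + 1), ← cogenerator_coderivation]
      refine cogenerator_mem_of_tensorCoalgebraFiltration hm
        ((Submodule.Quotient.mk_eq_zero _).1 ?_)
      have h2 := completedTensorCoalgebra_d_level (h.toLin (tElt n)) (m := m)
        (hlevel (m + 1) (by omega) (n, 0) (Nat.zero_le _))
      rw [← h.map_d] at h2
      have h3 : (interval k).d (tElt n) = 0 := by
        simp only [interval, tElt, LinearMap.coe_mk, AddHom.coe_mk, Pi.zero_apply, mul_zero]
        rfl
      rw [h3, map_zero] at h2
      exact h2.symm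
  have hflow : ∀ n : ℕ, ((n : k) + 1) • P (n + 1) = seriesBracket A B P n - A.d (B n) := by
    intro n
    refine eq_of_sub_mem (i := 1) (F := F) (Submodule.smul_mem _ _ (hP _)) (sub_mem
      (by simpa using seriesBracket_mem_deg hB hP n) (by simpa using A.d_mem 0 _ (hB n)))
      fun m hm => ?_
    rw [← curvature_pathFamily_one hP hB, ← cogeneratingMap_tensorSum _ (by omega : 3 ≤ m + 1),
      ← cogenerator_coderivation, ← hx0, ← cogenerator_tensorSum (k := k) x hm, ← map_smul,
      ← map_sub]
    refine cogenerator_mem_of_tensorCoalgebraFiltration hm (mkQ_eq_mkQ.1 ?_)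
    have h2 := completedTensorCoalgebra_d_level (h.toLin (tuElt n)) (m := m)
      (hlevel (m + 1) (by omega) (n, 1) (le_refl 1))
    rw [← h.map_d] at h2
    have h3 : (interval k).d (tuElt n) = ((n : k) + 1) • tElt (n + 1) := by
      refine Prod.ext (funext fun i => ?_) (by simp [interval, tElt])
      simp only [interval, tuElt, tElt, LinearMap.coe_mk, AddHom.coe_mk, Prod.smul_fst,
        Pi.smul_apply, smul_eq_mul]
      rcases i with _ | i
      · simp
      · by_cases hi : i = n
        · subst hi; simp
        · simp [hi]
    rw [h3, map_smul] at h2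
    rw [← h2, map_smul, ← hlevel m hm (n + 1, 0) (Nat.zero_le _)]
    rfl
  refine ⟨P, B, ⟨hP, hPmem, hB, fun n => (hBc n).mem (h.filtered n _ (tuElt_mem n)), hmc, hflow⟩,
    ⟨(hPc 0).unique (hP 0) hp (h0 ▸ hasCogenerator_groupLike F p), fun N => ?_⟩⟩
  -- The rest of `∑ t_i` lies in `F_(N+2) J` and `h` preserves filtrations, so at this level the
  -- image is a finite sum.
  have h2 : (h.toLin (fun _ => 1, 0)).1 (N + 2) =
      Submodule.mkQ _ (∑ n ∈ range (N + 2), tensorSum k x (N + 2) (n, 0)) := by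
    have h3 : ((fun _ => 1, 0) : IntervalSpace k) - ∑ n ∈ range (N + 2), tElt n ∈
        (intervalFiltration k).F (N + 2) := by
      intro i hi
      simp [tElt, Prod.fst_sum, Prod.snd_sum, Finset.sum_apply, Pi.single_apply, hi]
    have h4 : (h.toLin ((fun _ => 1, 0) - ∑ n ∈ range (N + 2), tElt n)).1 (N + 2) = 0 :=
      h.map_fil _ h3
    rw [map_sub, map_sum] at h4
    have h5 : (h.toLin (fun _ => 1, 0)).1 (N + 2) =
        ∑ n ∈ range (N + 2), (h.toLin (tElt n)).1 (N + 2) := by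
      rw [← sub_eq_zero, ← h4, Submodule.coe_sub, Pi.sub_apply, Submodule.coe_sum,
        Finset.sum_apply]
    rw [h5, map_sum]
    exact sum_congr rfl fun n _ => hlevel (N + 2) (by omega) (n, 0) (Nat.zero_le _)
  have h3 := hasCogenerator_groupLike F q (N + 2) (by omega) _ (h1 ▸ h2)
  rw [map_sum, sum_congr rfl fun n _ => cogenerator_tensorSum (k := k) x (by omega) (n, 0),
    sum_range_succ, sum_range_succ] at h3
  -- The comparison took place at level `N + 2`; the two extra terms `P N` and `P (N + 1)` lie in
  -- `F_N` and can be dropped.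
  have h4 := sub_mem (F.anti (by omega : N ≤ N + 2) h3)
    (add_mem (F.anti le_rfl (hPmem N)) (F.anti N.le_succ (hPmem (N + 1))))
  convert h4 using 1
  simp only [hx0]
  abel

end FromMaps

/-! ### The filtered map attached to a path -/

section FromPaths

variable {k : Type*} [Field k] [CharZero k] {L : Type*} [AddCommGroup L] [Module k L]
variable {A : DGLieAlgebra k L} {F : CompleteFiltration A}

/-- Compatibility of the geometric series with the differentials, up to long tensors. The path
equations determine the curvature, and the recursion for the coderivation gives the rest by
induction on the length; the case with one `u` also uses the case without. -/
theorem coderivation_tensorSum_pathFamily {P B : ℕ → L} (h : IsPath F P B) (N : ℕ) :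
    (∀ n, coderivation A (tensorSum k (pathFamily P B) (N + 1) (n, 0)) ∈
      lengthFiltration k L N) ∧
    ∀ n : ℕ, coderivation A (tensorSum k (pathFamily P B) (N + 1) (n, 1)) -
      ((n : k) + 1) • tensorSum k (pathFamily P B) (N + 1) (n + 1, 0) ∈
        lengthFiltration k L N := by
  set x := pathFamily P B with hx
  have hxP : ∀ n, x (n, 0) = P n := fun n => rfl
  have hxB : ∀ n, x (n, 1) = B n := fun n => rfl
  have hsus : ∀ n, suspendedParity A (P n) = P n := fun n => by
    rw [suspendedParity, LinearMap.neg_apply, parity_of_deg_one (h.P_deg n), neg_neg]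
  have hc0 : ∀ n, curvature x A (n, 0) = 0 := fun n => by
    rw [hx, curvature_pathFamily_zero h.P_deg, h.maurerCartan, neg_zero]
  have hc1 : ∀ n : ℕ, curvature x A (n, 1) = ((n : k) + 1) • P (n + 1) := fun n => by
    rw [hx, curvature_pathFamily_one h.P_deg h.B_deg, h.flow]
  have hlast : ∀ N γ, ∑ ab ∈ antidiagonal γ,
      TensorAlgebra.ι k (A.d (x ab.1)) * tensorPow k x N ab.2 ∈ lengthFiltration k L (N + 1) :=
    fun N γ => Submodule.sum_mem _ fun _ _ =>
      ι_mul_mem_lengthFiltration _ (tensorPow_mem_lengthFiltration _ _ _)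
  induction N with
  | zero => exact ⟨fun _ => mem_lengthFiltration_zero _, fun _ => mem_lengthFiltration_zero _⟩
  | succ N ih =>
    refine ⟨fun n => ?_, fun n => ?_⟩
    · rw [coderivation_tensorSum]
      refine sub_mem (add_mem ?_ ?_) (hlast _ _)
      · rw [sum_antidiagonal_prod_zero]
        exact Submodule.sum_mem _ fun _ _ => ι_mul_mem_lengthFiltration _ (ih.1 _)
      · rw [sum_antidiagonal_prod_zero]
        simp [hc0]
    · have h1 : ((n : k) + 1) • tensorSum k x (N + 2) (n + 1, 0) =
          ∑ ij ∈ antidiagonal n,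
            (TensorAlgebra.ι k (((ij.1 : k) + 1) • P (ij.1 + 1)) * tensorSum k x (N + 1) (ij.2, 0) +
              TensorAlgebra.ι k (P ij.1) *
                (((ij.2 : k) + 1) • tensorSum k x (N + 1) (ij.2 + 1, 0))) := by
        rw [tensorSum_succ, if_neg (by simp), zero_add, sum_antidiagonal_prod_zero,
          sum_antidiagonal_leibniz fun i j => TensorAlgebra.ι k (x (i, 0)) *
            tensorSum k x (N + 1) (j, 0)]
        refine sum_congr rfl fun ij _ => ?_
        rw [map_smul, smul_mul_assoc, mul_smul_comm]
        rfl
      have h2 : ∀ γ, tensorSum k x (N + 1) γ = tensorSum k x N γ + tensorPow k x N γ := fun γ =>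
        sum_range_succ _ _
      -- The curvature terms cancel against the first half of the Leibniz expansion. What remains
      -- are letters times earlier errors, and truncation errors of length `N + 1`.
      have h3 : coderivation A (tensorSum k x (N + 2) (n, 1)) -
          ((n : k) + 1) • tensorSum k x (N + 2) (n + 1, 0) =
          ∑ ij ∈ antidiagonal n, (TensorAlgebra.ι k (P ij.1) *
              (coderivation A (tensorSum k x (N + 1) (ij.2, 1)) -
                ((ij.2 : k) + 1) • tensorSum k x (N + 1) (ij.2 + 1, 0)) +
            TensorAlgebra.ι k (suspendedParity A (B ij.1)) *
              coderivation A (tensorSum k x (N + 1) (ij.2, 0)) -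
            TensorAlgebra.ι k (((ij.1 : k) + 1) • P (ij.1 + 1)) * tensorPow k x N (ij.2, 0)) -
          ∑ ab ∈ antidiagonal (n, 1),
            TensorAlgebra.ι k (A.d (x ab.1)) * tensorPow k x N ab.2 := by
        rw [coderivation_tensorSum, h1, sum_antidiagonal_prod_one, sum_antidiagonal_prod_one,
          sub_right_comm, ← sum_add_distrib, ← sum_sub_distrib]
        congr 1
        refine sum_congr rfl fun ij _ => ?_
        simp only [hc0, hc1, map_zero, zero_mul, zero_add, hxP, hxB, hsus, mul_sub, h2 (ij.2, 0),
          mul_add]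
        abel
      rw [h3]
      exact sub_mem (Submodule.sum_mem _ fun ij _ => sub_mem
        (add_mem (ι_mul_mem_lengthFiltration _ (ih.2 _)) (ι_mul_mem_lengthFiltration _ (ih.1 _)))
        (ι_mul_mem_lengthFiltration _ (tensorPow_mem_lengthFiltration _ _ _))) (hlast _ _)

/-- The tensor that represents the image of `a` under the map attached to a path. -/
def pathTensor (x : ℕ × ℕ → L) (M N : ℕ) : IntervalSpace k →ₗ[k] TensorAlgebra k L where
  toFun a := ∑ n ∈ range M, (a.1 n • tensorSum k x N (n, 0) + a.2 n • tensorSum k x N (n, 1))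
  map_add' a b := by
    rw [← sum_add_distrib]
    refine sum_congr rfl fun n _ => ?_
    simp only [Prod.fst_add, Prod.snd_add, Pi.add_apply, add_smul]
    abel
  map_smul' c a := by
    rw [RingHom.id_apply, smul_sum]
    refine sum_congr rfl fun n _ => ?_
    simp only [Prod.smul_fst, Prod.smul_snd, Pi.smul_apply, smul_add, smul_smul, smul_eq_mul]

omit [CharZero k] in
theorem pathTensor_apply (x : ℕ × ℕ → L) (M N : ℕ) (a : IntervalSpace k) : pathTensor x M N a =
    ∑ n ∈ range M, (a.1 n • tensorSum k x N (n, 0) + a.2 n • tensorSum k x N (n, 1)) := rfl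

omit [CharZero k] in
theorem mkQ_pathTensor {x : ℕ × ℕ → L} (hx : ∀ γ, x γ ∈ F.F γ.1) {m M N : ℕ} (hM : m ≤ M)
    (hN : m ≤ N) (a : IntervalSpace k) :
    Submodule.mkQ ((tensorCoalgebraFiltration F).F m) (pathTensor x M N a) =
      Submodule.mkQ _ (pathTensor x m m a) := by
  rw [pathTensor_apply, pathTensor_apply, ← sum_range_add_sum_Ico _ hM, map_add, map_sum,
    map_sum, map_sum]
  have h1 : ∑ n ∈ Ico m M, Submodule.mkQ ((tensorCoalgebraFiltration F).F m)
      (a.1 n • tensorSum k x N (n, 0) + a.2 n • tensorSum k x N (n, 1)) = 0 := by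
    refine sum_eq_zero fun n hn => (Submodule.Quotient.mk_eq_zero _).2 ?_
    have hn' := (tensorCoalgebraFiltration F).anti (mem_Ico.1 hn).1
    exact add_mem (Submodule.smul_mem _ _ (hn' (tensorSum_mem hx N (n, 0))))
      (Submodule.smul_mem _ _ (hn' (tensorSum_mem hx N (n, 1))))
  rw [h1, add_zero]
  refine sum_congr rfl fun n _ => ?_
  rw [map_add, map_add, map_smul, map_smul, map_smul, map_smul, mkQ_tensorSum x hN,
    mkQ_tensorSum x hN]

/-- The linear map from `J` attached to a family. -/
def pathLinearMap (F : CompleteFiltration A) {x : ℕ × ℕ → L} (hx : ∀ γ, x γ ∈ F.F γ.1) :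
    IntervalSpace k →ₗ[k] CompletedTensorSpace F where
  toFun a := ⟨fun m => Submodule.mkQ _ (pathTensor x m m a), fun _ _ h => mkQ_pathTensor hx h h a⟩
  map_add' a b := by
    refine Subtype.ext (funext fun m => ?_)
    simp only [map_add]
    rfl
  map_smul' c a := by
    refine Subtype.ext (funext fun m => ?_)
    simp only [map_smul]
    rfl

omit [CharZero k] in
theorem pathLinearMap_level {x : ℕ × ℕ → L} (hx : ∀ γ, x γ ∈ F.F γ.1) {m M N : ℕ} (hM : m ≤ M)
    (hN : m ≤ N) (a : IntervalSpace k) :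
    (pathLinearMap F hx a).1 m = Submodule.mkQ _ (pathTensor x M N a) :=
  (mkQ_pathTensor hx hM hN a).symm

omit [CharZero k] in
theorem pathTensor_tElt (x : ℕ × ℕ → L) {M n : ℕ} (hn : n < M) (N : ℕ) :
    pathTensor x M N (tElt n : IntervalSpace k) = tensorSum k x N (n, 0) := by
  rw [pathTensor_apply, sum_eq_single n]
  · simp [tElt]
  · intro i _ hi
    simp [tElt, hi]
  · simp [hn]

omit [CharZero k] in
theorem pathTensor_tuElt (x : ℕ × ℕ → L) {M n : ℕ} (hn : n < M) (N : ℕ) :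
    pathTensor x M N (tuElt n : IntervalSpace k) = tensorSum k x N (n, 1) := by
  rw [pathTensor_apply, sum_eq_single n]
  · simp [tuElt]
  · intro i _ hi
    simp [tuElt, hi]
  · simp [hn]

omit [CharZero k] in
theorem tmul_sub_tmul_mem {V W : Type*} [AddCommGroup V] [Module k V] [AddCommGroup W] [Module k W]
    {B : Filtration k V} {C : Filtration k W} (hB : B.F 0 = ⊤) (hC : C.F 0 = ⊤) {N : ℕ} {a a' : V}
    {b b' : W} (ha : a - a' ∈ B.F N) (hb : b - b' ∈ C.F N) :
    a ⊗ₜ[k] b - a' ⊗ₜ[k] b' ∈ (tensorFiltration B C).F N := by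
  have h1 : a ⊗ₜ[k] b - a' ⊗ₜ[k] b' = (a - a') ⊗ₜ[k] b + a' ⊗ₜ[k] (b - b') := by
    rw [TensorProduct.sub_tmul, TensorProduct.tmul_sub]
    abel
  rw [h1]
  exact add_mem (Submodule.subset_span ⟨N, 0, le_rfl, _, ha, _, by rw [hC]; trivial, rfl⟩)
    (Submodule.subset_span ⟨0, N, by omega, _, by rw [hB]; trivial, _, hb, rfl⟩)

omit [CharZero k] in
theorem tensorCoalgebraFiltration_zero (F : CompleteFiltration A) :
    (tensorCoalgebraFiltration F).F 0 = ⊤ :=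
  eq_top_iff.2 fun t _ => weightFiltration_le F 0 (mem_weightFiltration_zero t)

omit [CharZero k] in
theorem completionFiltration_zero (F : CompleteFiltration A) :
    (completionFiltration (tensorCoalgebraFiltration F)).F 0 = ⊤ := by
  refine eq_top_iff.2 fun g _ => ?_
  obtain ⟨t, ht⟩ := Submodule.mkQ_surjective _ (g.1 0)
  change g.1 0 = 0
  rw [← ht]
  exact (Submodule.Quotient.mk_eq_zero _).2
    (by rw [tensorCoalgebraFiltration_zero]; exact Submodule.mem_top)

omit [CharZero k] in
theorem pathFamily_mem {P B : ℕ → L} (h : IsPath F P B) (γ : ℕ × ℕ) :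
    pathFamily P B γ ∈ F.F γ.1 := by
  rw [pathFamily]
  split_ifs
  exacts [h.P_mem _, h.B_mem _, zero_mem _]

omit [CharZero k] in
theorem pathFamily_deg {P B : ℕ → L} (h : IsPath F P B) (γ : ℕ × ℕ) :
    pathFamily P B γ ∈ A.deg (1 - γ.2) := by
  rw [pathFamily]
  split_ifs with h0 h1
  · rw [h0]
    simpa using h.P_deg _
  · rw [h1]
    simpa using h.B_deg _
  · exact zero_mem _

-- Compatibility with coproducts on truncations: `f` agrees with `c` applied to partial geometric
-- series on the `t_n` and `t_n u`, and those series have the coproduct of `J` up to level `M`. It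
-- is applied with `c` the canonical map to the completion.
omit [CharZero k] in
theorem map_intervalComulTerm_sub_mem {V : Type*} [AddCommGroup V] [Module k V]
    {B : Filtration k V} (hB : B.F 0 = ⊤) (f : IntervalSpace k →ₗ[k] V)
    (c : TensorAlgebra k L →ₗ[k] V)
    (hc : ∀ p, (tensorCoalgebraFiltration F).F p ≤ (B.F p).comap c) (x : ℕ × ℕ → L) {M : ℕ}
    (ht : ∀ n < M, f (tElt n) - c (tensorSum k x M (n, 0)) ∈ B.F M)
    (htu : ∀ n < M, f (tuElt n) - c (tensorSum k x M (n, 1)) ∈ B.F M) (a : IntervalSpace k) :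
    TensorProduct.map f f (∑ n ∈ range M, intervalComulTerm n a) -
      TensorProduct.map c c (deconcatenation k L (pathTensor x M M a)) ∈
      (tensorFiltration B B).F M := by
  set S := (tensorFiltration B B).F M with hS
  have hmul : ∀ {g h : V} {s t : TensorAlgebra k L}, g - c s ∈ B.F M → h - c t ∈ B.F M →
      g ⊗ₜ[k] h - c s ⊗ₜ[k] c t ∈ S := fun hg hh => tmul_sub_tmul_mem hB hB hg hh
  have hΔ : ∀ γ, ∑ ab ∈ antidiagonal γ, c (tensorSum k x M ab.1) ⊗ₜ[k] c (tensorSum k x M ab.2) -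
      TensorProduct.map c c (deconcatenation k L (tensorSum k x M γ)) ∈ S := by
    intro γ
    have h1 := tensorFiltration_map _ _ _ _ c c hc hc M
      (deconcatenation_tensorSum_sub_mem x F M γ)
    simpa only [Submodule.mem_comap, map_sub, map_sum, TensorProduct.map_tmul] using h1
  have h0 : ∀ n < M, ∑ ij ∈ antidiagonal n, f (tElt ij.1) ⊗ₜ[k] f (tElt ij.2) -
      TensorProduct.map c c (deconcatenation k L (tensorSum k x M (n, 0))) ∈ S := by
    intro n hn
    have h1 := hΔ (n, 0)
    rw [sum_antidiagonal_prod_zero] at h1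
    have h2 : ∑ ij ∈ antidiagonal n, (f (tElt ij.1) ⊗ₜ[k] f (tElt ij.2) -
        c (tensorSum k x M (ij.1, 0)) ⊗ₜ[k] c (tensorSum k x M (ij.2, 0))) ∈ S := by
      refine Submodule.sum_mem _ fun ij hij => ?_
      have := HasAntidiagonal.mem_antidiagonal.1 hij
      exact hmul (ht _ (by omega)) (ht _ (by omega))
    convert add_mem h2 h1 using 1
    rw [sum_sub_distrib, sub_add_sub_cancel]
  have h1 : ∀ n < M, ∑ ij ∈ antidiagonal n, (f (tuElt ij.1) ⊗ₜ[k] f (tElt ij.2) +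
      f (tElt ij.1) ⊗ₜ[k] f (tuElt ij.2)) -
      TensorProduct.map c c (deconcatenation k L (tensorSum k x M (n, 1))) ∈ S := by
    intro n hn
    have h1 := hΔ (n, 1)
    rw [sum_antidiagonal_prod_one] at h1
    have h2 : ∑ ij ∈ antidiagonal n, ((f (tuElt ij.1) ⊗ₜ[k] f (tElt ij.2) -
        c (tensorSum k x M (ij.1, 1)) ⊗ₜ[k] c (tensorSum k x M (ij.2, 0))) +
        (f (tElt ij.1) ⊗ₜ[k] f (tuElt ij.2) -
        c (tensorSum k x M (ij.1, 0)) ⊗ₜ[k] c (tensorSum k x M (ij.2, 1)))) ∈ S := by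
      refine Submodule.sum_mem _ fun ij hij => ?_
      have := HasAntidiagonal.mem_antidiagonal.1 hij
      exact add_mem (hmul (htu _ (by omega)) (ht _ (by omega)))
        (hmul (ht _ (by omega)) (htu _ (by omega)))
    convert add_mem h2 h1 using 1
    simp only [sum_sub_distrib, sum_add_distrib]
    abel
  rw [pathTensor_apply, map_sum, map_sum, map_sum, ← sum_sub_distrib]
  refine Submodule.sum_mem _ fun n hn => ?_
  have hn' := mem_range.1 hn
  have h2 := add_mem (Submodule.smul_mem _ (a.1 n) (h0 n hn'))
    (Submodule.smul_mem _ (a.2 n) (h1 n hn'))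
  convert h2 using 1
  simp only [intervalComulTerm, LinearMap.coe_mk, AddHom.coe_mk, map_sum, map_add, map_smul,
    TensorProduct.map_tmul, smul_sub, smul_sum, sum_add_distrib, smul_add]
  abel

/-- The filtered map `J → Ĉ(L)` attached to a path. -/
def pathMap {P B : ℕ → L} (h : IsPath F P B) : FilteredMap (interval k) F where
  toLin := pathLinearMap F (pathFamily_mem h)
  map_deg i a ha m := by
    have hs : ∀ n e : ℕ, tensorSum k (pathFamily P B) m (n, e) ∈ tensorDeg A (-(e : ℤ)) := fun n e =>
      Submodule.sum_mem _ fun r _ => tensorPow_mem_tensorDeg (pathFamily_deg h) r (n, e)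
    refine ⟨pathTensor (pathFamily P B) m m a, ?_, rfl⟩
    rw [pathTensor_apply]
    simp only [interval] at ha
    split_ifs at ha with h0 h1
    · have ha' : a.2 = 0 := ha
      rw [h0]
      refine Submodule.sum_mem _ fun n _ => ?_
      rw [ha', Pi.zero_apply, zero_smul, add_zero]
      exact Submodule.smul_mem _ _ (by simpa using hs n 0)
    · have ha' : a.1 = 0 := ha
      rw [h1]
      refine Submodule.sum_mem _ fun n _ => ?_
      rw [ha', Pi.zero_apply, zero_smul, zero_add]
      exact Submodule.smul_mem _ _ (by simpa using hs n 1)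
    · rw [(Submodule.mem_bot k).1 ha]
      simp
  map_fil p a ha := by
    change Submodule.mkQ _ (pathTensor _ p p a) = 0
    rw [pathTensor_apply, sum_eq_zero, map_zero]
    intro n hn
    have := ha n (mem_range.1 hn)
    rw [this.1, this.2, zero_smul, zero_smul, add_zero]
  map_d a := by
    refine Subtype.ext (funext fun m => ?_)
    have hx := pathFamily_mem h
    -- The differential of `J` shifts `t_n u` to `t_(n+1)`: with `m + 2` terms on that side,
    -- removing the vanishing coefficient of `t_0` leaves `m + 1` terms, matching the other side.
    rw [completedTensorCoalgebra_d_level _ (pathLinearMap_level hx le_rfl le_rfl a),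
      pathLinearMap_level hx (by omega : m ≤ m + 2) (by omega : m ≤ m + 1), mkQ_eq_mkQ,
      pathTensor_apply, pathTensor_apply, map_sum, sum_range_succ']
    have h1 : ∀ n, ((interval k).d a).1 (n + 1) = ((n : k) + 1) * a.2 n := fun n => by
      simp [interval]
    have h2 : ∀ n, ((interval k).d a).2 n = 0 := fun n => rfl
    have h3 : ((interval k).d a).1 0 = 0 := by simp [interval]
    simp only [h1, h2, h3, zero_smul, add_zero]
    rw [← sum_sub_distrib]
    refine Submodule.sum_mem _ fun n _ => ?_
    have h4 := lengthFiltration_le F m (add_mem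
      (Submodule.smul_mem _ (a.1 n) ((coderivation_tensorSum_pathFamily h m).1 n))
      (Submodule.smul_mem _ (a.2 n) ((coderivation_tensorSum_pathFamily h m).2 n)))
    convert neg_mem h4 using 1
    rw [map_add, map_smul, map_smul, smul_sub, smul_smul, mul_comm (a.2 n)]
    abel
  map_counit a := by
    change TensorAlgebra.algebraMapInv (R := k) (pathTensor (pathFamily P B) 1 1 a) = a.1 0
    rw [pathTensor_apply, sum_range_one, map_add, map_smul, map_smul,
      counit_tensorSum _ one_ne_zero, counit_tensorSum _ one_ne_zero]
    simp
  map_comul a := by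
    refine Subtype.ext (funext fun M => ?_)
    have hx := pathFamily_mem h
    have h1 : ∀ (b : IntervalSpace k) (t : TensorAlgebra k L), pathTensor (pathFamily P B) M M b = t →
        pathLinearMap F hx b - toCompletion (tensorCoalgebraFiltration F) t ∈
          (completionFiltration (tensorCoalgebraFiltration F)).F M := by
      rintro b t rfl
      change Submodule.mkQ ((tensorCoalgebraFiltration F).F M) (pathTensor (pathFamily P B) M M b) -
        Submodule.mkQ _ (pathTensor (pathFamily P B) M M b) = 0
      exact sub_self _
    exact mkQ_eq_mkQ.2 (map_intervalComulTerm_sub_mem (completionFiltration_zero F)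
      (pathLinearMap F hx) (toCompletion _) (toCompletion_mem _) (pathFamily P B)
      (fun n hn => h1 _ _ (pathTensor_tElt _ hn M)) (fun n hn => h1 _ _ (pathTensor_tuElt _ hn M)) a)
  mem_C a m := by
    refine ⟨pathTensor (pathFamily P B) m m a, ?_, rfl⟩
    rw [pathTensor_apply]
    refine Submodule.sum_mem _ fun n _ => ?_
    exact add_mem (Submodule.smul_mem _ _ (Submodule.sum_mem _ fun r _ =>
        tensorPow_mem_symmetricTensors (pathFamily_deg h) r (Nat.zero_le _)))
      (Submodule.smul_mem _ _ (Submodule.sum_mem _ fun r _ =>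
        tensorPow_mem_symmetricTensors (pathFamily_deg h) r (le_refl 1)))
  filtered p a ha m := by
    have hx := pathFamily_mem h
    -- Lengths below `m + 2` always include length one, so the component of length one can be read
    -- off even for small `m`.
    refine ⟨pathTensor (pathFamily P B) m (m + 2) a, ?_,
      pathLinearMap_level hx le_rfl (by omega) a⟩
    rw [pathTensor_apply, map_sum]
    refine Submodule.sum_mem _ fun n _ => ?_
    rw [map_add, map_smul, map_smul, cogenerator_tensorSum _ (by omega),
      cogenerator_tensorSum _ (by omega)]
    by_cases hn : n < p
    · rw [(ha n hn).1, (ha n hn).2, zero_smul, zero_smul, add_zero]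
      exact zero_mem _
    · exact add_mem (Submodule.smul_mem _ _ (F.anti (not_lt.1 hn) (hx (n, 0))))
        (Submodule.smul_mem _ _ (F.anti (not_lt.1 hn) (hx (n, 1))))

theorem pathMap_zero {P B : ℕ → L} (h : IsPath F P B) :
    (pathMap h).toLin (tElt 0) = groupLike F (P 0) := by
  refine Subtype.ext (funext fun m => ?_)
  refine (pathLinearMap_level (pathFamily_mem h) m.le_succ le_rfl _).trans ?_
  rw [pathTensor_tElt _ m.succ_pos]
  have h1 : ((0, 0) : ℕ × ℕ) = 0 := rfl
  simp only [tensorSum, h1, tensorPow_zero_right]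
  rfl

/-- At level `m`, summing the recursion over all powers of `t` gives `g = 1 + (∑ P_i) g`, and `∑
P_i` acts as `q`. The uniqueness of the geometric series then identifies `g`. -/
theorem pathMap_one {P B : ℕ → L} {p q : L} (h : IsPath F P B) (hpq : PathJoins F P p q) :
    (pathMap h).toLin (fun _ => 1, 0) = groupLike F q := by
  refine Subtype.ext (funext fun m => ?_)
  have hx := pathFamily_mem h
  set g := ((pathMap h).toLin (fun _ => 1, 0)).1 m with hg
  let z : ℕ → TensorAlgebra k L ⧸ (tensorCoalgebraFiltration F).F m := fun n =>
    Submodule.mkQ _ (tensorSum k (pathFamily P B) m (n, 0))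
  -- With `2 * m + 1` terms, `i + j ≥ 2 * m + 1` forces `i ≥ m` or `j ≥ m`, so the omitted products
  -- vanish at level `m`.
  have hgz : g = ∑ n ∈ range (2 * m + 1), z n := by
    refine (pathLinearMap_level hx (by omega : m ≤ 2 * m + 1) le_rfl _).trans ?_
    rw [pathTensor_apply, map_sum]
    simp [z]
  have hz : ∀ n, z n = Submodule.mkQ _ (if n = 0 then 1 else 0) +
      ∑ ij ∈ antidiagonal n, levelMul F m (P ij.1) (z ij.2) := by
    intro n
    have h1 := mkQ_tensorSum_recursion (k := k) (F := F) (pathFamily P B) m (n, 0)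
    rw [sum_antidiagonal_prod_zero] at h1
    refine h1.trans ?_
    congr 2
    simp
  refine eq_sum_pow_of_recursion (p := q) ?_
  have h1 := sum_range_sum_range_sub_mem (⊥ : Submodule k _)
    (fun i j => levelMul F m (P i) (z j)) (2 * m + 1) (fun i _ j _ hij => by
      rw [Submodule.mem_bot]
      rcases (by omega : m ≤ i ∨ m ≤ j) with hi | hj
      · rw [levelMul_eq_zero F (F.anti hi (h.P_mem i)), LinearMap.zero_apply]
      · have h2 : z j = 0 := (Submodule.Quotient.mk_eq_zero _).2
          ((tensorCoalgebraFiltration F).anti hj (tensorSum_mem hx m (j, 0)))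
        rw [h2, map_zero])
  rw [Submodule.mem_bot, sub_eq_zero] at h1
  have h2 : levelMul F m q = levelMul F m (∑ i ∈ range (2 * m + 1), P i) :=
    (levelMul_congr (F.anti (by omega) (hpq.sum (2 * m + 1)))).symm
  have h3 : levelMul F m q g =
      ∑ i ∈ range (2 * m + 1), ∑ j ∈ range (2 * m + 1), levelMul F m (P i) (z j) := by
    rw [h2, hgz, map_sum (levelMul F m), LinearMap.sum_apply]
    exact sum_congr rfl fun i _ => map_sum _ _ _
  rw [h3, h1, hgz, sum_congr rfl fun n _ => hz n, sum_add_distrib]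
  congr 1
  rw [← map_sum, sum_ite_eq_of_mem' _ _ _ (by simp)]

/-- The restriction of a filtered map from `J` to the point `t_0`. -/
def FilteredMap.atZero (h : FilteredMap (interval k) F) : FilteredMap (point k) F where
  toLin := h.toLin.comp (LinearMap.toSpanSingleton k _ (tElt 0))
  map_deg i c hc := by
    simp only [point] at hc
    split_ifs at hc with h0
    · exact h.map_deg i _ (by rw [h0]; simp [interval, tElt])
    · rw [(Submodule.mem_bot k).1 hc, map_zero]
      exact zero_mem _
  map_fil p c hc := by
    by_cases hp : p = 0
    · subst hp
      exact h.map_fil 0 fun i hi => absurd hi (Nat.not_lt_zero i)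
    · have hc' : c = 0 := by simpa [point, pointFiltration, hp] using hc
      rw [hc']
      exact zero_mem _
  map_d c := by
    have h1 : (interval k).d (c • tElt 0) = 0 := by
      rw [map_smul]
      have h3 : (interval k).d (tElt 0) = 0 := by
        simp only [interval, tElt, LinearMap.coe_mk, AddHom.coe_mk, Pi.zero_apply, mul_zero]
        rfl
      rw [h3, smul_zero]
    have h2 := h.map_d (c • tElt 0)
    rw [h1, map_zero] at h2
    refine Eq.trans ?_ h2
    exact map_zero _
  map_counit c := by
    refine (h.map_counit (c • tElt 0)).trans ?_
    simp [interval, point, tElt]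
  map_comul c := by
    refine Eq.trans (Subtype.ext (funext fun M => ?_)) (h.map_comul (c • tElt 0))
    have h1 : (tElt 0 ⊗ₜ[k] (c • tElt 0) : IntervalSpace k ⊗[k] IntervalSpace k) -
        ∑ n ∈ range M, intervalComulTerm n (c • tElt 0) ∈
          (tensorFiltration (intervalFiltration k) (intervalFiltration k)).F M := by
      simp only [map_smul, intervalComulTerm_tElt]
      -- For `M = 0` the truncated coproduct is empty, but `F_0` contains every tensor that is
      -- compared.
      rcases M with _ | M
      · rw [range_zero, sum_empty, sub_zero]
        exact Submodule.subset_span ⟨0, 0, le_rfl, _, tElt_mem 0, _,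
          Submodule.smul_mem _ _ (tElt_mem 0), rfl⟩
      · rw [← smul_sum, sum_ite_eq_of_mem' _ _ _ (by simp)]
        simp
    have h2 := tensorFiltration_map _ _ _ _ h.toLin h.toLin h.map_fil h.map_fil M h1
    rw [Submodule.mem_comap, map_sub] at h2
    have h3 : LinearMap.toSpanSingleton k (IntervalSpace k) (tElt 0) 1 = tElt 0 := one_smul _ _
    refine Eq.trans ?_ (mkQ_eq_mkQ.2 h2)
    change Submodule.mkQ _ (TensorProduct.map (h.toLin.comp (LinearMap.toSpanSingleton k _ (tElt 0)))
      (h.toLin.comp (LinearMap.toSpanSingleton k _ (tElt 0))) (1 ⊗ₜ[k] c)) = _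
    rw [TensorProduct.map_tmul, TensorProduct.map_tmul, LinearMap.comp_apply, h3]
    rfl
  mem_C c := h.mem_C _
  filtered p c hc := by
    by_cases hp : p = 0
    · subst hp
      exact h.filtered 0 _ fun i hi => absurd hi (Nat.not_lt_zero i)
    · have hc' : c = 0 := by simpa [point, pointFiltration, hp] using hc
      rw [hc', map_zero, ← map_zero h.toLin]
      exact h.filtered p 0 (zero_mem _)

omit [CharZero k] in
theorem FilteredMap.atZero_one (h : FilteredMap (interval k) F) :
    h.atZero.toLin 1 = h.toLin (tElt 0) :=
  congrArg h.toLin (one_smul k (tElt 0 : IntervalSpace k))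

end FromPaths

/-! ### The classifying maps and the main theorem -/

section Classification

variable {k : Type*} [Field k] [CharZero k] {L : Type*} [AddCommGroup L] [Module k L]
variable {A : DGLieAlgebra k L} {F : CompleteFiltration A}

-- Restricting the filtered map of the constant path to `t_0` yields `χ(p)`, so the axioms of a
-- filtered map need not be checked again for the point.
omit [CharZero k] in
theorem isPath_const (F : CompleteFiltration A) (p : MaurerCartan A) :
    IsPath F (fun n => if n = 0 then p.1 else 0) 0 where
  P_deg n := by
    split_ifs
    exacts [p.2.1, zero_mem _]
  P_mem n := by
    split_ifs with h
    · rw [h, F.F_zero]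
      exact Submodule.mem_top
    · exact zero_mem _
  B_deg _ := zero_mem _
  B_mem _ := zero_mem _
  maurerCartan n := by
    rcases n with _ | n
    · simpa [seriesBracket] using p.2.2
    · have h : ∀ ij ∈ Finset.HasAntidiagonal.antidiagonal (n + 1), A.bracket (if ij.1 = 0 then p.1 else 0)
          (if ij.2 = 0 then p.1 else 0) = 0 := by
        intro ij hij
        have h := Finset.HasAntidiagonal.mem_antidiagonal.1 hij
        rcases (by omega : ij.1 ≠ 0 ∨ ij.2 ≠ 0) with h | h <;> simp [h]
      rw [seriesBracket, Finset.sum_congr rfl h]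
      simp
  flow n := by simp [seriesBracket]

/-- The classifying map `χ(p)`. -/
def classifyingMap (F : CompleteFiltration A) (p : MaurerCartan A) : FilteredMap (point k) F :=
  (pathMap (isPath_const F p)).atZero

theorem isClassifyingMap_classifyingMap (p : MaurerCartan A) :
    IsClassifyingMap p (classifyingMap F p) :=
  (pathMap (isPath_const F p)).atZero_one.trans (pathMap_zero (isPath_const F p))

omit [CharZero k] in
theorem FilteredMap.point_ext {f g : FilteredMap (point k) F} (h : f.toLin 1 = g.toLin 1) :
    f = g := by
  have h' : f.toLin = g.toLin := LinearMap.ext_ring h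
  obtain ⟨⟨f, _, _, _, _, _⟩, _, _⟩ := f
  obtain ⟨⟨g, _, _, _, _, _⟩, _, _⟩ := g
  cases h'
  rfl

theorem homotopic_iff {p q : MaurerCartan A} {f g : FilteredMap (point k) F}
    (hf : IsClassifyingMap p f) (hg : IsClassifyingMap q g) :
    Homotopic f g ↔ GaugeEquivalent F p q := by
  constructor
  · rintro ⟨h, h0, h1⟩
    obtain ⟨P, B, hP, hpq⟩ := h.exists_path p.2.1 (h0.trans hf) (h1.trans hg)
    exact hP.exists_gaugeAct hpq
  · rintro ⟨b, hb, h⟩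
    obtain ⟨P, B, hP, hpq⟩ := exists_path_of_gaugeAct hb p.2.1 p.2.2 h
    refine ⟨pathMap hP, ?_, (pathMap_one hP hpq).trans hg.symm⟩
    rw [pathMap_zero, hpq.zero]
    exact hf.symm

/-- Every filtered map from the point is a classifying map, so the three properties are transported
from gauge equivalence and no homotopies have to be reversed or concatenated. -/
theorem homotopic_equivalence (F : CompleteFiltration A) : Equivalence (Homotopic (F := F)) := by
  have h := gaugeEquivalent_equivalence F
  refine ⟨fun f => ?_, fun {f g} hfg => ?_, fun {f g e} hfg hge => ?_⟩
  · obtain ⟨p, hp⟩ := f.exists_eq_groupLike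
    exact (homotopic_iff hp hp).2 (h.refl p)
  · obtain ⟨p, hp⟩ := f.exists_eq_groupLike
    obtain ⟨q, hq⟩ := g.exists_eq_groupLike
    exact (homotopic_iff hq hp).2 (h.symm ((homotopic_iff hp hq).1 hfg))
  · obtain ⟨p, hp⟩ := f.exists_eq_groupLike
    obtain ⟨q, hq⟩ := g.exists_eq_groupLike
    obtain ⟨r, hr⟩ := e.exists_eq_groupLike
    exact (homotopic_iff hp hr).2
      (h.trans ((homotopic_iff hp hq).1 hfg) ((homotopic_iff hq hr).1 hge))

/-- The map from the moduli set to homotopy classes induced by `p ↦ χ(p)`. -/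
def classifyingClass (F : CompleteFiltration A) : ModuliSet F → HomotopyClasses F :=
  Quot.map (classifyingMap F) fun p q h =>
    (homotopic_iff (isClassifyingMap_classifyingMap p) (isClassifyingMap_classifyingMap q)).2 h

theorem classifyingClass_bijective (F : CompleteFiltration A) :
    Function.Bijective (classifyingClass F) := by
  constructor
  · rintro ⟨p⟩ ⟨q⟩ h
    -- Equality in the quotient only gives the generated equivalence relation, which here is
    -- homotopy itself.
    have h1 := (homotopic_equivalence F).eqvGen_iff.1 (Quot.eqvGen_exact h)
    exact Quot.sound ((homotopic_iff (isClassifyingMap_classifyingMap p)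
      (isClassifyingMap_classifyingMap q)).1 h1)
  · rintro ⟨f⟩
    obtain ⟨p, hp⟩ := f.exists_eq_groupLike
    refine ⟨Quot.mk _ p, congrArg (Quot.mk _) (FilteredMap.point_ext ?_)⟩
    exact (isClassifyingMap_classifyingMap p).trans hp.symm

end Classification

end HomotopyModuli

end

theorem mainTheorem3 {k : Type*} [Field k] [CharZero k] {L : Type*} [AddCommGroup L] [Module k L]
    (A : HomotopyModuli.DGLieAlgebra k L) (F : HomotopyModuli.CompleteFiltration A) :
    Equivalence (HomotopyModuli.GaugeEquivalent F) ∧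
    Equivalence (HomotopyModuli.Homotopic (F := F)) ∧
    ∃ Φ : HomotopyModuli.ModuliSet F → HomotopyModuli.HomotopyClasses F,
      Function.Bijective Φ ∧
      ∀ p : HomotopyModuli.MaurerCartan A,
        ∃ f : HomotopyModuli.FilteredMap (HomotopyModuli.point k) F,
          HomotopyModuli.IsClassifyingMap p f ∧ Φ (Quot.mk _ p) = Quot.mk _ f :=
  ⟨HomotopyModuli.gaugeEquivalent_equivalence F, HomotopyModuli.homotopic_equivalence F,
    HomotopyModuli.classifyingClass F, HomotopyModuli.classifyingClass_bijective F,
    fun p => ⟨HomotopyModuli.classifyingMap F p,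
      HomotopyModuli.isClassifyingMap_classifyingMap p, rfl⟩⟩
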